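/- Let $(X,\mathcal B,\mu)$ be a standard probability space, i.e. a standard Borel space with a non-atomic probability measure (so it is isomorphic to $[0,1]$ with Lebesgue measure). Let $\mathcal E$ be the set of ergodic invertible measure-preserving transformations of $(X,\mathcal B,\mu)$, and let $L^0$ be the space of real-valued measurable functions on $X$; equations between functions are understood $\mu$-almost everywhere. The weak topology on $\mathcal E$ has as a subbase the sets $\{T\in\mathcal E:\mu(TA\,\triangle\,SA)<\varepsilon\}$ with $S\in\mathcal E$, $A\in\mathcal B$, $\varepsilon>0$; the uniform topology on $\mathcal E$ is the one of the metric $d(S,T)=\mu(\{x: Sx\ne Tx\})$ (transformations that agree almost everywhere being identified). Let $f\in L^0$. (i) If $\mu(\{x: f(x)\neq 0\})>0$, then the set of all $T\in\mathcal E$ for which there is a measurable $g:X\to\mathbb R$ with $f=g-g\circ T$ is meager (of first category) in $\mathcal E$, both for the weak topology and for the uniform topology. (ii) There exist $T\in\mathcal E$ and $g\in L^0$ with $f=g-g\circ T$ if and only if $$\int_{\{f>0\}} f\,d\mu=\int_{\{f<0\}}(-f)\,d\mu$$ as elements of $[0,\infty]$, that is, both integrals are finite and equal or both are infinite. -/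

import Mathlib

open MeasureTheory
open scoped ENNReal symmDiff

/-- The family of ergodic invertible measure preserving transformations of `(X, μ)`
(`Ergodic` includes that `T` preserves `μ`). -/
abbrev ErgodicAut {X : Type*} [MeasurableSpace X] (μ : Measure X) : Type _ :=
  {T : X ≃ᵐ X // Ergodic (T : X → X) μ}

namespace ErgodicAut

/-- The weak (coarse) topology: the sets `{T | μ (T A ∆ S A) < ε}`, with `A` measurable and
`ε > 0`, form a subbase. Transformations that agree almost everywhere are topologically
indistinguishable, so passing to the quotient by a.e. equality changes neither the open sets nor
the meager sets. -/
abbrev weakTopology {X : Type*} [MeasurableSpace X] (μ : Measure X) :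
    TopologicalSpace (ErgodicAut μ) :=
  TopologicalSpace.generateFrom
    {U | ∃ (S : ErgodicAut μ) (A : Set X) (ε : ℝ≥0∞), MeasurableSet A ∧ 0 < ε ∧
      U = {T : ErgodicAut μ | μ ((T.1 '' A) ∆ (S.1 '' A)) < ε}}

/-- The uniform topology, given by the pseudometric `d(S, T) = μ {x | T x ≠ S x}`: it is generated
by the balls. -/
abbrev uniformTopology {X : Type*} [MeasurableSpace X] (μ : Measure X) :
    TopologicalSpace (ErgodicAut μ) :=
  TopologicalSpace.generateFrom
    {U | ∃ (S : ErgodicAut μ) (ε : ℝ≥0∞), 0 < ε ∧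
      U = {T : ErgodicAut μ | μ {x | T.1 x ≠ S.1 x} < ε}}

end ErgodicAut

/-- The pair `(T, g)` solves the coboundary equation `f = g - g ∘ T` almost everywhere, with a
measurable transfer function `g`. -/
def IsCoboundarySolution {X : Type*} [MeasurableSpace X] (μ : Measure X) (f : X → ℝ)
    (T : ErgodicAut μ) (g : X → ℝ) : Prop :=
  Measurable g ∧ ∀ᵐ x ∂μ, f x = g x - g (T.1 x)

/-! Necessity in (ii): for `f = g - g ∘ T`, truncating `g` at `±n` gives bounded coboundaries with
integral zero, and their positive and negative parts increase to those of `f`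
(`lintegral_coboundary`).

Sufficiency: equality of the two integrals lets `X` be exhausted up to a null set by increasing sets
`Y n` on which `f` is bounded with integral zero (`exists_exhaustions`). The transformation is a
limit of partial ones. Each stage is a partition of `X` into finite columns (`Columns`), where the
map is settled except at the tops, and each stage concatenates columns of the preceding one. The
transfer function at a point is minus the sum of `f` over the lower levels of its column. Two ways
of concatenating alternate. Halving (`exists_ext_halve`) pairs large positive column sums with large
negative ones and cancels the remaining one-sided excess greedily; as the mean is zero, the supply
suffices. Mixing (`exists_ext_mix`) cuts the bases into many cells of equal mass, sorted by how far
a column exceeds its share of a given set `A`, and lets each new column pass once through every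
cell, so that unions of columns become almost independent of `A`. Both change the transfer function
by at most a constant times the current bound for the column sums. On `Y k` these bounds are `2⁻ᵏ`,
so the transfer functions converge. As `A` runs through a generating π-system, each member
infinitely often, an invariant set becomes independent of every `A`, hence trivial
(`preErgodic_of_mixed`). The outcome is `exists_ergodic_of_columns`.

For (i), Birkhoff sums of a coboundary are `g - g ∘ T^[n]`, hence bounded in probability, so the set
in question lies in the union over `K : ℕ` of the sets `boundedBirkhoff μ f K`. These are closed in
the weak topology, hence in the finer uniform one, and it suffices that they contain no uniform ball
(`exists_near_abs_birkhoffSum_large`). Near a given `T`, take a Rokhlin tower over whose base the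
sums of `f` do not vanish almost everywhere, cut the base into equal pieces, and stack the columns
so that, up to a sign, many with nonnegative sum are consecutive and enough of them have sum bounded
below. The stack has large Birkhoff sums on a set of measure above `1 / 8`. It is completed to an
ergodic transformation by `exists_ergodic_of_columns` again, now for the function zero. -/

namespace Coboundary

open Set Filter Topology

/-! ### Isomorphisms of nonatomic standard probability spaces. -/

section Isomorphism

variable {X Y : Type*} [MeasurableSpace X] [MeasurableSpace Y]

/-- A measurable bijection of standard Borel spaces is a measurable equivalence. -/
noncomputable def equivOfBijective [StandardBorelSpace X] [StandardBorelSpace Y]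
    (F : X → Y) (hF : Measurable F) (hb : Function.Bijective F) : X ≃ᵐ Y where
  toEquiv := Equiv.ofBijective F hb
  measurable_toFun := hF
  measurable_invFun := by
    have he : MeasurableEmbedding F := hF.measurableEmbedding hb.1
    intro s hs
    have : (Equiv.ofBijective F hb).symm ⁻¹' s = F '' s := by
      rw [← Equiv.image_eq_preimage_symm]; rfl
    rw [this]
    exact he.measurableSet_image.2 hs

lemma not_countable_of_measure_pos {μ : Measure X} [NullSingletonClass μ] {S : Set X}
    (h : μ S ≠ 0) : ¬ S.Countable := fun hc => h (hc.measure_zero μ)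

/-- `S` is Borel isomorphic to the plane. The vertical lines are uncountably many disjoint
uncountable sets, and only countably many of them have positive measure. The null set serves as
spare room when an injection is modified into a bijection. -/
lemma exists_null_uncountable_subset [StandardBorelSpace X] (μ : Measure X) [IsFiniteMeasure μ]
    {S : Set X} (hS : MeasurableSet S) (hc : ¬ S.Countable) :
    ∃ Z ⊆ S, MeasurableSet Z ∧ ¬ Z.Countable ∧ μ Z = 0 := by
  have := hS.standardBorel
  have hR : ¬ (univ : Set ℝ).Countable := Cardinal.not_countable_real
  have hR' : ¬ Countable ℝ := fun h => hR (Set.countable_univ_iff.2 h)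
  have hRR : ¬ Countable (ℝ × ℝ) := fun h =>
    hR' (Function.Injective.countable (f := fun t : ℝ => ((t, 0) : ℝ × ℝ))
      (fun a b hab => (Prod.mk.inj hab).1))
  let e : S ≃ᵐ ℝ × ℝ := PolishSpace.measurableEquivOfNotCountable
    (fun h => hc (Set.countable_coe_iff.1 h)) hRR
  let Z : ℝ → Set X := fun t => Subtype.val '' (e ⁻¹' {q | q.1 = t})
  have hZm : ∀ t, MeasurableSet (Z t) := fun t =>
    (MeasurableEmbedding.subtype_coe hS).measurableSet_image.2
      (e.measurable (measurable_fst (measurableSet_singleton t)))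
  have hZd : Pairwise (Function.onFun Disjoint Z) := by
    intro s t hst
    refine Set.disjoint_left.2 ?_
    rintro _ ⟨x, hx, rfl⟩ ⟨y, hy, hxy⟩
    have : y = x := Subtype.ext hxy
    subst this
    exact hst (hx.symm.trans hy)
  have hcount := Measure.countable_meas_pos_of_disjoint_iUnion (μ := μ) hZm hZd
  obtain ⟨t, ht⟩ : ∃ t, t ∉ {i | 0 < μ (Z i)} := by
    by_contra! h
    exact hR (hcount.mono fun t _ => h t)
  refine ⟨Z t, ?_, hZm t, ?_, by simpa using ht⟩
  · rintro _ ⟨x, _, rfl⟩; exact x.2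
  · intro hcZ
    apply hR'
    have hinj : Function.Injective
        (fun s : ℝ => (⟨(e.symm (t, s) : S), ⟨e.symm (t, s), by simp, rfl⟩⟩ : Z t)) := by
      intro a b hab
      have h1 : ((e.symm (t, a) : S) : X) = (e.symm (t, b) : S) :=
        congrArg (fun z : Z t => (z : X)) hab
      have h2 := e.symm.injective (Subtype.ext h1)
      exact (Prod.mk.inj h2).2
    have : Countable (Z t) := hcZ.to_subtype
    exact hinj.countable

/-- A measurable map which is injective on a conull set agrees almost everywhere with a measurable
equivalence. -/
lemma exists_measurableEquiv_ae_eq [StandardBorelSpace X] [StandardBorelSpace Y]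
    {μ : Measure X} [IsProbabilityMeasure μ] [NullSingletonClass μ] {F : X → Y}
    (hF : Measurable F) {X₀ : Set X} (hX₀ : MeasurableSet X₀) (hμ : μ X₀ᶜ = 0)
    (hinj : InjOn F X₀) : ∃ e : X ≃ᵐ Y, ∀ᵐ x ∂μ, e x = F x := by
  classical
  have hpos : μ X₀ ≠ 0 := by
    have := prob_compl_eq_zero_iff (μ := μ) hX₀
    rw [this.1 hμ]; exact one_ne_zero
  obtain ⟨Z, hZX, hZm, hZc, hZ0⟩ :=
    exists_null_uncountable_subset μ hX₀ (not_countable_of_measure_pos hpos)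
  -- Giving up `Z` makes the complements of domain and range both uncountable: they contain `Z` and
  -- `F '' Z`. Uncountable standard Borel spaces are isomorphic, so `F` on `X₁` extends to an
  -- equivalence.
  set X₁ := X₀ \ Z with hX₁
  have hX₁m : MeasurableSet X₁ := hX₀.diff hZm
  have := hX₁m.standardBorel
  have hemb : MeasurableEmbedding (X₁.domRestrict F) :=
    (hF.comp measurable_subtype_coe).measurableEmbedding
      (fun a b hab => Subtype.ext (hinj a.2.1 b.2.1 hab))
  have hYm : MeasurableSet (range (X₁.domRestrict F)) := hemb.measurableSet_range
  have := hX₁m.compl.standardBorel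
  have := hYm.compl.standardBorel
  have hXc : ¬ Countable (X₁ᶜ : Set X) := fun h =>
    hZc ((Set.countable_coe_iff.1 h).mono (show Z ⊆ X₁ᶜ from fun x hx hx' => hx'.2 hx))
  have hYc : ¬ Countable ((range (X₁.domRestrict F))ᶜ : Set Y) := by
    intro h
    have h1 : (F '' Z).Countable := (Set.countable_coe_iff.1 h).mono (by
      rintro _ ⟨z, hz, rfl⟩ ⟨x, hx⟩
      have : (x : X) = z := hinj x.2.1 (hZX hz) hx
      exact x.2.2 (this ▸ hz))
    exact hZc (Set.countable_of_injective_of_countable_image (hinj.mono hZX) h1)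
  let a := hemb.equivRange
  let h : (X₁ᶜ : Set X) ≃ᵐ ((range (X₁.domRestrict F))ᶜ : Set Y) :=
    PolishSpace.measurableEquivOfNotCountable hXc hYc
  refine ⟨(MeasurableEquiv.sumCompl hX₁m).symm.trans
    ((MeasurableEquiv.sumCongr a h).trans (MeasurableEquiv.sumCompl hYm)), ?_⟩
  have hnull : μ X₁ᶜ = 0 := by
    refine measure_mono_null (t := X₀ᶜ ∪ Z) ?_ (measure_union_null hμ hZ0)
    intro x hx
    by_cases hx0 : x ∈ X₀
    · right; by_contra hz; exact hx ⟨hx0, hz⟩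
    · exact Or.inl hx0
  filter_upwards [compl_mem_ae_iff.2 hnull] with x hx
  have hx1 : x ∈ X₁ := by simpa using hx
  have : (MeasurableEquiv.sumCompl hX₁m).symm x = Sum.inl ⟨x, hx1⟩ := by
    rw [MeasurableEquiv.symm_apply_eq]; rfl
  simp only [MeasurableEquiv.trans_apply, this]
  have h1 : (MeasurableEquiv.sumCongr a h) (Sum.inl ⟨x, hx1⟩) = Sum.inl (a ⟨x, hx1⟩) := rfl
  rw [h1]
  have h2 : ∀ y : range (X₁.domRestrict F), MeasurableEquiv.sumCompl hYm (Sum.inl y) = (y : Y) :=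
    fun y => rfl
  rw [h2, MeasurableEmbedding.equivRange_apply]
  rfl

lemma continuous_cdf (ρ : Measure ℝ) [IsProbabilityMeasure ρ] [NullSingletonClass ρ] :
    Continuous (ProbabilityTheory.cdf ρ) := by
  rw [continuous_iff_continuousAt]
  intro x
  rw [(ProbabilityTheory.monotone_cdf ρ).continuousAt_iff_leftLim_eq_rightLim,
    StieltjesFunction.rightLim_eq]
  have h := (ProbabilityTheory.cdf ρ).measure_singleton x
  rw [ProbabilityTheory.measure_cdf, measure_singleton] at h
  have h1 := ENNReal.ofReal_eq_zero.1 h.symm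
  have h2 := (ProbabilityTheory.monotone_cdf ρ).leftLim_le (le_refl x)
  linarith

/-- By inner regularity a level set of positive measure would contain a compact set of positive
measure. That set lies between its least and its greatest point, where the distribution function
does not grow. -/
lemma cdf_level_null (ρ : Measure ℝ) [IsProbabilityMeasure ρ] [NullSingletonClass ρ] (c : ℝ) :
    ρ {y | ProbabilityTheory.cdf ρ y = c} = 0 := by
  by_contra hne
  have hm : MeasurableSet {y | ProbabilityTheory.cdf ρ y = c} :=
    (continuous_cdf ρ).measurable (measurableSet_singleton c)
  obtain ⟨K, hKs, hKc, hK⟩ := hm.exists_lt_isCompact (pos_iff_ne_zero.2 hne)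
  have hKne : K.Nonempty := nonempty_of_measure_ne_zero hK.ne'
  obtain ⟨a, ha⟩ := hKc.exists_isLeast hKne
  obtain ⟨b, hb⟩ := hKc.exists_isGreatest hKne
  have h1 : ρ K ≤ ρ (Ioc a b) := by
    refine (measure_mono (t := Icc a b) fun x hx => ⟨ha.2 hx, hb.2 hx⟩).trans ?_
    exact (measure_congr Ioc_ae_eq_Icc).ge
  have h2 : ρ (Ioc a b) = 0 := by
    have := (ProbabilityTheory.cdf ρ).measure_Ioc a b
    rw [ProbabilityTheory.measure_cdf] at this
    rw [this, hKs ha.1, hKs hb.1]; simp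
  exact absurd (h1.trans h2.le) (not_le.2 hK)

/-- The probability integral transform. For `0 < t < 1` continuity gives `x` with value `t`, and the
preimage of `Iic t` differs from `Iic x` only within a null level set. -/
lemma map_cdf (ρ : Measure ℝ) [IsProbabilityMeasure ρ] [NullSingletonClass ρ] :
    ρ.map (ProbabilityTheory.cdf ρ) = volume.restrict (Icc 0 1) := by
  have hm : Measurable (ProbabilityTheory.cdf ρ) := (continuous_cdf ρ).measurable
  have : IsFiniteMeasure (ρ.map (ProbabilityTheory.cdf ρ)) := inferInstance
  refine Measure.ext_of_Iic _ _ fun t => ?_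
  rw [Measure.map_apply hm measurableSet_Iic, Measure.restrict_apply measurableSet_Iic]
  rcases lt_trichotomy t 0 with ht | rfl | ht
  · have h1 : ProbabilityTheory.cdf ρ ⁻¹' Iic t = ∅ := by
      ext x; simp only [mem_preimage, mem_Iic, mem_empty_iff_false, iff_false, not_le]
      exact ht.trans_le (ProbabilityTheory.cdf_nonneg ρ x)
    have h2 : Iic t ∩ Icc 0 1 = (∅ : Set ℝ) := by
      ext x; simp only [mem_inter_iff, mem_Iic, mem_Icc, mem_empty_iff_false, iff_false]
      rintro ⟨h, h', _⟩; linarith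
    rw [h1, h2]; simp
  · have h1 : ProbabilityTheory.cdf ρ ⁻¹' Iic 0 = {y | ProbabilityTheory.cdf ρ y = 0} := by
      ext x; simp only [mem_preimage, mem_Iic, mem_ofPred_eq]
      exact ⟨fun h => le_antisymm h (ProbabilityTheory.cdf_nonneg ρ x), fun h => h.le⟩
    have h2 : Iic 0 ∩ Icc 0 1 = ({0} : Set ℝ) := by
      ext x; simp only [mem_inter_iff, mem_Iic, mem_Icc, mem_singleton_iff]
      exact ⟨fun h => le_antisymm h.1 h.2.1, fun h => by subst h; simp⟩
    rw [h1, h2, cdf_level_null]; simp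
  · rcases le_or_gt 1 t with h1t | ht1
    · have h1 : ProbabilityTheory.cdf ρ ⁻¹' Iic t = univ := by
        ext x; simp only [mem_preimage, mem_Iic, mem_univ, iff_true]
        exact (ProbabilityTheory.cdf_le_one ρ x).trans h1t
      have h2 : Iic t ∩ Icc 0 1 = Icc (0 : ℝ) 1 :=
        inter_eq_right.2 fun x hx => hx.2.trans h1t
      rw [h1, h2]; simp
    · obtain ⟨x, hx⟩ : t ∈ range (ProbabilityTheory.cdf ρ) := by
        refine mem_range_of_exists_le_of_exists_ge (continuous_cdf ρ) ?_ ?_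
        · exact ((ProbabilityTheory.tendsto_cdf_atBot ρ).eventually (ge_mem_nhds ht)).exists
        · exact ((ProbabilityTheory.tendsto_cdf_atTop ρ).eventually (le_mem_nhds ht1)).exists
      have h2 : Iic t ∩ Icc 0 1 = Icc (0 : ℝ) t := by
        ext y; simp only [mem_inter_iff, mem_Iic, mem_Icc]
        constructor
        · rintro ⟨h, h', _⟩; exact ⟨h', h⟩
        · rintro ⟨h, h'⟩; exact ⟨h', h, h'.trans ht1.le⟩
      have h3 : ρ (ProbabilityTheory.cdf ρ ⁻¹' Iic t) = ρ (Iic x) := by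
        refine le_antisymm ?_ (measure_mono fun y hy => ?_)
        · have hsub : ProbabilityTheory.cdf ρ ⁻¹' Iic t ⊆
              Iic x ∪ {y | ProbabilityTheory.cdf ρ y = t} := by
            intro y hy
            rcases le_total y x with h | h
            · exact Or.inl h
            · right
              exact le_antisymm hy (hx ▸ ProbabilityTheory.monotone_cdf ρ h)
          refine (measure_mono hsub).trans ((measure_union_le _ _).trans ?_)
          rw [cdf_level_null, add_zero]
        · show ProbabilityTheory.cdf ρ y ≤ t
          rw [← hx]; exact ProbabilityTheory.monotone_cdf ρ hy
      rw [h3, h2, Real.volume_Icc, ← ProbabilityTheory.ofReal_cdf, hx, sub_zero]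

/-- A nonatomic standard probability space is isomorphic to the unit interval. -/
lemma exists_equiv_unitInterval [StandardBorelSpace X] (μ : Measure X) [IsProbabilityMeasure μ]
    [NullSingletonClass μ] :
    ∃ e : X ≃ᵐ ℝ, μ.map e = volume.restrict (Icc 0 1) := by
  have hX : ¬ Countable X := fun h => by
    have := not_countable_of_measure_pos (μ := μ) (S := univ) (by simp)
    exact this (Set.countable_univ_iff.2 h)
  have hR' : ¬ Countable ℝ := fun h => Cardinal.not_countable_real (Set.countable_univ_iff.2 h)
  let i : X ≃ᵐ ℝ := PolishSpace.measurableEquivOfNotCountable hX hR'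
  set ρ := μ.map i with hρ
  have : IsProbabilityMeasure ρ := Measure.isProbabilityMeasure_map i.measurable.aemeasurable
  have : NullSingletonClass ρ := ⟨fun x => by
    rw [hρ, i.map_apply]
    have : i ⁻¹' {x} = {i.symm x} := by
      ext y; simp [MeasurableEquiv.eq_symm_apply]
    rw [this]; exact measure_singleton _⟩
  have hm : Measurable (ProbabilityTheory.cdf ρ) := (continuous_cdf ρ).measurable
  -- Two points with the same value of the distribution function enclose a rational with that value,
  -- so the function is injective off this countable union of level sets.
  let N : Set ℝ := ⋃ q : ℚ, {y | ProbabilityTheory.cdf ρ y = ProbabilityTheory.cdf ρ q}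
  have hN : MeasurableSet N := MeasurableSet.iUnion fun q => hm (measurableSet_singleton _)
  have hN0 : ρ N = 0 := measure_iUnion_null fun q => cdf_level_null ρ _
  have hinj : InjOn (fun x => ProbabilityTheory.cdf ρ (i x)) (i ⁻¹' Nᶜ) := by
    have key : ∀ a b : ℝ, a ∈ Nᶜ → a < b →
        ProbabilityTheory.cdf ρ a ≠ ProbabilityTheory.cdf ρ b := by
      intro a b ha hab heq
      obtain ⟨q, hq1, hq2⟩ := exists_rat_btwn hab
      apply ha
      refine mem_iUnion.2 ⟨q, ?_⟩
      exact le_antisymm (ProbabilityTheory.monotone_cdf ρ hq1.le)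
        (heq ▸ ProbabilityTheory.monotone_cdf ρ hq2.le)
    intro x hx y hy hxy
    by_contra hne
    have hne' : i x ≠ i y := fun h => hne (i.injective h)
    rcases lt_or_gt_of_ne hne' with h | h
    · exact key _ _ hx h hxy
    · exact key _ _ hy h hxy.symm
  obtain ⟨e, he⟩ := exists_measurableEquiv_ae_eq (μ := μ) (hm.comp i.measurable)
    (i.measurable hN.compl) (by
      have : (i ⁻¹' Nᶜ)ᶜ = i ⁻¹' N := by ext; simp
      rw [this, ← i.map_apply]; exact hN0) hinj
  refine ⟨e, ?_⟩
  rw [Measure.map_congr he, ← map_cdf ρ, hρ, Measure.map_map hm i.measurable]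

lemma cond_nullSingletonClass (μ : Measure X) [NullSingletonClass μ] {S : Set X} :
    NullSingletonClass (ProbabilityTheory.cond μ S) :=
  ⟨fun x => ProbabilityTheory.cond_absolutelyContinuous (measure_singleton x)⟩

/-- The conditional measure on `S` is isomorphic to Lebesgue measure on the unit interval, where an
initial interval has any prescribed length. -/
lemma exists_subset_measure_eq [StandardBorelSpace X] (μ : Measure X) [IsFiniteMeasure μ]
    [NullSingletonClass μ] {S : Set X} (hS : MeasurableSet S) {t : ℝ≥0∞} (ht : t ≤ μ S) :
    ∃ S' ⊆ S, MeasurableSet S' ∧ μ S' = t := by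
  rcases eq_or_ne (μ S) 0 with h0 | h0
  · exact ⟨∅, empty_subset _, .empty, by simp [le_antisymm (ht.trans h0.le) bot_le]⟩
  have hfin : μ S ≠ ∞ := measure_ne_top μ S
  have : IsProbabilityMeasure (ProbabilityTheory.cond μ S) :=
    ProbabilityTheory.cond_isProbabilityMeasure h0
  have := cond_nullSingletonClass μ (S := S)
  obtain ⟨e, he⟩ := exists_equiv_unitInterval (ProbabilityTheory.cond μ S)
  have htr : (t / μ S).toReal ≤ 1 := by
    refine ENNReal.toReal_le_of_le_ofReal zero_le_one ?_
    rw [ENNReal.ofReal_one]; exact ENNReal.div_le_of_le_mul (by simpa using ht)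
  refine ⟨S ∩ e ⁻¹' Iic (t / μ S).toReal, inter_subset_left,
    hS.inter (e.measurable measurableSet_Iic), ?_⟩
  have h1 : ProbabilityTheory.cond μ S (e ⁻¹' Iic (t / μ S).toReal) = t / μ S := by
    rw [← e.map_apply, he, Measure.restrict_apply measurableSet_Iic]
    have h2 : Iic (t / μ S).toReal ∩ Icc 0 1 = Icc (0 : ℝ) (t / μ S).toReal := by
      ext y; simp only [mem_inter_iff, mem_Iic, mem_Icc]
      constructor
      · rintro ⟨h, h', _⟩; exact ⟨h', h⟩
      · rintro ⟨h, h'⟩; exact ⟨h', h, h'.trans htr⟩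
    rw [h2, Real.volume_Icc, sub_zero, ENNReal.ofReal_toReal]
    exact ENNReal.div_ne_top (ne_top_of_le_ne_top hfin ht) h0
  rw [ProbabilityTheory.cond_apply hS] at h1
  rw [← one_mul (μ (S ∩ _)), ← ENNReal.mul_inv_cancel h0 hfin, mul_assoc, h1,
    ENNReal.mul_div_cancel h0 hfin]

lemma exists_measure_eq_between [StandardBorelSpace X] (μ : Measure X) [IsFiniteMeasure μ]
    [NullSingletonClass μ] {S S' : Set X} (hS : MeasurableSet S) (hS' : MeasurableSet S')
    (hsub : S ⊆ S') {t : ℝ≥0∞} (ht : μ S ≤ t) (ht' : t ≤ μ S') :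
    ∃ R, S ⊆ R ∧ R ⊆ S' ∧ MeasurableSet R ∧ μ R = t := by
  obtain ⟨R, hR, hRm, hRt⟩ := exists_subset_measure_eq μ (hS'.diff hS) (t := t - μ S) (by
    rw [measure_sdiff hsub hS.nullMeasurableSet (measure_ne_top μ S)]
    exact tsub_le_tsub_right ht' _)
  refine ⟨S ∪ R, subset_union_left, union_subset hsub (hR.trans sdiff_subset), hS.union hRm, ?_⟩
  rw [measure_union (disjoint_sdiff_right.mono_right hR) hRm, hRt, add_tsub_cancel_of_le ht]

/-- Both conditional measures are isomorphic to the unit interval. The equivalence transports only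
the restricted measures and need not preserve `μ`; that is achieved by gluing with a second one on
the complements. -/
lemma exists_equiv_map_restrict [StandardBorelSpace X] (μ : Measure X) [IsProbabilityMeasure μ]
    [NullSingletonClass μ] {D E : Set X} (h : μ D = μ E) :
    ∃ e : X ≃ᵐ X, (μ.restrict D).map e = μ.restrict E := by
  rcases eq_or_ne (μ D) 0 with h0 | h0
  · refine ⟨MeasurableEquiv.refl X, ?_⟩
    rw [Measure.restrict_eq_zero.2 h0, Measure.restrict_eq_zero.2 (h ▸ h0)]; simp
  have h0' : μ E ≠ 0 := h ▸ h0
  have := ProbabilityTheory.cond_isProbabilityMeasure (μ := μ) h0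
  have := ProbabilityTheory.cond_isProbabilityMeasure (μ := μ) h0'
  have := cond_nullSingletonClass μ (S := D)
  have := cond_nullSingletonClass μ (S := E)
  obtain ⟨a, ha⟩ := exists_equiv_unitInterval (ProbabilityTheory.cond μ D)
  obtain ⟨b, hb⟩ := exists_equiv_unitInterval (ProbabilityTheory.cond μ E)
  refine ⟨a.trans b.symm, ?_⟩
  have key : (ProbabilityTheory.cond μ D).map (a.trans b.symm) = ProbabilityTheory.cond μ E := by
    have : ((a.trans b.symm : X ≃ᵐ X) : X → X) = b.symm ∘ a := rfl
    rw [this, ← Measure.map_map b.symm.measurable a.measurable, ha, ← hb,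
      Measure.map_map b.symm.measurable b.measurable]
    simp
  unfold ProbabilityTheory.cond at key
  rw [Measure.map_smul, ← h] at key
  have h2 := congrArg (fun ν => μ D • ν) key
  simpa [smul_smul, ENNReal.mul_inv_cancel h0 (measure_ne_top μ D)] using h2

/-- Sets of equal measure are exchanged by a measure preserving equivalence. -/
lemma exists_measurePreserving_preimage_ae_eq [StandardBorelSpace X] (μ : Measure X)
    [IsProbabilityMeasure μ] [NullSingletonClass μ] {D E : Set X} (hD : MeasurableSet D)
    (hE : MeasurableSet E) (h : μ D = μ E) :
    ∃ e : X ≃ᵐ X, MeasurePreserving e μ μ ∧ μ (D \ e ⁻¹' E) = 0 := by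
  classical
  obtain ⟨a, ha⟩ := exists_equiv_map_restrict μ h
  obtain ⟨b, hb⟩ := exists_equiv_map_restrict μ (D := Dᶜ) (E := Eᶜ) (by
    rw [prob_compl_eq_one_sub hD, prob_compl_eq_one_sub hE, h])
  let F : X → X := D.piecewise a b
  have hF : Measurable F := a.measurable.piecewise hD b.measurable
  have hFa : F =ᵐ[μ.restrict D] a := (ae_restrict_mem hD).mono fun x hx => by simp [F, hx]
  have hFb : F =ᵐ[μ.restrict Dᶜ] b :=
    (ae_restrict_mem hD.compl).mono fun x hx => piecewise_eq_of_notMem _ _ _ hx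
  have hmap : μ.map F = μ := by
    conv_lhs => rw [← Measure.restrict_add_restrict_compl (μ := μ) hD]
    rw [Measure.map_add _ _ hF, Measure.map_congr hFa, Measure.map_congr hFb, ha, hb,
      Measure.restrict_add_restrict_compl hE]
  have hDa : μ (D \ a ⁻¹' E) = 0 := by
    have : (μ.restrict D) (a ⁻¹' Eᶜ) = 0 := by
      rw [← a.map_apply, ha, Measure.restrict_apply hE.compl]; simp
    rw [Measure.restrict_apply (a.measurable hE.compl)] at this
    refine measure_mono_null (fun x hx => ?_) this
    exact ⟨hx.2, hx.1⟩
  have hDb : μ (Dᶜ \ b ⁻¹' Eᶜ) = 0 := by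
    have : (μ.restrict Dᶜ) (b ⁻¹' E) = 0 := by
      rw [← b.map_apply, hb, Measure.restrict_apply hE]; simp
    rw [Measure.restrict_apply (b.measurable hE)] at this
    refine measure_mono_null (fun x hx => ?_) this
    exact ⟨not_not.1 hx.2, hx.1⟩
  -- Almost every point of `D` goes to `E` and almost every point of `Dᶜ` to `Eᶜ`. On the set where
  -- this holds the glued map is injective.
  obtain ⟨e, he⟩ := exists_measurableEquiv_ae_eq (μ := μ) hF
    (X₀ := (D ∩ a ⁻¹' E) ∪ (Dᶜ ∩ b ⁻¹' Eᶜ))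
    ((hD.inter (a.measurable hE)).union (hD.compl.inter (b.measurable hE.compl)))
    (measure_mono_null (fun x hx => by
      by_cases hxD : x ∈ D
      · exact Or.inl ⟨hxD, fun h' => hx (Or.inl ⟨hxD, h'⟩)⟩
      · exact Or.inr ⟨hxD, fun h' => hx (Or.inr ⟨hxD, h'⟩)⟩) (measure_union_null hDa hDb))
    (by
      rintro x (⟨hx, hx'⟩ | ⟨hx, hx'⟩) y (⟨hy, hy'⟩ | ⟨hy, hy'⟩) hxy
      · simp only [F, piecewise_eq_of_mem _ _ _ hx, piecewise_eq_of_mem _ _ _ hy] at hxy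
        exact a.injective hxy
      · simp only [F, piecewise_eq_of_mem _ _ _ hx, piecewise_eq_of_notMem _ _ _ hy] at hxy
        exact absurd (show b y ∈ E from hxy ▸ hx') hy'
      · simp only [F, piecewise_eq_of_notMem _ _ _ hx, piecewise_eq_of_mem _ _ _ hy] at hxy
        exact absurd (show b x ∈ E from hxy ▸ hy') hx'
      · simp only [F, piecewise_eq_of_notMem _ _ _ hx, piecewise_eq_of_notMem _ _ _ hy] at hxy
        exact b.injective hxy)
  refine ⟨e, ⟨e.measurable, (Measure.map_congr he).trans hmap⟩, ?_⟩
  have h3 : μ {x | ¬ e x = F x} = 0 := ae_iff.1 he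
  refine measure_mono_null (fun x hx => ?_) (measure_union_null hDa h3)
  by_cases hex : e x = F x
  · refine Or.inl ⟨hx.1, fun h' => hx.2 ?_⟩
    show e x ∈ E
    rw [hex]; simpa [F, piecewise_eq_of_mem _ _ _ hx.1] using h'
  · exact Or.inr hex

end Isomorphism

/-! ### Quantiles of a function on a nonatomic space. -/

section Quantile

variable {X : Type*} [MeasurableSpace X]

/-- Every mass `t ≤ μ C` is attained by an initial segment of `C` for the order given by `w`. -/
lemma exists_initial_segment [StandardBorelSpace X] (μ : Measure X) [IsFiniteMeasure μ]
    [NullSingletonClass μ] {C : Set X} (hC : MeasurableSet C) {w : X → ℝ} (hw : Measurable w)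
    {t : ℝ≥0∞} (ht : t ≤ μ C) :
    ∃ S ⊆ C, MeasurableSet S ∧ μ S = t ∧ ∀ x ∈ S, ∀ y ∈ C, y ∉ S → w x ≤ w y := by
  rcases eq_or_ne t 0 with rfl | ht0
  · exact ⟨∅, empty_subset _, .empty, by simp, by simp⟩
  rcases eq_or_lt_of_le ht with rfl | htC
  · exact ⟨C, Subset.rfl, hC, rfl, fun x _ y hy hy' => absurd hy hy'⟩
  have hmle : ∀ τ, MeasurableSet (C ∩ {x | w x ≤ τ}) := fun τ =>
    hC.inter (measurableSet_le hw measurable_const)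
  have hmono : ∀ {a b : ℝ}, a ≤ b → C ∩ {x | w x ≤ a} ⊆ C ∩ {x | w x ≤ b} :=
    fun hab x hx => ⟨hx.1, le_trans hx.2 hab⟩
  set A : Set ℝ := {τ | t ≤ μ (C ∩ {x | w x ≤ τ})} with hA
  have hAne : A.Nonempty := by
    have h1 : μ C = ⨆ n : ℕ, μ (C ∩ {x | w x ≤ n}) := by
      rw [← Monotone.measure_iUnion]
      · congr 1; ext x
        simp only [mem_iUnion, mem_inter_iff, mem_ofPred_eq, exists_and_left]
        exact ⟨fun h => ⟨h, exists_nat_ge (w x)⟩, fun h => h.1⟩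
      · exact fun a b hab => hmono (by exact_mod_cast hab)
    rw [h1, lt_iSup_iff] at htC
    obtain ⟨n, hn⟩ := htC
    exact ⟨n, hn.le⟩
  have hAbd : BddBelow A := by
    have h1 : (0 : ℝ≥0∞) = ⨅ n : ℕ, μ (C ∩ {x | w x ≤ -(n : ℝ)}) := by
      rw [← Antitone.measure_iInter]
      · have : (⋂ n : ℕ, C ∩ {x | w x ≤ -(n : ℝ)}) = ∅ := by
          ext x
          simp only [mem_iInter, mem_inter_iff, mem_ofPred_eq, mem_empty_iff_false, iff_false]
          intro h
          obtain ⟨n, hn⟩ := exists_nat_gt (-(w x))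
          linarith [(h n).2]
        rw [this, measure_empty]
      · exact fun a b hab => hmono (by simpa using hab)
      · exact fun n => (hmle _).nullMeasurableSet
      · exact ⟨0, measure_ne_top _ _⟩
    have h2 := pos_iff_ne_zero.2 ht0
    rw [h1, iInf_lt_iff] at h2
    obtain ⟨n, hn⟩ := h2
    refine ⟨-(n : ℝ), fun a ha => ?_⟩
    by_contra! hlt
    exact absurd (ha.trans (measure_mono (hmono hlt.le))) (not_le.2 hn)
  -- The quantile `τ` satisfies `μ (C ∩ {w < τ}) ≤ t ≤ μ (C ∩ {w ≤ τ})`. The level `{w = τ}` may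
  -- have positive mass; nonatomicity of `μ` permits cutting it at will.
  set τ := sInf A with hτ
  have hupper : t ≤ μ (C ∩ {x | w x ≤ τ}) := by
    have h1 : C ∩ {x | w x ≤ τ} = ⋂ n : ℕ, C ∩ {x | w x ≤ τ + 1 / ((n : ℝ) + 1)} := by
      ext x
      simp only [mem_iInter, mem_inter_iff, mem_ofPred_eq]
      constructor
      · intro h n
        have : (0 : ℝ) < 1 / ((n : ℝ) + 1) := by positivity
        exact ⟨h.1, by linarith [h.2]⟩
      · intro h
        refine ⟨(h 0).1, ?_⟩
        refine le_of_forall_pos_le_add fun ε hε => ?_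
        obtain ⟨n, hn⟩ := exists_nat_one_div_lt hε
        linarith [(h n).2]
    rw [h1, Antitone.measure_iInter]
    · refine le_iInf fun n => ?_
      have : sInf A < τ + 1 / ((n : ℝ) + 1) := by
        rw [← hτ]; have : (0 : ℝ) < 1 / ((n : ℝ) + 1) := by positivity
        linarith
      obtain ⟨a, ha, hlt⟩ := exists_lt_of_csInf_lt hAne this
      exact le_trans ha (measure_mono (hmono hlt.le))
    · exact fun a b hab => hmono (by gcongr)
    · exact fun n => (hmle _).nullMeasurableSet
    · exact ⟨0, measure_ne_top _ _⟩
  have hlower : μ (C ∩ {x | w x < τ}) ≤ t := by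
    have h1 : C ∩ {x | w x < τ} = ⋃ n : ℕ, C ∩ {x | w x ≤ τ - 1 / ((n : ℝ) + 1)} := by
      ext x
      simp only [mem_iUnion, mem_inter_iff, mem_ofPred_eq, exists_and_left]
      refine and_congr_right fun _ => ⟨fun h => ?_, ?_⟩
      · obtain ⟨n, hn⟩ := exists_nat_one_div_lt (sub_pos.2 h)
        exact ⟨n, by linarith⟩
      · rintro ⟨n, hn⟩
        have : (0 : ℝ) < 1 / ((n : ℝ) + 1) := by positivity
        linarith
    rw [h1, Monotone.measure_iUnion]
    · refine iSup_le fun n => ?_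
      by_contra! hlt
      have h2 : τ - 1 / ((n : ℝ) + 1) ∈ A := hlt.le
      have h3 := csInf_le hAbd h2
      have : (0 : ℝ) < 1 / ((n : ℝ) + 1) := by positivity
      linarith
    · exact fun a b hab => hmono (by gcongr)
  obtain ⟨S, hS1, hS2, hSm, hSt⟩ := exists_measure_eq_between μ
    (hC.inter (measurableSet_lt hw measurable_const)) (hmle τ)
    (fun x hx => ⟨hx.1, le_of_lt (show w x < τ from hx.2)⟩) hlower hupper
  refine ⟨S, fun x hx => (hS2 hx).1, hSm, hSt, fun x hx y hy hyS => ?_⟩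
  have h1 : w x ≤ τ := (hS2 hx).2
  have h2 : τ ≤ w y := by
    by_contra! hlt
    exact hyS (hS1 ⟨hy, hlt⟩)
  exact h1.trans h2

/-- Nested initial segments with prescribed masses. -/
lemma exists_initial_segments [StandardBorelSpace X] (μ : Measure X) [IsFiniteMeasure μ]
    [NullSingletonClass μ] {C : Set X} (hC : MeasurableSet C) {w : X → ℝ} (hw : Measurable w)
    {M : ℕ → ℝ≥0∞} (hM0 : M 0 = 0) (hM : Monotone M) (hMC : ∀ i, M i ≤ μ C) :
    ∃ S : ℕ → Set X, S 0 = ∅ ∧ Monotone S ∧ (∀ i, S i ⊆ C) ∧ (∀ i, MeasurableSet (S i)) ∧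
      (∀ i, μ (S i) = M i) ∧ ∀ i, ∀ x ∈ S i, ∀ y ∈ C, y ∉ S i → w x ≤ w y := by
  let Good : ℕ → Set X → Prop := fun i S => S ⊆ C ∧ MeasurableSet S ∧ μ S = M i ∧
    ∀ x ∈ S, ∀ y ∈ C, y ∉ S → w x ≤ w y
  have step : ∀ i S, Good i S → ∃ S', Good (i + 1) S' ∧ S ⊆ S' := by
    rintro i S ⟨hSC, hSm, hSμ, hS⟩
    obtain ⟨R, hR, hRm, hRμ, hRw⟩ := exists_initial_segment μ (hC.diff hSm) hw
      (t := M (i + 1) - M i) (by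
        rw [measure_sdiff hSC hSm.nullMeasurableSet (measure_ne_top _ _), hSμ]
        exact tsub_le_tsub_right (hMC _) _)
    refine ⟨S ∪ R, ⟨union_subset hSC fun x hx => (hR hx).1, hSm.union hRm, ?_, ?_⟩,
      subset_union_left⟩
    · rw [measure_union (disjoint_sdiff_right.mono_right hR) hRm, hSμ, hRμ,
        add_tsub_cancel_of_le (hM (Nat.le_succ i))]
    · rintro x (hx | hx) y hy hyn
      · exact hS x hx y hy fun h => hyn (Or.inl h)
      · exact hRw x hx y ⟨hy, fun h => hyn (Or.inl h)⟩ fun h => hyn (Or.inr h)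
  choose! next hnext hsub using step
  let S : ℕ → Set X := fun n => Nat.rec ∅ (fun i T => next i T) n
  have hgood : ∀ i, Good i (S i) := by
    intro i
    induction i with
    | zero => exact ⟨empty_subset _, .empty, by simp [S, hM0], by simp [S]⟩
    | succ i ih => exact hnext i _ ih
  exact ⟨S, rfl, monotone_nat_of_le_succ fun i => hsub i _ (hgood i), fun i => (hgood i).1,
    fun i => (hgood i).2.1, fun i => (hgood i).2.2.1, fun i => (hgood i).2.2.2⟩

end Quantile

/-! ### Partitions into finite clusters and their cyclic permutations. -/

section Star

variable {X : Type*} [MeasurableSpace X]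

/-- As `σ` is a bijection, the images of the pieces partition `X` again, and the measure of a
preimage can be computed piece by piece. -/
lemma measurePreserving_of_piecewise {μ : Measure X} {ι : Type*} [Countable ι] (σ : X ≃ᵐ X)
    (P : ι → Set X) (hP : ∀ i, MeasurableSet (P i)) (hd : Pairwise (Function.onFun Disjoint P))
    (hU : ⋃ i, P i = univ) (ψ : ι → X ≃ᵐ X) (hψ : ∀ i, MeasurePreserving (ψ i) μ μ)
    (h : ∀ i, ∀ x ∈ P i, σ x = ψ i x) : MeasurePreserving σ μ μ := by
  refine ⟨σ.measurable, Measure.ext fun A hA => ?_⟩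
  rw [Measure.map_apply σ.measurable hA]
  have hPσ : ∀ i, MeasurableSet (σ '' P i) := fun i => σ.measurableSet_image.2 (hP i)
  have h1 : σ ⁻¹' A = ⋃ i, σ ⁻¹' A ∩ P i := by rw [← inter_iUnion, hU, inter_univ]
  have h2 : A = ⋃ i, A ∩ σ '' P i := by
    rw [← inter_iUnion, ← image_iUnion, hU, image_univ, σ.surjective.range_eq, inter_univ]
  rw [h1]
  conv_rhs => rw [h2]
  rw [measure_iUnion (fun i j hij => (hd hij).mono inter_subset_right inter_subset_right)
      (fun i => (σ.measurable hA).inter (hP i)),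
    measure_iUnion (fun i j hij => ((disjoint_image_iff σ.injective).2 (hd hij)).mono
      inter_subset_right inter_subset_right) (fun i => hA.inter (hPσ i))]
  refine tsum_congr fun i => ?_
  have : σ ⁻¹' A ∩ P i = ψ i ⁻¹' (A ∩ σ '' P i) := by
    ext x
    simp only [mem_inter_iff, mem_preimage, mem_image]
    constructor
    · rintro ⟨hx, hxP⟩
      exact ⟨h i x hxP ▸ hx, x, hxP, h i x hxP⟩
    · rintro ⟨hx, y, hy, hyx⟩
      have : y = x := (ψ i).injective ((h i y hy).symm.trans hyx)
      subst this
      exact ⟨hyx ▸ hx, hy⟩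
  rw [this, (hψ i).measure_preimage (hA.inter (hPσ i)).nullMeasurableSet]

/-- A measurable partition of a set into finite ordered clusters: the cluster of the root `x ∈ D 0`
consists of the points `φ n x` with `x ∈ D n`. -/
structure Star (μ : Measure X) where
  φ : ℕ → X ≃ᵐ X
  D : ℕ → Set X
  mp : ∀ n, MeasurePreserving (φ n) μ μ
  zero : ∀ x, φ 0 x = x
  meas : ∀ n, MeasurableSet (D n)
  anti : ∀ n, D (n + 1) ⊆ D n
  fin : ∀ x, ∃ n, x ∉ D n
  disj : ∀ n m x y, x ∈ D n → y ∈ D m → φ n x = φ m y → n = m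

namespace Star

variable {μ : Measure X} (s : Star μ)

/-- The set that is partitioned into clusters. -/
def C : Set X := ⋃ n, (s.φ n).symm ⁻¹' s.D n

lemma measurableSet_C : MeasurableSet s.C :=
  MeasurableSet.iUnion fun n => (s.φ n).symm.measurable (s.meas n)

lemma mem_C {n : ℕ} {x : X} (hx : x ∈ s.D n) : s.φ n x ∈ s.C :=
  mem_iUnion.2 ⟨n, by simpa using hx⟩

lemma antitone_D : Antitone s.D := antitone_nat_of_succ_le s.anti

lemma D_zero_subset_C : s.D 0 ⊆ s.C := fun x hx => by simpa [s.zero] using s.mem_C hx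

lemma exists_of_mem_C {y : X} (hy : y ∈ s.C) : ∃ n, ∃ x ∈ s.D n, s.φ n x = y := by
  obtain ⟨n, hn⟩ := mem_iUnion.1 hy
  exact ⟨n, _, hn, by simp⟩

/-- The second alternative makes the search total. Off `C` it returns `0`, so `root` and `perm` fix
these points. -/
lemma exists_idx (y : X) : ∃ n, (s.φ n).symm y ∈ s.D n ∨ y ∉ s.C := by
  by_cases hy : y ∈ s.C
  · obtain ⟨n, hn⟩ := mem_iUnion.1 hy
    exact ⟨n, Or.inl hn⟩
  · exact ⟨0, Or.inr hy⟩

open Classical in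
/-- The position of a point in its cluster. -/
noncomputable def idx (y : X) : ℕ := Nat.find (s.exists_idx y)

/-- The root of the cluster of a point. -/
noncomputable def root (y : X) : X := (s.φ (s.idx y)).symm y

lemma measurable_idx : Measurable s.idx := by
  classical
  refine measurable_find _ fun n => ?_
  exact ((s.φ n).symm.measurable (s.meas n)).union s.measurableSet_C.compl

lemma measurable_of_idx {β : Type*} [MeasurableSpace β] {F : ℕ → X → β} {i : X → ℕ}
    (hi : Measurable i) (hF : ∀ n, Measurable (F n)) : Measurable fun y => F (i y) y :=
  (measurable_from_prod_countable_right (f := fun q : ℕ × X => F q.1 q.2) hF).comp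
    (hi.prodMk measurable_id)

lemma measurable_root : Measurable s.root :=
  measurable_of_idx s.measurable_idx fun n => (s.φ n).symm.measurable

lemma idx_of_notMem {y : X} (hy : y ∉ s.C) : s.idx y = 0 := by
  classical
  exact (Nat.find_eq_zero _).2 (Or.inr hy)

lemma symm_zero (y : X) : (s.φ 0).symm y = y := by
  rw [MeasurableEquiv.symm_apply_eq, s.zero]

lemma root_of_notMem {y : X} (hy : y ∉ s.C) : s.root y = y := by
  rw [root, s.idx_of_notMem hy, symm_zero]

lemma idx_φ {n : ℕ} {x : X} (hx : x ∈ s.D n) : s.idx (s.φ n x) = n := by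
  classical
  have h := Nat.find_spec (s.exists_idx (s.φ n x))
  rcases h with h | h
  · exact s.disj _ _ _ _ h hx (MeasurableEquiv.apply_symm_apply _ _)
  · exact absurd (s.mem_C hx) h

lemma root_φ {n : ℕ} {x : X} (hx : x ∈ s.D n) : s.root (s.φ n x) = x := by
  rw [root, s.idx_φ hx, MeasurableEquiv.symm_apply_apply]

lemma root_of_mem_D_zero {x : X} (hx : x ∈ s.D 0) : s.root x = x := by
  have := s.root_φ hx; rwa [s.zero] at this

lemma root_mem {y : X} (hy : y ∈ s.C) : s.root y ∈ s.D 0 := by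
  obtain ⟨n, x, hx, rfl⟩ := s.exists_of_mem_C hy
  rw [s.root_φ hx]
  exact s.antitone_D (Nat.zero_le n) hx

open Classical in
/-- The cyclic permutation of each cluster, as a function. -/
noncomputable def perm (y : X) : X :=
  if s.root y ∈ s.D (s.idx y + 1) then s.φ (s.idx y + 1) (s.root y) else s.root y

lemma perm_φ {n : ℕ} {x : X} (hx : x ∈ s.D (n + 1)) : s.perm (s.φ n x) = s.φ (n + 1) x := by
  have hx' := s.anti n hx
  rw [perm, s.idx_φ hx', s.root_φ hx', if_pos hx]

lemma perm_last {n : ℕ} {x : X} (hx : x ∈ s.D n) (hx' : x ∉ s.D (n + 1)) :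
    s.perm (s.φ n x) = x := by
  rw [perm, s.idx_φ hx, s.root_φ hx, if_neg hx']

lemma perm_of_notMem {y : X} (hy : y ∉ s.C) : s.perm y = y := by
  have : y ∉ s.D (0 + 1) := fun h => hy (s.D_zero_subset_C (s.anti 0 h))
  rw [perm, s.idx_of_notMem hy, s.root_of_notMem hy, if_neg this]

lemma perm_cases {y : X} (hy : y ∈ s.C) : ∃ n x, x ∈ s.D n ∧ s.φ n x = y ∧
    ((x ∈ s.D (n + 1) ∧ s.perm y = s.φ (n + 1) x) ∨ (x ∉ s.D (n + 1) ∧ s.perm y = x)) := by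
  obtain ⟨n, x, hx, rfl⟩ := s.exists_of_mem_C hy
  refine ⟨n, x, hx, rfl, ?_⟩
  by_cases h : x ∈ s.D (n + 1)
  · exact Or.inl ⟨h, s.perm_φ h⟩
  · exact Or.inr ⟨h, s.perm_last hx h⟩

lemma perm_mem_C {y : X} (hy : y ∈ s.C) : s.perm y ∈ s.C := by
  obtain ⟨n, x, hx, rfl, ⟨h, h'⟩ | ⟨_, h'⟩⟩ := s.perm_cases hy
  · rw [h']; exact s.mem_C h
  · rw [h']; exact s.D_zero_subset_C (s.antitone_D (Nat.zero_le n) hx)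

lemma root_perm (y : X) : s.root (s.perm y) = s.root y := by
  by_cases hy : y ∈ s.C
  · obtain ⟨n, x, hx, rfl, ⟨h, h'⟩ | ⟨_, h'⟩⟩ := s.perm_cases hy
    · rw [h', s.root_φ h, s.root_φ hx]
    · rw [h', s.root_φ hx, s.root_of_mem_D_zero (s.antitone_D (Nat.zero_le n) hx)]
  · rw [s.perm_of_notMem hy]

open Classical in
/-- The number of points in the cluster of a root. -/
noncomputable def len (x : X) : ℕ := Nat.find (s.fin x)

lemma measurable_len : Measurable s.len := by
  classical
  exact measurable_find _ fun n => (s.meas n).compl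

lemma len_eq {n : ℕ} {x : X} (hx : x ∈ s.D n) (hx' : x ∉ s.D (n + 1)) : s.len x = n + 1 := by
  classical
  refine (Nat.find_eq_iff _).2 ⟨hx', fun m hm => not_not.2 (s.antitone_D ?_ hx)⟩
  omega

lemma exists_last {x : X} (hx : x ∈ s.D 0) : ∃ n, x ∈ s.D n ∧ x ∉ s.D (n + 1) := by
  classical
  have h := Nat.find_spec (s.fin x)
  have h' := fun m => Nat.find_min (s.fin x) (m := m)
  obtain ⟨n, hn⟩ : ∃ n, Nat.find (s.fin x) = n + 1 := by
    refine Nat.exists_eq_succ_of_ne_zero fun h0 => ?_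
    rw [h0] at h; exact h hx
  refine ⟨n, ?_, hn ▸ h⟩
  have := h' n (by omega)
  exact not_not.1 this

lemma perm_bijective : Function.Bijective s.perm := by
  constructor
  · intro y y' h
    by_cases hy : y ∈ s.C
    · by_cases hy' : y' ∈ s.C
      · have hroot : s.root y = s.root y' := by rw [← s.root_perm y, h, s.root_perm]
        obtain ⟨n, x, hx, rfl, h1⟩ := s.perm_cases hy
        obtain ⟨m, x', hx', rfl, h2⟩ := s.perm_cases hy'
        rw [s.root_φ hx, s.root_φ hx'] at hroot
        subst hroot
        have hx0 : x ∈ s.D 0 := s.antitone_D (Nat.zero_le n) hx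
        suffices n = m by subst this; rfl
        -- A point that moves up lands at a positive level, a last point lands at the root, which
        -- has level `0`; so the mixed cases are impossible. Two last points over the same root have
        -- the same level, since the cluster has one length.
        rcases h1 with ⟨h1, e1⟩ | ⟨h1, e1⟩ <;> rcases h2 with ⟨h2, e2⟩ | ⟨h2, e2⟩
        · have := s.disj _ _ _ _ h1 h2 (e1.symm.trans (h.trans e2)); omega
        · have := s.disj _ 0 _ x h1 hx0 (by rw [s.zero]; exact e1.symm.trans (h.trans e2)); omega
        · have := s.disj 0 _ x _ hx0 h2 (by rw [s.zero]; exact e1.symm.trans (h.trans e2)); omega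
        · have := s.len_eq hx h1; have := s.len_eq hx' h2; omega
      · rw [s.perm_of_notMem hy'] at h
        exact absurd (h ▸ s.perm_mem_C hy) hy'
    · by_cases hy' : y' ∈ s.C
      · rw [s.perm_of_notMem hy] at h
        exact absurd (h ▸ s.perm_mem_C hy') hy
      · rwa [s.perm_of_notMem hy, s.perm_of_notMem hy'] at h
  · intro z
    by_cases hz : z ∈ s.C
    · obtain ⟨n, x, hx, rfl⟩ := s.exists_of_mem_C hz
      cases n with
      | zero =>
        obtain ⟨n, h1, h2⟩ := s.exists_last hx
        exact ⟨s.φ n x, by rw [s.perm_last h1 h2, s.zero]⟩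
      | succ n => exact ⟨s.φ n x, s.perm_φ hx⟩
    · exact ⟨z, s.perm_of_notMem hz⟩

lemma measurableSet_perm : MeasurableSet {y | s.root y ∈ s.D (s.idx y + 1)} := by
  have : {y | s.root y ∈ s.D (s.idx y + 1)} =
      ⋃ n, {y | s.idx y = n} ∩ s.root ⁻¹' s.D (n + 1) := by
    ext y; simp
  rw [this]
  exact MeasurableSet.iUnion fun n => (s.measurable_idx (measurableSet_singleton n)).inter
    (s.measurable_root (s.meas _))

lemma measurable_perm : Measurable s.perm := by
  classical
  refine Measurable.ite s.measurableSet_perm ?_ s.measurable_root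
  exact measurable_of_idx (F := fun n y => s.φ (n + 1) (s.root y)) s.measurable_idx
    fun n => (s.φ (n + 1)).measurable.comp s.measurable_root

/-- The cyclic permutation of each cluster. -/
noncomputable def σ [StandardBorelSpace X] : X ≃ᵐ X :=
  equivOfBijective s.perm s.measurable_perm s.perm_bijective

lemma σ_apply [StandardBorelSpace X] (y : X) : s.σ y = s.perm y := rfl

/-- The pieces are indexed by the level and by whether a next level exists. On each of them the
permutation is `φ (n + 1) ∘ (φ n)⁻¹` or `(φ n)⁻¹`. -/
lemma measurePreserving_σ [StandardBorelSpace X] : MeasurePreserving s.σ μ μ := by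
  classical
  let P : ℕ × Bool → Set X := fun q => {y | s.idx y = q.1} ∩
    (if q.2 then {y | s.root y ∈ s.D (s.idx y + 1)} else {y | s.root y ∈ s.D (s.idx y + 1)}ᶜ)
  let ψ : ℕ × Bool → X ≃ᵐ X := fun q =>
    if q.2 then (s.φ q.1).symm.trans (s.φ (q.1 + 1)) else (s.φ q.1).symm
  refine measurePreserving_of_piecewise s.σ P ?_ ?_ ?_ ψ ?_ ?_
  · rintro ⟨n, b⟩
    refine (s.measurable_idx (measurableSet_singleton n)).inter ?_
    cases b
    · simpa using s.measurableSet_perm.compl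
    · simpa using s.measurableSet_perm
  · rintro ⟨n, b⟩ ⟨m, b'⟩ hne
    refine Set.disjoint_left.2 fun y hy hy' => hne ?_
    have h1 : n = m := hy.1.symm.trans hy'.1
    subst h1
    have h2 := hy.2
    have h3 := hy'.2
    cases b <;> cases b' <;> simp at h2 h3 ⊢
    · exact absurd h3 h2
    · exact absurd h2 h3
  · ext y
    simp only [mem_iUnion, mem_univ, iff_true]
    by_cases h : s.root y ∈ s.D (s.idx y + 1)
    · exact ⟨(s.idx y, true), rfl, by simpa using h⟩
    · exact ⟨(s.idx y, false), rfl, by simpa using h⟩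
  · rintro ⟨n, b⟩
    have hs : MeasurePreserving (s.φ n).symm μ μ := (s.mp n).symm
    cases b
    · simpa [ψ] using hs
    · exact (s.mp (n + 1)).comp hs
  · rintro ⟨n, b⟩ y ⟨hy, hy'⟩
    have hy : s.idx y = n := hy
    rw [σ_apply, perm]
    cases b
    · have : ¬ s.root y ∈ s.D (s.idx y + 1) := by simpa using hy'
      rw [if_neg this, root, hy]; simp [ψ]
    · have : s.root y ∈ s.D (s.idx y + 1) := by simpa using hy'
      rw [if_pos this, root, hy]; simp [ψ]

/-- The root map is many-to-one and does not preserve `μ`, but locally it is one of countably many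
measure preserving maps; so it pulls null sets back to null sets. -/
lemma quasi_root : Measure.QuasiMeasurePreserving s.root μ μ := by
  refine ⟨s.measurable_root, Measure.AbsolutelyContinuous.mk fun N hN hN0 => ?_⟩
  rw [Measure.map_apply s.measurable_root hN]
  refine measure_mono_null (t := ⋃ n, (s.φ n).symm ⁻¹' N) (fun y hy => mem_iUnion.2 ⟨_, hy⟩) ?_
  refine measure_iUnion_null fun n => ?_
  have hs : MeasurePreserving (s.φ n).symm μ μ := (s.mp n).symm
  rw [hs.measure_preimage hN.nullMeasurableSet, hN0]

/-- Partial sums of `u` along clusters. -/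
def psum (u : X → ℝ) (n : ℕ) (x : X) : ℝ := ∑ i ∈ Finset.range n, u (s.φ i x)

lemma measurable_psum {u : X → ℝ} (hu : Measurable u) (n : ℕ) : Measurable (s.psum u n) :=
  Finset.measurable_sum _ fun i _ => hu.comp (s.φ i).measurable

/-- The sum of `u` over the points that precede a given point in its cluster. -/
noncomputable def before (u : X → ℝ) (y : X) : ℝ := s.psum u (s.idx y) (s.root y)

lemma measurable_before {u : X → ℝ} (hu : Measurable u) : Measurable (s.before u) :=
  measurable_of_idx (F := fun n y => s.psum u n (s.root y)) s.measurable_idx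
    fun n => (s.measurable_psum hu n).comp s.measurable_root

lemma before_φ (u : X → ℝ) {n : ℕ} {x : X} (hx : x ∈ s.D n) :
    s.before u (s.φ n x) = s.psum u n x := by rw [before, s.idx_φ hx, s.root_φ hx]

lemma before_of_notMem (u : X → ℝ) {y : X} (hy : y ∉ s.C) : s.before u y = 0 := by
  rw [before, s.idx_of_notMem hy]; simp [psum]

lemma before_of_mem_D_zero (u : X → ℝ) {x : X} (hx : x ∈ s.D 0) : s.before u x = 0 := by
  have := s.before_φ u hx
  rw [s.zero] at this; rw [this]; simp [psum]

open Classical in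
/-- The sum of `u` over the cluster of a root. -/
noncomputable def total (u : X → ℝ) (x : X) : ℝ :=
  -- Outside `D 0` the value `u x` is kept, which is right for base points outside `C`: their
  -- columns remain as they are.
  if x ∈ s.D 0 then s.psum u (s.len x) x else u x

lemma measurable_total {u : X → ℝ} (hu : Measurable u) : Measurable (s.total u) := by
  classical
  exact Measurable.ite (s.meas 0)
    (measurable_of_idx s.measurable_len fun n => s.measurable_psum hu n) hu

lemma total_of_last (u : X → ℝ) {n : ℕ} {x : X} (hx : x ∈ s.D n) (hx' : x ∉ s.D (n + 1)) :
    s.total u x = s.psum u (n + 1) x := by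
  rw [total, if_pos (s.antitone_D (Nat.zero_le n) hx), s.len_eq hx hx']

lemma total_of_notMem (u : X → ℝ) {x : X} (hx : x ∉ s.D 0) : s.total u x = u x := if_neg hx

end Star

end Star

/-! ### Partitions of the space into columns and their concatenation. -/

section Columns

variable {X : Type*} [MeasurableSpace X]

/-- A measurable partition of `X` into finite columns: `Θ` moves up one level in each column and
maps its top to its base point, `B` is the set of base points, `p` maps a point to the base point of
its column, `-g` is the sum of `f` over the lower levels of the column, `u` the sum of `f` over the
whole column. -/
structure Columns (μ : Measure X) (f : X → ℝ) where
  Θ : X ≃ᵐ X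
  B : Set X
  p : X → X
  g : X → ℝ
  u : X → ℝ
  mp : MeasurePreserving Θ μ μ
  meas_B : MeasurableSet B
  meas_g : Measurable g
  meas_u : Measurable u
  quasi_p : Measure.QuasiMeasurePreserving p μ μ
  p_mem : ∀ x, p x ∈ B
  p_base : ∀ x ∈ B, p x = x
  p_Θ : ∀ x, p (Θ x) = p x
  g_base : ∀ x ∈ B, g x = 0
  eq_inner : ∀ x, Θ x ∉ B → f x = g x - g (Θ x)
  eq_top : ∀ x, Θ x ∈ B → f x = g x + u (Θ x)
  -- This encodes induction along a column: whatever passes between consecutive levels is decided at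
  -- the base. It is what turns invariant sets into unions of columns.
  link : ∀ χ : X → Prop, (∀ x, Θ x ∉ B → (χ x ↔ χ (Θ x))) → ∀ x, χ x ↔ χ (p x)

namespace Columns

variable {μ : Measure X} {f : X → ℝ}

/-- The partition into columns of height one. -/
def trivial (hf : Measurable f) : Columns μ f where
  Θ := MeasurableEquiv.refl X
  B := univ
  p := id
  g := 0
  u := f
  mp := MeasurePreserving.id μ
  meas_B := .univ
  meas_g := measurable_const
  meas_u := hf
  quasi_p := Measure.QuasiMeasurePreserving.id μ
  p_mem := fun _ => mem_univ _
  p_base := fun _ _ => rfl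
  p_Θ := fun _ => rfl
  g_base := fun _ _ => rfl
  eq_inner := fun x hx => absurd (mem_univ _) hx
  eq_top := fun x _ => by simp
  link := fun χ _ x => Iff.rfl

/-- Concatenate the columns over the points of each cluster of a star on the base. -/
noncomputable def step [StandardBorelSpace X] (c : Columns μ f) (s : Star μ) (hs : s.C ⊆ c.B) :
    Columns μ f where
  Θ := c.Θ.trans s.σ
  B := (c.B \ s.C) ∪ s.D 0
  p := s.root ∘ c.p
  -- The levels below `x` now include the complete columns over the earlier points of the cluster.
  g := fun x => c.g x - s.before c.u (c.p x)
  u := s.total c.u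
  mp := s.measurePreserving_σ.comp c.mp
  meas_B := (c.meas_B.diff s.measurableSet_C).union (s.meas 0)
  meas_g := c.meas_g.sub ((s.measurable_before c.meas_u).comp c.quasi_p.measurable)
  meas_u := s.measurable_total c.meas_u
  quasi_p := s.quasi_root.comp c.quasi_p
  p_mem := fun x => by
    by_cases h : c.p x ∈ s.C
    · exact Or.inr (s.root_mem h)
    · refine Or.inl ?_
      rw [Function.comp_apply, s.root_of_notMem h]
      exact ⟨c.p_mem x, h⟩
  p_base := fun x hx => by
    rcases hx with hx | hx
    · rw [Function.comp_apply, c.p_base x hx.1, s.root_of_notMem hx.2]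
    · rw [Function.comp_apply, c.p_base x (hs (s.D_zero_subset_C hx)), s.root_of_mem_D_zero hx]
  p_Θ := fun x => by
    simp only [MeasurableEquiv.trans_apply, Function.comp_apply, Star.σ_apply]
    by_cases h : c.Θ x ∈ s.C
    · rw [c.p_base _ (hs (s.perm_mem_C h)), s.root_perm, ← c.p_Θ x, c.p_base _ (hs h)]
    · rw [s.perm_of_notMem h, c.p_Θ]
  g_base := fun x hx => by
    rcases hx with hx | hx
    · rw [c.g_base x hx.1, c.p_base x hx.1, s.before_of_notMem _ hx.2, sub_zero]
    · have hx' := hs (s.D_zero_subset_C hx)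
      rw [c.g_base x hx', c.p_base x hx', s.before_of_mem_D_zero _ hx, sub_zero]
  eq_inner := fun x hx => by
    simp only [MeasurableEquiv.trans_apply, Star.σ_apply] at hx ⊢
    by_cases h : c.Θ x ∈ s.C
    · have hB := hs h
      have hp : c.p x = c.Θ x := by rw [← c.p_Θ, c.p_base _ hB]
      have hB' := hs (s.perm_mem_C h)
      rw [c.g_base _ hB', c.p_base _ hB', hp, c.eq_top x hB]
      obtain ⟨n, b, hb, hbx, ⟨h1, h2⟩ | ⟨h1, h2⟩⟩ := s.perm_cases h
      · rw [h2, ← hbx, s.before_φ _ hb, s.before_φ _ h1, Star.psum, Star.psum,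
          Finset.sum_range_succ]
        ring
      · exact absurd (Or.inr (h2 ▸ s.antitone_D (Nat.zero_le n) hb)) hx
    · rw [s.perm_of_notMem h] at hx ⊢
      have hB : c.Θ x ∉ c.B := fun hB => hx (Or.inl ⟨hB, h⟩)
      rw [c.eq_inner x hB, c.p_Θ]; ring
  eq_top := fun x hx => by
    simp only [MeasurableEquiv.trans_apply, Star.σ_apply] at hx ⊢
    by_cases h : c.Θ x ∈ s.C
    · have hB := hs h
      have hp : c.p x = c.Θ x := by rw [← c.p_Θ, c.p_base _ hB]
      rw [hp, c.eq_top x hB]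
      obtain ⟨n, b, hb, hbx, ⟨h1, h2⟩ | ⟨h1, h2⟩⟩ := s.perm_cases h
      · exfalso
        rw [h2] at hx
        rcases hx with hx | hx
        · exact hx.2 (s.mem_C h1)
        · have := s.disj _ 0 _ _ h1 hx (by rw [s.zero]); omega
      · rw [h2, s.total_of_last _ hb h1, ← hbx, s.before_φ _ hb, Star.psum, Star.psum,
          Finset.sum_range_succ]
        ring
    · rw [s.perm_of_notMem h] at hx ⊢
      have hD : c.Θ x ∉ s.D 0 := fun hD => h (s.D_zero_subset_C hD)
      have hB : c.Θ x ∈ c.B := (hx.resolve_right hD).1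
      have hp : c.p x = c.Θ x := by rw [← c.p_Θ, c.p_base _ hB]
      rw [s.total_of_notMem _ hD, hp, s.before_of_notMem _ h, c.eq_top x hB, sub_zero]
  link := fun χ hχ x => by
    have h1 : ∀ x, χ x ↔ χ (c.p x) := by
      refine c.link χ fun x hx => ?_
      have h : c.Θ x ∉ s.C := fun h => hx (hs h)
      have h2 := hχ x
      simp only [MeasurableEquiv.trans_apply, Star.σ_apply, s.perm_of_notMem h] at h2
      exact h2 fun h3 => h3.elim (fun h4 => hx h4.1) fun h4 => h (s.D_zero_subset_C h4)
    have h2 : ∀ n b, b ∈ s.D n → (χ (s.φ n b) ↔ χ b) := by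
      intro n
      induction n with
      | zero => intro b _; rw [s.zero]
      | succ n ih =>
        intro b hb
        rw [← ih b (s.anti n hb)]
        -- This preimage is the top of the old column over `φ n b`. The new map sends it to `φ (n +
        -- 1) b`, the base of the next column in the cluster.
        have h3 := hχ (c.Θ.symm (s.φ n b))
        have hB : s.φ n b ∈ c.B := hs (s.mem_C (s.anti n hb))
        simp only [MeasurableEquiv.trans_apply, Star.σ_apply, MeasurableEquiv.apply_symm_apply,
          s.perm_φ hb] at h3
        have h4 : c.p (c.Θ.symm (s.φ n b)) = s.φ n b := by
          rw [← c.p_Θ, MeasurableEquiv.apply_symm_apply, c.p_base _ hB]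
        rw [← h3, h1 (c.Θ.symm _), h4]
        rintro (h5 | h5)
        · exact h5.2 (s.mem_C hb)
        · have := s.disj _ 0 _ _ hb h5 (by rw [s.zero]); omega
    rw [h1 x, Function.comp_apply]
    by_cases h : c.p x ∈ s.C
    · obtain ⟨n, b, hb, hbx⟩ := s.exists_of_mem_C h
      rw [← hbx, s.root_φ hb, h2 n b hb]
    · rw [s.root_of_notMem h]

end Columns

end Columns

/-! ### The positive and negative parts of a coboundary. -/

section Balance

variable {X : Type*} [MeasurableSpace X]

/-- Truncating at `n` factors through truncating at `m`, and truncation at `n` is 1-Lipschitz. The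
inequality is what monotone convergence needs in `lintegral_coboundary`. -/
lemma clamp_sub_clamp_le {n m a b : ℝ} (hn : 0 ≤ n) (hnm : n ≤ m) (hab : b ≤ a) :
    max (-n) (min n a) - max (-n) (min n b) ≤ max (-m) (min m a) - max (-m) (min m b) := by
  have h1 : ∀ t, max (-n) (min n t) = max (-n) (min n (max (-m) (min m t))) := by
    intro t
    rcases le_total m t with h | h
    · rw [min_eq_left h, max_eq_right (show -m ≤ m by linarith), min_eq_left (hnm.trans h),
        min_eq_left hnm]
    · rcases le_total (-m) t with h' | h'
      · rw [min_eq_right h, max_eq_right h']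
      · rw [min_eq_right h, max_eq_left h', min_eq_right (show t ≤ n by linarith),
          min_eq_right (show -m ≤ n by linarith), max_eq_left (show t ≤ -n by linarith),
          max_eq_left (show -m ≤ -n by linarith)]
  have h2 : max (-m) (min m b) ≤ max (-m) (min m a) := max_le_max le_rfl (min_le_min le_rfl hab)
  rw [h1 a, h1 b]
  generalize max (-m) (min m a) = a' at h2 ⊢
  generalize max (-m) (min m b) = b' at h2 ⊢
  have h3 : max (-n) (min n a') ≤ max (-n) (min n b') + (a' - b') := by
    refine max_le (by linarith [le_max_left (-n) (min n b')]) ?_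
    have h4 : min n a' ≤ min n b' + (a' - b') := by
      rcases le_total n b' with h | h
      · rw [min_eq_left h]; linarith [min_le_left n a']
      · rw [min_eq_right h]; linarith [min_le_right n a']
    linarith [le_max_right (-n) (min n b')]
  linarith

/-- The positive and the negative part of a coboundary have the same integral. -/
lemma lintegral_coboundary {μ : Measure X} [IsFiniteMeasure μ] {Θ : X → X}
    (hΘ : MeasurePreserving Θ μ μ) {g : X → ℝ} (hg : Measurable g) :
    ∫⁻ x, ENNReal.ofReal (g x - g (Θ x)) ∂μ = ∫⁻ x, ENNReal.ofReal (-(g x - g (Θ x))) ∂μ := by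
  -- The truncations are bounded, so their coboundaries have integral zero. The positive and
  -- negative parts of these coboundaries increase to those of `g - g ∘ Θ`, and monotone convergence
  -- covers infinite integrals as well.
  let k : ℕ → X → ℝ := fun n x => max (-(n : ℝ)) (min n (g x))
  have hk : ∀ n, Measurable (k n) := fun n =>
    measurable_const.max (measurable_const.min hg)
  have hkb : ∀ n x, |k n x| ≤ n := fun n x => by
    have : (0 : ℝ) ≤ n := Nat.cast_nonneg n
    rw [abs_le]
    exact ⟨le_max_left _ _, max_le (by linarith) (min_le_left _ _)⟩
  have hki : ∀ n, Integrable (k n) μ := fun n =>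
    Integrable.of_bound (hk n).aestronglyMeasurable n (Eventually.of_forall (hkb n))
  have hkΘ : ∀ n, Integrable (fun x => k n (Θ x)) μ := fun n => hΘ.integrable_comp_of_integrable (hki n)
  have heq : ∀ n, ∫⁻ x, ENNReal.ofReal (k n x - k n (Θ x)) ∂μ =
      ∫⁻ x, ENNReal.ofReal (-(k n x - k n (Θ x))) ∂μ := by
    intro n
    have hintg : Integrable (fun x => k n x - k n (Θ x)) μ := (hki n).sub (hkΘ n)
    have h0 : ∫ x, (k n x - k n (Θ x)) ∂μ = 0 := by
      have h1 : ∫ x, k n (Θ x) ∂μ = ∫ x, k n x ∂μ := by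
        rw [← integral_map hΘ.measurable.aemeasurable
          (by rw [hΘ.map_eq]; exact (hk n).aestronglyMeasurable), hΘ.map_eq]
      rw [integral_sub (hki n) (hkΘ n), h1, sub_self]
    rw [integral_eq_lintegral_pos_part_sub_lintegral_neg_part hintg, sub_eq_zero] at h0
    refine (ENNReal.toReal_eq_toReal_iff' ?_ ?_).1 h0
    · exact hintg.lintegral_lt_top.ne
    · exact hintg.neg.lintegral_lt_top.ne
  have hclamp : ∀ (t : ℝ), ∀ᶠ n : ℕ in atTop, max (-(n : ℝ)) (min n t) = t := by
    intro t
    obtain ⟨N, hN⟩ := exists_nat_ge |t|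
    filter_upwards [eventually_ge_atTop N] with n hn
    have h1 : |t| ≤ n := hN.trans (by exact_mod_cast hn)
    rw [abs_le] at h1
    rw [min_eq_right h1.2, max_eq_right h1.1]
  have hlim : ∀ x, ∀ᶠ n in atTop, k n x - k n (Θ x) = g x - g (Θ x) := by
    intro x
    filter_upwards [hclamp (g x), hclamp (g (Θ x))] with n h1 h2
    simp only [k, h1, h2]
  have hmono : ∀ s t : ℝ, Monotone fun n : ℕ =>
      ENNReal.ofReal (max (-(n : ℝ)) (min n s) - max (-(n : ℝ)) (min n t)) := by
    intro s t n m hnm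
    rcases le_total t s with h | h
    · exact ENNReal.ofReal_le_ofReal
        (clamp_sub_clamp_le (Nat.cast_nonneg n) (by exact_mod_cast hnm) h)
    · have : max (-(n : ℝ)) (min n s) - max (-(n : ℝ)) (min n t) ≤ 0 :=
        sub_nonpos.2 (max_le_max le_rfl (min_le_min le_rfl h))
      simp only [ENNReal.ofReal_of_nonpos this, zero_le]
  have L1 : Tendsto (fun n => ∫⁻ x, ENNReal.ofReal (k n x - k n (Θ x)) ∂μ) atTop
      (𝓝 (∫⁻ x, ENNReal.ofReal (g x - g (Θ x)) ∂μ)) := by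
    refine lintegral_tendsto_of_tendsto_of_monotone (fun n => ?_) ?_ ?_
    · exact ((hk n).sub ((hk n).comp hΘ.measurable)).ennreal_ofReal.aemeasurable
    · exact Eventually.of_forall fun x => hmono _ _
    · refine Eventually.of_forall fun x => tendsto_const_nhds.congr' ?_
      filter_upwards [hlim x] with n hn
      rw [hn]
  have L2 : Tendsto (fun n => ∫⁻ x, ENNReal.ofReal (-(k n x - k n (Θ x))) ∂μ) atTop
      (𝓝 (∫⁻ x, ENNReal.ofReal (-(g x - g (Θ x))) ∂μ)) := by
    refine lintegral_tendsto_of_tendsto_of_monotone (fun n => ?_) ?_ ?_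
    · exact ((hk n).sub ((hk n).comp hΘ.measurable)).neg.ennreal_ofReal.aemeasurable
    · refine Eventually.of_forall fun x => ?_
      simp only [neg_sub]
      exact hmono _ _
    · refine Eventually.of_forall fun x => tendsto_const_nhds.congr' ?_
      filter_upwards [hlim x] with n hn
      rw [hn]
  exact tendsto_nhds_unique L1 (L2.congr fun n => (heq n).symm)

lemma integral_coboundary {μ : Measure X} [IsFiniteMeasure μ] {Θ : X → X}
    (hΘ : MeasurePreserving Θ μ μ) {g : X → ℝ} (hg : Measurable g)
    (hi : Integrable (fun x => g x - g (Θ x)) μ) : ∫ x, (g x - g (Θ x)) ∂μ = 0 := by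
  rw [integral_eq_lintegral_pos_part_sub_lintegral_neg_part hi, lintegral_coboundary hΘ hg, sub_self]

end Balance

/-! ### Comparing successive column partitions. -/

namespace Columns

variable {X : Type*} [MeasurableSpace X] {μ : Measure X} {f : X → ℝ}

/-- `W` is a union of columns. -/
def Sat (c : Columns μ f) (W : Set X) : Prop := ∀ x, x ∈ W ↔ c.p x ∈ W

lemma Sat.mem_iff {c : Columns μ f} {W : Set X} (h : c.Sat W) (x : X) : c.Θ x ∈ W ↔ x ∈ W := by
  rw [h (c.Θ x), c.p_Θ, ← h x]

/-- The column sums over `W` have the same mean as `f`. -/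
lemma integral_u [IsFiniteMeasure μ] (c : Columns μ f) {W : Set X} (hW : MeasurableSet W)
    (hsat : c.Sat W) (hfi : IntegrableOn f W μ) (hui : IntegrableOn c.u (c.B ∩ W) μ) :
    ∫ x in c.B ∩ W, c.u x ∂μ = ∫ x in W, f x ∂μ := by
  have hBW := c.meas_B.inter hW
  have h1 : Integrable (W.indicator f) μ := (integrable_indicator_iff hW).2 hfi
  have h2 : Integrable ((c.B ∩ W).indicator c.u) μ := (integrable_indicator_iff hBW).2 hui
  have h3 : Integrable (fun x => (c.B ∩ W).indicator c.u (c.Θ x)) μ :=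
    c.mp.integrable_comp_of_integrable h2
  -- On `W`, `f` and the column sums placed at the tops differ by the coboundary of `g`; as `W` is a
  -- union of columns, multiplying by its indicator keeps this true.
  have key : ∀ x, W.indicator f x - (c.B ∩ W).indicator c.u (c.Θ x) =
      W.indicator c.g x - W.indicator c.g (c.Θ x) := by
    intro x
    by_cases hx : x ∈ W
    · have hx' := (hsat.mem_iff x).2 hx
      by_cases hB : c.Θ x ∈ c.B
      · simp [hx, hx', hB, c.eq_top x hB, c.g_base _ hB]
      · simp [hx, hx', hB, c.eq_inner x hB]
    · have hx' : c.Θ x ∉ W := fun h => hx ((hsat.mem_iff x).1 h)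
      simp [hx, hx']
  have h4 := integral_coboundary c.mp (c.meas_g.indicator hW)
    ((h1.sub h3).congr (Eventually.of_forall key))
  rw [← integral_congr_ae (Eventually.of_forall key), integral_sub h1 h3, sub_eq_zero] at h4
  have h5 : ∫ x, (c.B ∩ W).indicator c.u (c.Θ x) ∂μ = ∫ x, (c.B ∩ W).indicator c.u x ∂μ := by
    rw [← integral_map c.Θ.measurable.aemeasurable
      (by rw [c.mp.map_eq]; exact h2.aestronglyMeasurable), c.mp.map_eq]
  rw [← integral_indicator hBW, ← integral_indicator hW, h4, h5]

/-- `c'` arises from `c` by concatenating columns within `W`, and the transfer functions differ by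
at most `δ`. -/
structure Ext (c c' : Columns μ f) (W : Set X) (δ : ℝ) : Prop where
  B_sub : c'.B ⊆ c.B
  Θ_eq : ∀ x, c.Θ x ∉ c.B → c'.Θ x = c.Θ x
  p_comp : ∀ x, c'.p (c.p x) = c'.p x
  sat : c'.Sat W
  off_B : ∀ x ∉ W, x ∈ c.B → x ∈ c'.B
  off_Θ : ∀ x ∉ W, c'.Θ x = c.Θ x
  off_g : ∀ x ∉ W, c'.g x = c.g x
  off_u : ∀ x ∉ W, c'.u x = c.u x
  close : ∀ x, |c'.g x - c.g x| ≤ δ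

lemma Ext.refl (c : Columns μ f) {W : Set X} (hW : c.Sat W) : c.Ext c W 0 where
  B_sub := Subset.rfl
  Θ_eq := fun _ _ => rfl
  p_comp := fun x => c.p_base _ (c.p_mem x)
  sat := hW
  off_B := fun _ _ h => h
  off_Θ := fun _ _ => rfl
  off_g := fun _ _ => rfl
  off_u := fun _ _ => rfl
  close := fun x => by simp

lemma Ext.trans {c c' c'' : Columns μ f} {W : Set X} {δ δ' : ℝ} (h : c.Ext c' W δ)
    (h' : c'.Ext c'' W δ') : c.Ext c'' W (δ + δ') where
  B_sub := h'.B_sub.trans h.B_sub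
  Θ_eq := fun x hx => by
    have h1 := h.Θ_eq x hx
    rw [← h1]
    exact h'.Θ_eq x (h1 ▸ fun h2 => hx (h.B_sub h2))
  p_comp := fun x => by rw [← h'.p_comp, h.p_comp, h'.p_comp]
  sat := h'.sat
  off_B := fun x hx hB => h'.off_B x hx (h.off_B x hx hB)
  off_Θ := fun x hx => (h'.off_Θ x hx).trans (h.off_Θ x hx)
  off_g := fun x hx => (h'.off_g x hx).trans (h.off_g x hx)
  off_u := fun x hx => (h'.off_u x hx).trans (h.off_u x hx)
  close := fun x => by
    have h1 := h.close x
    have h2 := h'.close x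
    calc |c''.g x - c.g x| = |(c''.g x - c'.g x) + (c'.g x - c.g x)| := by ring_nf
      _ ≤ _ := (abs_add_le _ _).trans (by linarith)

/-- The transfer function changes exactly by the sum that precedes a column in its cluster, so a
bound for `before` is the only analytic input. -/
lemma ext_step [StandardBorelSpace X] (c : Columns μ f) (s : Star μ) (hs : s.C ⊆ c.B) {W : Set X}
    (hsW : s.C ⊆ W) (hW : c.Sat W) {δ : ℝ} (hδ : 0 ≤ δ) (hb : ∀ y ∈ s.C, |s.before c.u y| ≤ δ) :
    c.Ext (c.step s hs) W δ where
  B_sub := union_subset sdiff_subset (s.D_zero_subset_C.trans hs)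
  Θ_eq := fun x hx => by
    show s.perm (c.Θ x) = c.Θ x
    exact s.perm_of_notMem fun h => hx (hs h)
  p_comp := fun x => by
    show s.root (c.p (c.p x)) = s.root (c.p x)
    rw [c.p_base _ (c.p_mem x)]
  sat := fun x => by
    show x ∈ W ↔ s.root (c.p x) ∈ W
    rw [hW x]
    by_cases h : c.p x ∈ s.C
    · exact ⟨fun _ => hsW (s.D_zero_subset_C (s.root_mem h)), fun _ => hsW h⟩
    · rw [s.root_of_notMem h]
  off_B := fun x hx hB => Or.inl ⟨hB, fun h => hx (hsW h)⟩
  off_Θ := fun x hx => by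
    show s.perm (c.Θ x) = c.Θ x
    exact s.perm_of_notMem fun h => hx ((hW.mem_iff x).1 (hsW h))
  off_g := fun x hx => by
    show c.g x - s.before c.u (c.p x) = c.g x
    rw [s.before_of_notMem _ fun h => hx ((hW x).2 (hsW h)), sub_zero]
  off_u := fun x hx => s.total_of_notMem _ fun h => hx (hsW (s.D_zero_subset_C h))
  close := fun x => by
    show |c.g x - s.before c.u (c.p x) - c.g x| ≤ δ
    rw [show c.g x - s.before c.u (c.p x) - c.g x = -s.before c.u (c.p x) by ring, abs_neg]
    by_cases h : c.p x ∈ s.C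
    · exact hb _ h
    · rw [s.before_of_notMem _ h]; simpa using hδ

end Columns

/-! ### Concatenations that reduce the column sums. -/

section Halving

variable {X : Type*} [MeasurableSpace X] {μ : Measure X}

namespace Star

lemma psum_neg (s : Star μ) (u : X → ℝ) (n : ℕ) (x : X) :
    s.psum (fun y => -u y) n x = -s.psum u n x := by
  simp [psum]

lemma before_neg (s : Star μ) (u : X → ℝ) (y : X) :
    s.before (fun y => -u y) y = -s.before u y := s.psum_neg u _ _

lemma total_neg (s : Star μ) (u : X → ℝ) (x : X) :
    s.total (fun y => -u y) x = -s.total u x := by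
  unfold total
  split_ifs
  · exact s.psum_neg u _ _
  · rfl

end Star

/-- `D` lies in `φ ⁻¹' E`, whose measure is at most that of `D`; so the two sets agree almost
everywhere. -/
lemma setIntegral_comp_eq {φ : X ≃ᵐ X} (hφ : MeasurePreserving φ μ μ) {D E : Set X}
    (hDE : ∀ x ∈ D, φ x ∈ E) (hD : MeasurableSet D) (hE : MeasurableSet E) (h : μ E ≤ μ D)
    (hfin : μ D ≠ ∞) (u : X → ℝ) : ∫ x in D, u (φ x) ∂μ = ∫ x in E, u x ∂μ := by
  have h1 : D =ᵐ[μ] φ ⁻¹' E := by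
    refine ae_eq_of_subset_of_measure_ge hDE ?_ hD.nullMeasurableSet ?_
    · rwa [hφ.measure_preimage hE.nullMeasurableSet]
    · rw [hφ.measure_preimage hE.nullMeasurableSet]; exact ne_top_of_le_ne_top hfin h
  rw [setIntegral_congr_set h1, hφ.setIntegral_preimage_emb φ.measurableEmbedding]

/-- One round: attach points with negative `u` to the points where the running sum exceeds `a`. -/
lemma exists_attach [StandardBorelSpace X] [IsProbabilityMeasure μ] [NullSingletonClass μ]
    {a : ℝ} (ha : 0 < a) {u t : X → ℝ} (hu : Measurable u) (ht : Measurable t) {P D Z : Set X}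
    (hP : MeasurableSet P) (hD : MeasurableSet D) (hZ : MeasurableSet Z) (hDP : D ⊆ P)
    (huZ : ∀ x ∈ Z, -a ≤ u x ∧ u x < 0) (htP : ∀ x ∈ P, 0 < t x)
    (hti : IntegrableOn t P μ)
    (hintg : ∫ x in P, t x ∂μ + ∫ x in Z, u x ∂μ ≤ 0) :
    ∃ (φ : X ≃ᵐ X) (E D' : Set X), MeasurePreserving φ μ μ ∧ E ⊆ Z ∧ MeasurableSet E ∧
      MeasurableSet D' ∧ D' ⊆ D ∩ {x | a < t x} ∧ μ ((D ∩ {x | a < t x}) \ D') = 0 ∧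
      μ D' = μ E ∧ ∀ x ∈ D', φ x ∈ E := by
  set Q := D ∩ {x | a < t x} with hQ
  have hQm : MeasurableSet Q := hD.inter (measurableSet_lt measurable_const ht)
  have huZi : IntegrableOn u Z μ := by
    refine Measure.integrableOn_of_bounded (M := a) (measure_ne_top _ _) hu.aestronglyMeasurable ?_
    refine (ae_restrict_mem hZ).mono fun x hx => ?_
    rw [Real.norm_eq_abs, abs_le]; exact ⟨(huZ x hx).1, by linarith [(huZ x hx).2]⟩
  -- Supply exceeds demand, by a Markov estimate: `a * μ Q ≤ ∫ t ≤ -∫ u ≤ a * μ Z`, with integrals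
  -- over `P` and `Z`.
  have hle : μ Q ≤ μ Z := by
    have h1 : a * μ.real Q ≤ ∫ x in P, t x ∂μ := by
      calc a * μ.real Q = ∫ x in Q, a ∂μ := by simp [mul_comm]
        _ ≤ ∫ x in Q, t x ∂μ := by
          refine setIntegral_mono_on (integrableOn_const (measure_ne_top _ _))
            (hti.mono_set (inter_subset_left.trans hDP)) hQm fun x hx => le_of_lt hx.2
        _ ≤ ∫ x in P, t x ∂μ := by
          refine setIntegral_mono_set hti ?_ (inter_subset_left.trans hDP).eventuallyLE
          exact (ae_restrict_mem hP).mono fun x hx => (htP x hx).le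
    have h2 : -(a * μ.real Z) ≤ ∫ x in Z, u x ∂μ := by
      calc -(a * μ.real Z) = ∫ x in Z, (-a) ∂μ := by simp [mul_comm]
        _ ≤ ∫ x in Z, u x ∂μ := setIntegral_mono_on (integrableOn_const (measure_ne_top _ _))
            huZi hZ fun x hx => (huZ x hx).1
    have h3 : μ.real Q ≤ μ.real Z := by
      have : a * μ.real Q ≤ a * μ.real Z := by linarith
      exact le_of_mul_le_mul_left this ha
    exact (ENNReal.toReal_le_toReal (measure_ne_top _ _) (measure_ne_top _ _)).1 h3
  obtain ⟨E, hEZ, hEm, hEμ⟩ := exists_subset_measure_eq μ hZ hle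
  obtain ⟨φ, hφ, hφQ⟩ := exists_measurePreserving_preimage_ae_eq μ hQm hEm hEμ.symm
  refine ⟨φ, E, Q ∩ φ ⁻¹' E, hφ, hEZ, hEm, hQm.inter (φ.measurable hEm), inter_subset_left, ?_, ?_,
    fun x hx => hx.2⟩
  · rwa [sdiff_self_inter]
  · rw [hEμ, ← measure_inter_add_sdiff Q (φ.measurable hEm), hφQ, add_zero]

/-- A greedy algorithm. In every round each point of `{u > a}` whose running sum still exceeds `a`
receives one unused point with `-a ≤ u < 0`. The sum was above `a` and drops by at most `a`, so it
stays in `(0, M]`. The nonpositive mean guarantees enough unused points in each round. The sets used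
up are disjoint, so their masses tend to zero, and almost every point stops after finitely many
rounds with a sum at most `a`. -/
lemma exists_star_reduce [StandardBorelSpace X] [IsProbabilityMeasure μ] [NullSingletonClass μ]
    {a M : ℝ} (ha : 0 < a) {u : X → ℝ} (hu : Measurable u) {C : Set X} (hC : MeasurableSet C)
    (huC : ∀ x ∈ C, -a ≤ u x ∧ u x ≤ M) (hintg : ∫ x in C, u x ∂μ ≤ 0) :
    ∃ s : Star μ, s.C ⊆ C ∧ (∀ x ∈ s.D 0, |s.total u x| ≤ a) ∧
      (∀ y ∈ s.C, |s.before u y| ≤ |M|) ∧ μ {x ∈ C | x ∉ s.C ∧ a < u x} = 0 := by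
  classical
  set P : Set X := C ∩ {x | a < u x} with hPdef
  set Z₀ : Set X := C ∩ {x | u x < 0} with hZdef
  have hP : MeasurableSet P := hC.inter (measurableSet_lt measurable_const hu)
  have hZ₀ : MeasurableSet Z₀ := hC.inter (measurableSet_lt hu measurable_const)
  have hPM : ∀ x ∈ P, u x ≤ M := fun x hx => (huC x hx.1).2
  have huCi : IntegrableOn u C μ := by
    refine Measure.integrableOn_of_bounded (M := max a |M|) (measure_ne_top _ _)
      hu.aestronglyMeasurable ((ae_restrict_mem hC).mono fun x hx => ?_)
    rw [Real.norm_eq_abs, abs_le]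
    have := huC x hx
    exact ⟨by linarith [le_max_left a |M|], by linarith [le_max_right a |M|, le_abs_self M]⟩
  -- A state consists of the running sums, the points served in every round so far, and the unused
  -- points with negative `u`.
  let St := (X → ℝ) × Set X × Set X
  let Inv : St → Prop := fun q => Measurable q.1 ∧ MeasurableSet q.2.1 ∧ MeasurableSet q.2.2 ∧
    q.2.1 ⊆ P ∧ q.2.2 ⊆ Z₀ ∧ (∀ x ∈ P, 0 < q.1 x ∧ q.1 x ≤ M) ∧
    ∫ x in P, q.1 x ∂μ + ∫ x in q.2.2, u x ∂μ ≤ 0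
  have hti : ∀ q, Inv q → IntegrableOn q.1 P μ := by
    rintro q ⟨h1, h2, h3, h4, h5, h6, h7⟩
    refine Measure.integrableOn_of_bounded (M := M) (measure_ne_top _ _)
      h1.aestronglyMeasurable ((ae_restrict_mem hP).mono fun x hx => ?_)
    rw [Real.norm_eq_abs, abs_of_pos (h6 x hx).1]; exact (h6 x hx).2
  have step : ∀ q : St, Inv q → ∃ r : (X ≃ᵐ X) × Set X × Set X, MeasurePreserving r.1 μ μ ∧
      r.2.1 ⊆ q.2.2 ∧ MeasurableSet r.2.1 ∧ MeasurableSet r.2.2 ∧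
      r.2.2 ⊆ q.2.1 ∩ {x | a < q.1 x} ∧ μ ((q.2.1 ∩ {x | a < q.1 x}) \ r.2.2) = 0 ∧
      μ r.2.2 = μ r.2.1 ∧ ∀ x ∈ r.2.2, r.1 x ∈ r.2.1 := by
    intro q hq
    have hti' := hti q hq
    obtain ⟨h1, h2, h3, h4, h5, h6, h7⟩ := hq
    obtain ⟨φ, E, D', h⟩ := exists_attach (μ := μ) ha hu h1 hP h2 h3 h4
      (fun x hx => ⟨(huC x (h5 hx).1).1, (h5 hx).2⟩) (fun x hx => (h6 x hx).1) hti' h7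
    exact ⟨⟨φ, E, D'⟩, h⟩
  choose! R hR using step
  let next : St → St := fun q =>
    (fun x => q.1 x + (R q).2.2.indicator (fun y => u ((R q).1 y)) x, (R q).2.2, q.2.2 \ (R q).2.1)
  have hnext : ∀ q, Inv q → Inv (next q) := by
    intro q hq
    have hti' := hti q hq
    obtain ⟨r1, r2, r3, r4, r5, r6, r7, r8⟩ := hR q hq
    obtain ⟨h1, h2, h3, h4, h5, h6, h7⟩ := hq
    have hbd : ∀ x ∈ (R q).2.2, -a ≤ u ((R q).1 x) ∧ u ((R q).1 x) < 0 := fun x hx =>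
      ⟨(huC _ (h5 (r2 (r8 x hx))).1).1, (h5 (r2 (r8 x hx))).2⟩
    have hmi : Measurable ((R q).2.2.indicator fun y => u ((R q).1 y)) :=
      (hu.comp (R q).1.measurable).indicator r4
    refine ⟨h1.add hmi, r4, h3.diff r3,
      fun x hx => h4 (r5 hx).1, fun x hx => h5 hx.1, fun x hx => ?_, ?_⟩
    · by_cases hxD : x ∈ (R q).2.2
      · have hb := hbd x hxD
        have h8 : a < q.1 x := (r5 hxD).2
        simp only [next, indicator_of_mem hxD]
        exact ⟨by linarith, by linarith [(h6 x hx).2]⟩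
      · simp only [next, indicator_of_notMem hxD, add_zero]
        exact h6 x hx
    · have hi1 : IntegrableOn ((R q).2.2.indicator fun y => u ((R q).1 y)) P μ := by
        refine Measure.integrableOn_of_bounded (M := a) (measure_ne_top _ _)
          hmi.aestronglyMeasurable (Eventually.of_forall fun x => ?_)
        by_cases hxD : x ∈ (R q).2.2
        · rw [indicator_of_mem hxD, Real.norm_eq_abs, abs_le]
          exact ⟨(hbd x hxD).1, by linarith [(hbd x hxD).2]⟩
        · rw [indicator_of_notMem hxD]; simpa using ha.le
      have e1 : ∫ x in P, (next q).1 x ∂μ = ∫ x in P, q.1 x ∂μ + ∫ x in (R q).2.1, u x ∂μ := by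
        show ∫ x in P, (q.1 x + (R q).2.2.indicator (fun y => u ((R q).1 y)) x) ∂μ = _
        rw [integral_add hti' hi1, setIntegral_indicator r4,
          inter_eq_right.2 (fun x hx => h4 (r5 hx).1),
          setIntegral_comp_eq r1 r8 r4 r3 r7.ge (measure_ne_top _ _)]
      have e2 : ∫ x in (next q).2.2, u x ∂μ =
          ∫ x in q.2.2, u x ∂μ - ∫ x in (R q).2.1, u x ∂μ := by
        show ∫ x in q.2.2 \ (R q).2.1, u x ∂μ = _
        exact setIntegral_sdiff r3 (huCi.mono_set fun x hx => (h5 hx).1) r2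
      rw [e1, e2]; linarith
  let q : ℕ → St := fun n => Nat.rec (u, P, Z₀) (fun _ => next) n
  have hq0 : Inv (q 0) := by
    refine ⟨hu, hP, hZ₀, Subset.rfl, Subset.rfl, fun x hx => ⟨ha.trans hx.2, hPM x hx⟩, ?_⟩
    have hd : Disjoint P Z₀ := Set.disjoint_left.2 fun x hx hx' => by
      have h1 : a < u x := hx.2
      have h2 : u x < 0 := hx'.2
      linarith
    show ∫ x in P, u x ∂μ + ∫ x in Z₀, u x ∂μ ≤ 0
    rw [← setIntegral_union hd hZ₀ (huCi.mono_set fun x hx => hx.1)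
      (huCi.mono_set fun x hx => hx.1)]
    have hsub : P ∪ Z₀ ⊆ C := union_subset (fun x hx => hx.1) fun x hx => hx.1
    have h1 := setIntegral_sdiff (hP.union hZ₀) huCi hsub
    have h2 : 0 ≤ ∫ x in C \ (P ∪ Z₀), u x ∂μ := by
      refine setIntegral_nonneg (hC.diff (hP.union hZ₀)) fun x hx => ?_
      by_contra! hlt
      exact hx.2 (Or.inr ⟨hx.1, hlt⟩)
    linarith
  have hqI : ∀ n, Inv (q n) := by
    intro n
    induction n with
    | zero => exact hq0
    | succ n ih => exact hnext _ ih
  let D : ℕ → Set X := fun n => (q n).2.1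
  let E : ℕ → Set X := fun n => (R (q n)).2.1
  -- Level `0` is the root itself; round `k` supplies level `k + 1`.
  let φ : ℕ → X ≃ᵐ X := fun n => Nat.casesOn n (MeasurableEquiv.refl X) fun k => (R (q k)).1
  let t : ℕ → X → ℝ := fun n => (q n).1
  have hDm : ∀ n, MeasurableSet (D n) := fun n => (hqI n).2.1
  have hDs : ∀ n, D (n + 1) ⊆ D n := fun n x hx => ((hR (q n) (hqI n)).2.2.2.2.1 hx).1
  have hDt : ∀ n, ∀ x ∈ D (n + 1), a < t n x := fun n x hx =>
    ((hR (q n) (hqI n)).2.2.2.2.1 hx).2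
  have hEZ : ∀ n, E n ⊆ (q n).2.2 := fun n => (hR (q n) (hqI n)).2.1
  have hEm : ∀ n, MeasurableSet (E n) := fun n => (hR (q n) (hqI n)).2.2.1
  have hDE : ∀ n, μ (D (n + 1)) = μ (E n) := fun n => (hR (q n) (hqI n)).2.2.2.2.2.2.1
  have hφE : ∀ n, ∀ x ∈ D (n + 1), φ (n + 1) x ∈ E n := fun n => (hR (q n) (hqI n)).2.2.2.2.2.2.2
  have hlost : ∀ n, μ ((D n ∩ {x | a < t n x}) \ D (n + 1)) = 0 := fun n =>
    (hR (q n) (hqI n)).2.2.2.2.2.1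
  have hZanti : Antitone fun n => (q n).2.2 := antitone_nat_of_succ_le fun n => sdiff_subset
  have hEd : ∀ n m, n < m → Disjoint (E n) (E m) := by
    intro n m hnm
    have h1 : E m ⊆ (q n).2.2 \ E n := (hEZ m).trans (hZanti hnm)
    exact Set.disjoint_left.2 fun x hx hx' => (h1 hx').2 hx
  have hEd' : Pairwise (Function.onFun Disjoint E) := by
    intro n m hnm
    rcases lt_or_gt_of_ne hnm with h | h
    · exact hEd n m h
    · exact (hEd m n h).symm
  have hEZ₀ : ∀ n, E n ⊆ Z₀ := fun n => (hEZ n).trans (hqI n).2.2.2.2.1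
  have htsum : ∑' n, μ (E n) ≠ ∞ := by
    rw [← measure_iUnion hEd' hEm]; exact measure_ne_top _ _
  have hDanti : Antitone D := antitone_nat_of_succ_le hDs
  -- The exceptional roots: those served in every round, and those that should have been served in
  -- some round but were missed.
  set N : Set X := (⋂ n, D n) ∪ ⋃ n, (D n ∩ {x | a < t n x}) \ D (n + 1) with hN
  have hNm : MeasurableSet N := (MeasurableSet.iInter hDm).union (MeasurableSet.iUnion fun n =>
    ((hDm n).inter (measurableSet_lt measurable_const (hqI n).1)).diff (hDm (n + 1)))
  have hN0 : μ N = 0 := by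
    refine measure_union_null ?_ (measure_iUnion_null hlost)
    have h1 := ENNReal.tendsto_atTop_zero_of_tsum_ne_top htsum
    have h2 : ∀ n, μ (⋂ n, D n) ≤ μ (E n) := fun n => by
      rw [← hDE]; exact measure_mono (iInter_subset D (n + 1))
    exact le_antisymm (ge_of_tendsto' h1 h2) bot_le
  have hPZ : ∀ x ∈ P, x ∉ Z₀ := fun x hx hx' => by
    have h1 : a < u x := hx.2
    have h2 : u x < 0 := hx'.2
    linarith
  let s : Star μ :=
    { φ := φ
      D := fun n => D n \ N
      mp := fun n => by
        cases n with
        | zero => exact MeasurePreserving.id μ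
        | succ n => exact (hR (q n) (hqI n)).1
      zero := fun x => rfl
      meas := fun n => (hDm n).diff hNm
      anti := fun n x hx => ⟨hDs n hx.1, hx.2⟩
      fin := fun x => by
        by_contra! h
        exact (h 0).2 (Or.inl (mem_iInter.2 fun n => (h n).1))
      disj := fun n m x y hx hy hxy => by
        have hP0 : ∀ z ∈ D 0, φ 0 z ∈ P := fun z hz => hz
        cases n with
        | zero =>
          cases m with
          | zero => rfl
          | succ m => exact absurd (hEZ₀ m (hφE m y hy.1)) (hxy ▸ hPZ _ (hP0 x hx.1))
        | succ n =>
          cases m with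
          | zero => exact absurd (hEZ₀ n (hφE n x hx.1)) (hxy ▸ hPZ _ (hP0 y hy.1))
          | succ m =>
            by_contra hne
            have h1 : n ≠ m := fun h => hne (by rw [h])
            exact Set.disjoint_left.1 (hEd' h1) (hφE n x hx.1) (hxy ▸ hφE m y hy.1) }
  have hpsum : ∀ n, ∀ x ∈ D n, s.psum u (n + 1) x = t n x := by
    intro n
    induction n with
    | zero => intro x _; simp [Star.psum, s, φ, t, q]
    | succ n ih =>
      intro x hx
      rw [Star.psum, Finset.sum_range_succ]
      have h1 := ih x (hDs n hx)
      rw [Star.psum] at h1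
      rw [h1]
      have : t (n + 1) x = t n x + (D (n + 1)).indicator (fun y => u (φ (n + 1) y)) x := rfl
      rw [this, indicator_of_mem hx]
  have htpos : ∀ n, ∀ x ∈ D n, 0 < t n x ∧ t n x ≤ M := fun n x hx =>
    (hqI n).2.2.2.2.2.1 x ((hqI n).2.2.2.1 hx)
  refine ⟨s, ?_, ?_, ?_, ?_⟩
  · intro y hy
    obtain ⟨n, x, hx, rfl⟩ := s.exists_of_mem_C hy
    cases n with
    | zero => exact hx.1.1
    | succ n => exact (hEZ₀ n (hφE n x hx.1)).1
  · intro x hx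
    obtain ⟨n, h1, h2⟩ := s.exists_last hx
    rw [s.total_of_last u h1 h2, hpsum n x h1.1, abs_of_pos (htpos n x h1.1).1]
    by_contra! hlt
    refine h1.2 (Or.inr (mem_iUnion.2 ⟨n, ⟨h1.1, hlt⟩, fun h3 => h2 ⟨h3, h1.2⟩⟩))
  · intro y hy
    obtain ⟨n, x, hx, rfl⟩ := s.exists_of_mem_C hy
    rw [s.before_φ u hx]
    cases n with
    | zero => simp [Star.psum]
    | succ n =>
      have h1 := htpos n x (hDs n hx.1)
      rw [hpsum n x (hDs n hx.1), abs_of_pos h1.1]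
      exact h1.2.trans (le_abs_self M)
  · refine measure_mono_null (fun x hx => ?_) hN0
    by_contra hxN
    have : x ∈ s.D 0 := ⟨⟨hx.1, hx.2.2⟩, hxN⟩
    exact hx.2.1 (s.D_zero_subset_C this)

/-- Pair off as many points with `u > a` with points with `u < -a` as possible. -/
lemma exists_star_pair [StandardBorelSpace X] [IsProbabilityMeasure μ] [NullSingletonClass μ]
    {a : ℝ} (ha : 0 < a) {u : X → ℝ} (hu : Measurable u) {C : Set X} (hC : MeasurableSet C)
    (huC : ∀ x ∈ C, |u x| ≤ 2 * a) :
    ∃ s : Star μ, s.C ⊆ C ∧ (∀ x ∈ s.D 0, |s.total u x| ≤ a) ∧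
      (∀ y ∈ s.C, |s.before u y| ≤ 2 * a) ∧
      (μ {x ∈ C | x ∉ s.C ∧ a < u x} = 0 ∨ μ {x ∈ C | x ∉ s.C ∧ u x < -a} = 0) := by
  set P : Set X := C ∩ {x | a < u x} with hPdef
  set Q : Set X := C ∩ {x | u x < -a} with hQdef
  have hP : MeasurableSet P := hC.inter (measurableSet_lt measurable_const hu)
  have hQ : MeasurableSet Q := hC.inter (measurableSet_lt hu measurable_const)
  -- Subsets of the common mass `min (μ P) (μ Q)` are matched; the side of smaller mass is thereby
  -- exhausted. A value in `(a, 2a]` plus one in `[-2a, -a)` has absolute value at most `a`.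
  obtain ⟨P', hP'P, hP'm, hP'μ⟩ := exists_subset_measure_eq μ hP (min_le_left (μ P) (μ Q))
  obtain ⟨Q', hQ'Q, hQ'm, hQ'μ⟩ := exists_subset_measure_eq μ hQ (min_le_right (μ P) (μ Q))
  obtain ⟨φ, hφ, hφP⟩ := exists_measurePreserving_preimage_ae_eq μ hP'm hQ'm (hP'μ.trans hQ'μ.symm)
  set D := P' ∩ φ ⁻¹' Q' with hD
  have hDm : MeasurableSet D := hP'm.inter (φ.measurable hQ'm)
  have hPQ : ∀ x ∈ P, x ∉ Q := fun x hx hx' => by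
    have h1 : a < u x := hx.2
    have h2 : u x < -a := hx'.2
    linarith
  let s : Star μ :=
    { φ := fun n => if n = 1 then φ else MeasurableEquiv.refl X
      D := fun n => if n < 2 then D else ∅
      mp := fun n => by
        split_ifs
        · exact hφ
        · exact MeasurePreserving.id μ
      zero := fun x => rfl
      meas := fun n => by split_ifs <;> simp [hDm]
      anti := fun n x hx => by
        by_cases h1 : n + 1 < 2
        · rw [if_pos h1] at hx
          rwa [if_pos (by omega)]
        · rw [if_neg h1] at hx
          exact absurd hx (notMem_empty x)
      fin := fun x => ⟨2, by simp⟩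
      disj := fun n m x y hx hy hxy => by
        rcases n with _ | _ | n
        · rcases m with _ | _ | m
          · rfl
          · have hx : x ∈ D := hx
            have hy : y ∈ D := hy
            have hxy : x = φ y := hxy
            exact absurd (hQ'Q hy.2) (hPQ _ (hxy ▸ hP'P hx.1))
          · simp at hy
        · rcases m with _ | _ | m
          · have hx : x ∈ D := hx
            have hy : y ∈ D := hy
            have hxy : φ x = y := hxy
            exact absurd (hQ'Q hx.2) (hPQ _ (hxy ▸ hP'P hy.1))
          · rfl
          · simp at hy
        · simp at hx }
  have hD0 : s.D 0 = D := rfl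
  have hD1 : s.D 1 = D := rfl
  have hD2 : ∀ n, 2 ≤ n → s.D n = ∅ := fun n hn => if_neg (by omega)
  have hcase : ∀ n x, x ∈ s.D n → (n = 0 ∨ n = 1) ∧ x ∈ D := by
    intro n x hx
    rcases n with _ | _ | n
    · exact ⟨Or.inl rfl, hx⟩
    · exact ⟨Or.inr rfl, hx⟩
    · rw [hD2 _ (by omega)] at hx; exact absurd hx (notMem_empty x)
  have hφ1 : ∀ x, s.φ 1 x = φ x := fun x => rfl
  have hφ0 : ∀ x, s.φ 0 x = x := fun x => rfl
  have hux : ∀ x ∈ D, a < u x ∧ u x ≤ 2 * a ∧ u (φ x) < -a ∧ -(2 * a) ≤ u (φ x) := by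
    intro x hx
    have h1 := hP'P hx.1
    have h2 := hQ'Q hx.2
    exact ⟨h1.2, (abs_le.1 (huC _ h1.1)).2, h2.2, (abs_le.1 (huC _ h2.1)).1⟩
  refine ⟨s, ?_, ?_, ?_, ?_⟩
  · intro y hy
    obtain ⟨n, x, hx, rfl⟩ := s.exists_of_mem_C hy
    obtain ⟨rfl | rfl, hxD⟩ := hcase n x hx
    · exact (hP'P hxD.1).1
    · exact (hQ'Q hxD.2).1
  · intro x hx
    have h2 : x ∉ s.D (1 + 1) := by rw [hD2 _ (by omega)]; exact notMem_empty x
    rw [s.total_of_last u (n := 1) hx h2, Star.psum, Finset.sum_range_succ, Finset.sum_range_one,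
      hφ0, hφ1, abs_le]
    obtain ⟨h3, h4, h5, h6⟩ := hux x hx
    constructor <;> linarith
  · intro y hy
    obtain ⟨n, x, hx, rfl⟩ := s.exists_of_mem_C hy
    rw [s.before_φ u hx]
    obtain ⟨rfl | rfl, hxD⟩ := hcase n x hx
    · simp [Star.psum, ha.le]
    · rw [Star.psum, Finset.sum_range_one, hφ0]
      exact huC x (hP'P hxD.1).1
  · have hDC : D ⊆ s.C := s.D_zero_subset_C
    have hφC : ∀ x ∈ D, φ x ∈ s.C := fun x hx => s.mem_C (n := 1) hx
    rcases le_total (μ P) (μ Q) with h | h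
    · left
      rw [min_eq_left h] at hP'μ
      have h1 : μ (P \ P') = 0 := by
        rw [measure_sdiff hP'P hP'm.nullMeasurableSet (measure_ne_top _ _), hP'μ, tsub_self]
      refine measure_mono_null (fun x hx => ?_) (measure_union_null h1 hφP)
      by_cases hxP : x ∈ P'
      · exact Or.inr ⟨hxP, fun h3 => hx.2.1 (hDC ⟨hxP, h3⟩)⟩
      · exact Or.inl ⟨⟨hx.1, hx.2.2⟩, hxP⟩
    · right
      rw [min_eq_right h] at hQ'μ hP'μ
      have h1 : μ (Q \ Q') = 0 := by
        rw [measure_sdiff hQ'Q hQ'm.nullMeasurableSet (measure_ne_top _ _), hQ'μ, tsub_self]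
      -- `φ` maps `D` into `Q'` and both have the same mass, so almost all of `Q'` is hit.
      have h2 : μ (Q' \ φ '' D) = 0 := by
        have h3 : μ (φ '' D) = μ Q' := by
          rw [φ.image_eq_preimage_symm, (MeasurePreserving.symm φ hφ).measure_preimage
            hDm.nullMeasurableSet, hD, hQ'μ, ← hP'μ, ← measure_inter_add_sdiff P' (φ.measurable hQ'm),
            hφP, add_zero]
        rw [measure_sdiff (by rintro _ ⟨x, hx, rfl⟩; exact hx.2)
          (φ.measurableSet_image.2 hDm).nullMeasurableSet (measure_ne_top _ _), h3, tsub_self]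
      refine measure_mono_null (fun x hx => ?_) (measure_union_null h1 h2)
      by_cases hxQ : x ∈ Q'
      · refine Or.inr ⟨hxQ, ?_⟩
        rintro ⟨y, hy, rfl⟩
        exact hx.2.1 (hφC y hy)
      · exact Or.inl ⟨⟨hx.1, hx.2.2⟩, hxQ⟩

end Halving

section Halving

variable {X : Type*} [MeasurableSpace X] {μ : Measure X}

/-- The second alternative is the first one for `-u`; with mean zero the integral condition holds
for either sign. -/
lemma exists_star_reduce_abs [StandardBorelSpace X] [IsProbabilityMeasure μ] [NullSingletonClass μ]
    {a M : ℝ} (ha : 0 < a) {u : X → ℝ} (hu : Measurable u) {C : Set X} (hC : MeasurableSet C)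
    (huC : (∀ x ∈ C, -a ≤ u x ∧ u x ≤ M) ∨ (∀ x ∈ C, -a ≤ -u x ∧ -u x ≤ M))
    (hintg : ∫ x in C, u x ∂μ = 0) :
    ∃ s : Star μ, s.C ⊆ C ∧ (∀ x ∈ s.D 0, |s.total u x| ≤ a) ∧
      (∀ y ∈ s.C, |s.before u y| ≤ |M|) ∧ μ {x ∈ C | x ∉ s.C ∧ a < |u x|} = 0 := by
  rcases huC with huC | huC
  · obtain ⟨s, h1, h2, h3, h4⟩ := exists_star_reduce (μ := μ) ha hu hC huC hintg.le
    refine ⟨s, h1, h2, h3, ?_⟩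
    refine measure_mono_null (fun x hx => ?_) h4
    refine ⟨hx.1, hx.2.1, ?_⟩
    rcases lt_abs.1 hx.2.2 with h | h
    · exact h
    · linarith [(huC x hx.1).1]
  · obtain ⟨s, h1, h2, h3, h4⟩ := exists_star_reduce (μ := μ) ha hu.neg hC huC
      (by rw [show (-u) = fun x => -u x from rfl, integral_neg, hintg, neg_zero])
    refine ⟨s, h1, fun x hx => ?_, fun y hy => ?_, ?_⟩
    · have := h2 x hx
      rwa [show (-u) = fun x => -u x from rfl, s.total_neg, abs_neg] at this
    · have := h3 y hy
      rwa [show (-u) = fun x => -u x from rfl, s.before_neg, abs_neg] at this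
    · refine measure_mono_null (fun x hx => ?_) h4
      refine ⟨hx.1, hx.2.1, ?_⟩
      rcases lt_abs.1 hx.2.2 with h | h
      · linarith [(huC x hx.1).1]
      · exact h

namespace Columns

variable {f : X → ℝ}

lemma integrableOn_u [IsFiniteMeasure μ] (c : Columns μ f) {W : Set X} {ε : ℝ}
    (hu : ∀ᵐ x ∂μ, x ∈ c.B ∩ W → |c.u x| ≤ ε) (hW : MeasurableSet W) :
    IntegrableOn c.u (c.B ∩ W) μ := by
  refine Measure.integrableOn_of_bounded (M := ε) (measure_ne_top _ _)
    c.meas_u.aestronglyMeasurable ?_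
  exact (ae_restrict_iff' (c.meas_B.inter hW)).2 hu

lemma step_u_bound [StandardBorelSpace X] (c : Columns μ f) (s : Star μ) (hs : s.C ⊆ c.B)
    {W : Set X} {a : ℝ} (hD : ∀ x ∈ s.D 0, |s.total c.u x| ≤ a)
    (h : ∀ᵐ x ∂μ, x ∈ c.B ∩ W → x ∉ s.C → |c.u x| ≤ a) :
    ∀ᵐ x ∂μ, x ∈ (c.step s hs).B ∩ W → |(c.step s hs).u x| ≤ a := by
  filter_upwards [h] with x hx hxB
  rcases hxB with ⟨hxB | hxB, hxW⟩
  · have hx0 : x ∉ s.D 0 := fun h => hxB.2 (s.D_zero_subset_C h)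
    show |s.total c.u x| ≤ a
    rw [s.total_of_notMem _ hx0]
    exact hx ⟨hxB.1, hxW⟩ hxB.2
  · exact hD x hxB

/-- The mean of `f` over `W` is zero, hence by `integral_u` so is that of the column sums over the
base. This is what the greedy cancellation needs. -/
lemma exists_ext_reduce [StandardBorelSpace X] [IsProbabilityMeasure μ] [NullSingletonClass μ]
    (c : Columns μ f) {W : Set X} (hW : MeasurableSet W) (hsat : c.Sat W)
    (hfi : IntegrableOn f W μ) (hintg : ∫ x in W, f x ∂μ = 0) {a : ℝ} (ha : 0 < a)
    (hu : (∀ᵐ x ∂μ, x ∈ c.B ∩ W → -a ≤ c.u x ∧ c.u x ≤ 2 * a) ∨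
      (∀ᵐ x ∂μ, x ∈ c.B ∩ W → -a ≤ -c.u x ∧ -c.u x ≤ 2 * a)) :
    ∃ c', c.Ext c' W (2 * a) ∧ ∀ᵐ x ∂μ, x ∈ c'.B ∩ W → |c'.u x| ≤ a := by
  have hab : ∀ᵐ x ∂μ, x ∈ c.B ∩ W → |c.u x| ≤ 2 * a := by
    rcases hu with hu | hu
    · filter_upwards [hu] with x hx hxB
      have := hx hxB
      rw [abs_le]; constructor <;> linarith
    · filter_upwards [hu] with x hx hxB
      have := hx hxB
      rw [abs_le]; constructor <;> linarith
  have hzero := (c.integral_u hW hsat hfi (c.integrableOn_u hab hW)).trans hintg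
  obtain ⟨C, hCm, hCsub, hCae, hCu⟩ : ∃ C, MeasurableSet C ∧ C ⊆ c.B ∩ W ∧
      (∀ᵐ x ∂μ, x ∈ c.B ∩ W → x ∈ C) ∧ ((∀ x ∈ C, -a ≤ c.u x ∧ c.u x ≤ 2 * a) ∨
      (∀ x ∈ C, -a ≤ -c.u x ∧ -c.u x ≤ 2 * a)) := by
    rcases hu with hu | hu
    · refine ⟨c.B ∩ W ∩ {x | -a ≤ c.u x ∧ c.u x ≤ 2 * a}, ?_, inter_subset_left, ?_,
        Or.inl fun x hx => hx.2⟩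
      · exact (c.meas_B.inter hW).inter ((measurableSet_le measurable_const c.meas_u).inter
          (measurableSet_le c.meas_u measurable_const))
      · filter_upwards [hu] with x hx hxB using ⟨hxB, hx hxB⟩
    · refine ⟨c.B ∩ W ∩ {x | -a ≤ -c.u x ∧ -c.u x ≤ 2 * a}, ?_, inter_subset_left, ?_,
        Or.inr fun x hx => hx.2⟩
      · exact (c.meas_B.inter hW).inter ((measurableSet_le measurable_const c.meas_u.neg).inter
          (measurableSet_le c.meas_u.neg measurable_const))
      · filter_upwards [hu] with x hx hxB using ⟨hxB, hx hxB⟩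
  have hCeq : (C : Set X) =ᵐ[μ] (c.B ∩ W : Set X) := by
    refine eventuallyEq_set.2 ?_
    filter_upwards [hCae] with x hx using ⟨fun h => hCsub h, hx⟩
  obtain ⟨s, h1, h2, h3, h4⟩ := exists_star_reduce_abs (μ := μ) ha c.meas_u hCm hCu
    (by rw [setIntegral_congr_set hCeq, hzero])
  have hs : s.C ⊆ c.B := fun x hx => (hCsub (h1 hx)).1
  refine ⟨c.step s hs, c.ext_step s hs (fun x hx => (hCsub (h1 hx)).2) hsat (by linarith) ?_, ?_⟩
  · intro y hy
    have := h3 y hy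
    rwa [abs_of_pos (by linarith : 0 < 2 * a)] at this
  · refine c.step_u_bound s hs h2 ?_
    have h4' : ∀ᵐ x ∂μ, ¬ (x ∈ C ∧ x ∉ s.C ∧ a < |c.u x|) := by
      rw [ae_iff]; simpa using h4
    filter_upwards [h4', hCae] with x hx hx' hxB hxs
    by_contra! hlt
    exact hx ⟨hx' hxB, hxs, hlt⟩

/-- Concatenating columns halves the bound for the column sums. -/
lemma exists_ext_halve [StandardBorelSpace X] [IsProbabilityMeasure μ] [NullSingletonClass μ]
    (c : Columns μ f) {W : Set X} (hW : MeasurableSet W) (hsat : c.Sat W)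
    (hfi : IntegrableOn f W μ) (hintg : ∫ x in W, f x ∂μ = 0) {a : ℝ} (ha : 0 < a)
    (hu : ∀ᵐ x ∂μ, x ∈ c.B ∩ W → |c.u x| ≤ 2 * a) :
    ∃ c', c.Ext c' W (4 * a) ∧ ∀ᵐ x ∂μ, x ∈ c'.B ∩ W → |c'.u x| ≤ a := by
  set C := c.B ∩ W ∩ {x | |c.u x| ≤ 2 * a} with hC
  have hCm : MeasurableSet C := (c.meas_B.inter hW).inter
    (measurableSet_le c.meas_u.abs measurable_const)
  obtain ⟨s, h1, h2, h3, h4⟩ := exists_star_pair (μ := μ) ha c.meas_u hCm fun x hx => hx.2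
  have hs : s.C ⊆ c.B := fun x hx => (h1 hx).1.1
  have hE := c.ext_step s hs (fun x hx => (h1 hx).1.2) hsat (by linarith) h3
  have hu1 : ∀ᵐ x ∂μ, x ∈ (c.step s hs).B ∩ W → |(c.step s hs).u x| ≤ 2 * a :=
    c.step_u_bound s hs (fun x hx => (h2 x hx).trans (by linarith)) (by
      filter_upwards [hu] with x hx hxB _ using hx hxB)
  have hval : ∀ x ∈ (c.step s hs).B ∩ W, |(c.step s hs).u x| ≤ a ∨
      (x ∈ c.B ∩ W ∧ x ∉ s.C ∧ (c.step s hs).u x = c.u x) := by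
    rintro x ⟨hxB | hxB, hxW⟩
    · have hx0 : x ∉ s.D 0 := fun h => hxB.2 (s.D_zero_subset_C h)
      exact Or.inr ⟨⟨hxB.1, hxW⟩, hxB.2, s.total_of_notMem _ hx0⟩
    · exact Or.inl (h2 x hxB)
  -- After the pairing one of the tails `{u > a}`, `{u < -a}` is null, so the column sums are
  -- one-sided. Pairing and cancellation each move the transfer function by at most `2 * a`.
  obtain ⟨c', hc', hb⟩ := (c.step s hs).exists_ext_reduce hW hE.sat hfi hintg ha (by
    rcases h4 with h4 | h4
    · right
      have h4' : ∀ᵐ x ∂μ, ¬ (x ∈ C ∧ x ∉ s.C ∧ a < c.u x) := by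
        rw [ae_iff]; simpa using h4
      filter_upwards [h4', hu1, hu] with x hx hx1 hx2 hxB
      have hb := abs_le.1 (hx1 hxB)
      refine ⟨?_, by linarith⟩
      rcases hval x hxB with h | ⟨h, h', h''⟩
      · linarith [(abs_le.1 h).2]
      · rw [h'']
        by_contra! hlt
        exact hx ⟨⟨h, hx2 h⟩, h', by linarith⟩
    · left
      have h4' : ∀ᵐ x ∂μ, ¬ (x ∈ C ∧ x ∉ s.C ∧ c.u x < -a) := by
        rw [ae_iff]; simpa using h4
      filter_upwards [h4', hu1, hu] with x hx hx1 hx2 hxB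
      have hb := abs_le.1 (hx1 hxB)
      refine ⟨?_, by linarith⟩
      rcases hval x hxB with h | ⟨h, h', h''⟩
      · linarith [(abs_le.1 h).1]
      · rw [h'']
        by_contra! hlt
        exact hx ⟨⟨h, hx2 h⟩, h', by linarith⟩)
  refine ⟨c', ?_, hb⟩
  have := hE.trans hc'
  rwa [show 2 * a + 2 * a = 4 * a by ring] at this

/-- Iterated halving: a halving that ends with the bound `a` costs `4 * a`, and the costs form a
geometric series whose sum does not depend on `n`. -/
lemma exists_ext_small [StandardBorelSpace X] [IsProbabilityMeasure μ] [NullSingletonClass μ]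
    (c : Columns μ f) {W : Set X} (hW : MeasurableSet W) (hsat : c.Sat W)
    (hfi : IntegrableOn f W μ) (hintg : ∫ x in W, f x ∂μ = 0) {ε : ℝ} (hε : 0 < ε)
    (hu : ∀ᵐ x ∂μ, x ∈ c.B ∩ W → |c.u x| ≤ ε) (n : ℕ) :
    ∃ c', c.Ext c' W (4 * ε) ∧ ∀ᵐ x ∂μ, x ∈ c'.B ∩ W → |c'.u x| ≤ ε / 2 ^ n := by
  -- In this form the cost telescopes: step `n + 1` adds `4 * (ε / 2 ^ (n + 1))`.
  suffices H : ∃ c', c.Ext c' W (4 * ε - 4 * (ε / 2 ^ n)) ∧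
      ∀ᵐ x ∂μ, x ∈ c'.B ∩ W → |c'.u x| ≤ ε / 2 ^ n by
    obtain ⟨c', h, h'⟩ := H
    have hpos : 0 < ε / 2 ^ n := by positivity
    exact ⟨c', { h with close := fun x => (h.close x).trans (by linarith) }, h'⟩
  induction n with
  | zero =>
    refine ⟨c, ?_, by simpa using hu⟩
    have := Ext.refl c hsat
    simpa using this
  | succ n ih =>
    obtain ⟨c₁, h1, h2⟩ := ih
    have e : ε / 2 ^ n = 2 * (ε / 2 ^ (n + 1)) := by field_simp; ring
    rw [e] at h2
    obtain ⟨c₂, h3, h4⟩ := c₁.exists_ext_halve hW h1.sat hfi hintg (by positivity) h2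
    refine ⟨c₂, ?_, h4⟩
    have := h1.trans h3
    rw [e] at this
    convert this using 1
    ring

end Columns

end Halving

/-! ### Couplings and orderings that keep partial sums bounded. -/

section Couple

variable {X : Type*} [MeasurableSpace X]

/-- The individual exchange maps, glued along the `P i`, are jointly injective off a null set
because the `Q i` are disjoint; equal masses make the `Q i` cover almost everything too. -/
lemma exists_measurePreserving_glue_of_cover [StandardBorelSpace X] (μ : Measure X)
    [IsProbabilityMeasure μ] [NullSingletonClass μ] {P Q : ℕ → Set X}
    (hP : ∀ i, MeasurableSet (P i)) (hQ : ∀ i, MeasurableSet (Q i))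
    (hPd : Pairwise (Function.onFun Disjoint P)) (hQd : Pairwise (Function.onFun Disjoint Q))
    (hPU : ⋃ i, P i = univ) (h : ∀ i, μ (P i) = μ (Q i)) :
    ∃ e : X ≃ᵐ X, MeasurePreserving e μ μ ∧ ∀ i, μ (P i \ e ⁻¹' Q i) = 0 := by
  classical
  choose φ hφ hφQ using fun i => exists_measurePreserving_preimage_ae_eq μ (hP i) (hQ i) (h i)
  have hex : ∀ x, ∃ i, x ∈ P i := fun x => mem_iUnion.1 (hPU ▸ mem_univ x)
  let idx : X → ℕ := fun x => Nat.find (hex x)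
  have hidx : Measurable idx := measurable_find _ hP
  have hidxP : ∀ i, ∀ x ∈ P i, idx x = i := by
    intro i x hx
    by_contra hne
    exact Set.disjoint_left.1 (hPd hne) (Nat.find_spec (hex x)) hx
  let F : X → X := fun x => φ (idx x) x
  have hF : Measurable F := Star.measurable_of_idx hidx fun n => (φ n).measurable
  have hFP : ∀ i, ∀ x ∈ P i, F x = φ i x := fun i x hx => by simp only [F, hidxP i x hx]
  let X₀ : Set X := ⋃ i, P i ∩ φ i ⁻¹' Q i
  have hX₀ : MeasurableSet X₀ := .iUnion fun i => (hP i).inter ((φ i).measurable (hQ i))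
  have hX₀0 : μ X₀ᶜ = 0 := by
    refine measure_mono_null (t := ⋃ i, P i \ φ i ⁻¹' Q i) (fun x hx => ?_)
      (measure_iUnion_null hφQ)
    obtain ⟨i, hi⟩ := hex x
    exact mem_iUnion.2 ⟨i, hi, fun h' => hx (mem_iUnion.2 ⟨i, hi, h'⟩)⟩
  have hinj : InjOn F X₀ := by
    intro x hx y hy hxy
    obtain ⟨i, hi, hi'⟩ := mem_iUnion.1 hx
    obtain ⟨j, hj, hj'⟩ := mem_iUnion.1 hy
    rw [hFP i x hi, hFP j y hj] at hxy
    have hij : i = j := by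
      by_contra hne
      exact Set.disjoint_left.1 (hQd hne) hi' (show φ i x ∈ Q j from hxy ▸ hj')
    subst hij
    exact (φ i).injective hxy
  obtain ⟨e, he⟩ := exists_measurableEquiv_ae_eq hF hX₀ hX₀0 hinj
  refine ⟨e, ⟨e.measurable, ?_⟩, fun i => ?_⟩
  · rw [Measure.map_congr he]
    have hQU : μ (⋃ i, Q i)ᶜ = 0 := by
      rw [prob_compl_eq_zero_iff (.iUnion hQ), measure_iUnion hQd hQ, ← tsum_congr h,
        ← measure_iUnion hPd hP, hPU, measure_univ]
    refine Measure.ext fun A hA => ?_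
    rw [Measure.map_apply hF hA]
    have h1 : F ⁻¹' A = ⋃ i, P i ∩ φ i ⁻¹' A := by
      ext x
      obtain ⟨i, hi⟩ := hex x
      simp only [mem_preimage, mem_iUnion, mem_inter_iff]
      exact ⟨fun hx => ⟨i, hi, hFP i x hi ▸ hx⟩, fun ⟨j, hj, hx⟩ => (hFP j x hj).symm ▸ hx⟩
    have h2 : μ A = μ (⋃ i, Q i ∩ A) := by
      rw [← iUnion_inter]
      refine measure_congr (eventuallyEq_set.2 ?_)
      filter_upwards [measure_eq_zero_iff_ae_notMem.1 hQU] with x hx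
      simp only [mem_compl_iff, not_not] at hx
      simp [hx]
    rw [h1, h2, measure_iUnion, measure_iUnion]
    · refine tsum_congr fun i => ?_
      have h3 : P i =ᵐ[μ] φ i ⁻¹' Q i := by
        have h4 : μ (P i) = μ (φ i ⁻¹' Q i) := by
          rw [(hφ i).measure_preimage (hQ i).nullMeasurableSet, h]
        refine ae_le_set.2 (hφQ i) |>.antisymm ?_
        refine ae_le_set.2 ?_
        have h5 := measure_inter_add_sdiff (μ := μ) (φ i ⁻¹' Q i) (hP i)
        have h6 := measure_inter_add_sdiff (μ := μ) (P i) ((φ i).measurable (hQ i))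
        rw [hφQ i, add_zero] at h6
        rw [inter_comm, h6, h4] at h5
        exact (ENNReal.add_right_inj (measure_ne_top _ _)).1 (h5.trans (add_zero _).symm)
      have h4 : (P i ∩ φ i ⁻¹' A : Set X) =ᵐ[μ] (φ i ⁻¹' (Q i ∩ A) : Set X) :=
        h3.inter (ae_eq_refl _)
      rw [measure_congr h4, (hφ i).measure_preimage ((hQ i).inter hA).nullMeasurableSet]
    · exact fun i j hij => (hQd hij).mono inter_subset_left inter_subset_left
    · exact fun i => (hQ i).inter hA
    · exact fun i j hij => (hPd hij).mono inter_subset_left inter_subset_left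
    · exact fun i => (hP i).inter ((φ i).measurable hA)
  · refine measure_mono_null (t := {x | e x ≠ F x} ∪ (P i \ φ i ⁻¹' Q i)) (fun x hx => ?_)
      (measure_union_null (ae_iff.1 he) (hφQ i))
    by_cases hex : e x = F x
    · refine Or.inr ⟨hx.1, fun h' => hx.2 ?_⟩
      rw [mem_preimage, hex, hFP i x hx.1]; exact h'
    · exact Or.inl hex

lemma exists_measurePreserving_glue [StandardBorelSpace X] (μ : Measure X)
    [IsProbabilityMeasure μ] [NullSingletonClass μ] {P Q : ℕ → Set X}
    (hP : ∀ i, MeasurableSet (P i)) (hQ : ∀ i, MeasurableSet (Q i))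
    (hPd : Pairwise (Function.onFun Disjoint P)) (hQd : Pairwise (Function.onFun Disjoint Q))
    (h : ∀ i, μ (P i) = μ (Q i)) :
    ∃ e : X ≃ᵐ X, MeasurePreserving e μ μ ∧ ∀ i, μ (P i \ e ⁻¹' Q i) = 0 := by
  -- The complement of the union is prepended as piece `0`, so that the family covers `X`.
  let ext : (ℕ → Set X) → ℕ → Set X := fun R n => Nat.casesOn n (⋃ i, R i)ᶜ R
  have hm : ∀ R : ℕ → Set X, (∀ i, MeasurableSet (R i)) → ∀ i, MeasurableSet (ext R i) := by
    rintro R hR (_ | i)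
    · exact (MeasurableSet.iUnion hR).compl
    · exact hR i
  have hd : ∀ R : ℕ → Set X, Pairwise (Function.onFun Disjoint R) →
      Pairwise (Function.onFun Disjoint (ext R)) := by
    rintro R hR (_ | i) (_ | j) hij
    · exact absurd rfl hij
    · exact Set.disjoint_left.2 fun x hx hx' => hx (mem_iUnion.2 ⟨j, hx'⟩)
    · exact Set.disjoint_left.2 fun x hx hx' => hx' (mem_iUnion.2 ⟨i, hx⟩)
    · exact hR fun h => hij (by rw [h])
  obtain ⟨e, he, heQ⟩ := exists_measurePreserving_glue_of_cover μ (hm P hP) (hm Q hQ) (hd P hPd)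
    (hd Q hQd) (by
      ext x
      simp only [mem_iUnion, mem_univ, iff_true]
      by_cases hx : x ∈ ⋃ i, P i
      · obtain ⟨i, hi⟩ := mem_iUnion.1 hx
        exact ⟨i + 1, hi⟩
      · exact ⟨0, hx⟩) (by
      rintro (_ | i)
      · show μ (⋃ i, P i)ᶜ = μ (⋃ i, Q i)ᶜ
        rw [prob_compl_eq_one_sub (.iUnion hP), prob_compl_eq_one_sub (.iUnion hQ),
          measure_iUnion hPd hP, measure_iUnion hQd hQ, tsum_congr h]
      · exact h i)
  exact ⟨e, he, fun i => heQ (i + 1)⟩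

/-- Antitone coupling: adding `u` along a suitable measure preserving map `D → E` does not increase
the oscillation of `s` above that of `u` plus `θ`. -/
lemma exists_antitone_coupling [StandardBorelSpace X] (μ : Measure X)
    [IsProbabilityMeasure μ] [NullSingletonClass μ] {D E : Set X} (hD : MeasurableSet D)
    (hE : MeasurableSet E) (hDE : μ D = μ E) {s u : X → ℝ} (hs : Measurable s) (hu : Measurable u)
    {ε θ R : ℝ} (hθ : 0 < θ) (huE : ∀ x ∈ E, |u x| ≤ ε) (hR : 2 * ε + θ ≤ R)
    (hsD : ∀ x ∈ D, ∀ y ∈ D, s x - s y ≤ R) :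
    ∃ (φ : X ≃ᵐ X) (D' : Set X), MeasurePreserving φ μ μ ∧ D' ⊆ D ∧ MeasurableSet D' ∧
      μ (D \ D') = 0 ∧ (∀ x ∈ D', φ x ∈ E) ∧
      ∀ x ∈ D', ∀ y ∈ D', (s x + u (φ x)) - (s y + u (φ y)) ≤ R := by
  rcases D.eq_empty_or_nonempty with rfl | ⟨x₀, hx₀⟩
  · exact ⟨.refl X, ∅, .id μ, Subset.rfl, .empty, by simp, by simp, by simp⟩
  -- `t` reverses the order of `s`. It is cut into layers of thickness `θ`, and `E`, sorted by
  -- increasing `u`, into consecutive segments of the same masses. Layer `i` is sent to segment `i`,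
  -- so that large `s` meets small `u`.
  set t : X → ℝ := fun x => s x₀ + R - s x with ht
  have htm : Measurable t := measurable_const.sub hs
  have ht0 : ∀ x ∈ D, 0 ≤ t x := fun x hx => by
    have := hsD x hx x₀ hx₀
    simp only [ht]; linarith
  let M : ℕ → ℝ≥0∞ := fun i => μ (D ∩ {x | t x < i * θ})
  have hMm : ∀ i : ℕ, MeasurableSet (D ∩ {x | t x < i * θ}) := fun i =>
    hD.inter (measurableSet_lt htm measurable_const)
  have hsub : ∀ {i j : ℕ}, i ≤ j → D ∩ {x | t x < i * θ} ⊆ D ∩ {x | t x < j * θ} := by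
    intro i j hij x hx
    refine ⟨hx.1, lt_of_lt_of_le (show t x < i * θ from hx.2) ?_⟩
    have : (i : ℝ) ≤ j := by exact_mod_cast hij
    exact mul_le_mul_of_nonneg_right this hθ.le
  obtain ⟨S, hS0, hSmono, hSE, hSm, hSμ, hSu⟩ := exists_initial_segments μ hE hu (M := M)
    (by
      have : D ∩ {x | t x < (0 : ℕ) * θ} = ∅ := by
        ext x
        simp only [mem_inter_iff, mem_ofPred_eq, mem_empty_iff_false, iff_false, not_and, not_lt]
        intro hx
        simpa using ht0 x hx
      simp only [M, this, measure_empty])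
    (fun i j hij => measure_mono (hsub hij))
    (fun i => hDE ▸ measure_mono inter_subset_left)
  let P : ℕ → Set X := fun i => (D ∩ {x | t x < (i + 1 : ℕ) * θ}) \ (D ∩ {x | t x < i * θ})
  let Q : ℕ → Set X := fun i => S (i + 1) \ S i
  have hPmem : ∀ i, ∀ x ∈ P i, x ∈ D ∧ i * θ ≤ t x ∧ t x < (i + 1) * θ := by
    intro i x hx
    refine ⟨hx.1.1, ?_, by simpa using hx.1.2⟩
    by_contra! hlt
    exact hx.2 ⟨hx.1.1, hlt⟩
  have hPd : Pairwise (Function.onFun Disjoint P) := by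
    refine (pairwise_disjoint_on P).2 fun i j hij => ?_
    refine Set.disjoint_left.2 fun x hx hx' => hx'.2 (hsub (Nat.succ_le_of_lt hij) hx.1)
  have hQd : Pairwise (Function.onFun Disjoint Q) := by
    refine (pairwise_disjoint_on Q).2 fun i j hij => ?_
    refine Set.disjoint_left.2 fun x hx hx' => hx'.2 (hSmono (Nat.succ_le_of_lt hij) hx.1)
  obtain ⟨φ, hφ, hφQ⟩ := exists_measurePreserving_glue μ (P := P) (Q := Q)
    (fun i => (hMm _).diff (hMm _)) (fun i => (hSm _).diff (hSm _)) hPd hQd (fun i => by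
      rw [measure_sdiff (hsub (Nat.le_succ i)) (hMm _).nullMeasurableSet (measure_ne_top _ _),
        measure_sdiff (hSmono (Nat.le_succ i)) (hSm _).nullMeasurableSet (measure_ne_top _ _),
        hSμ, hSμ])
  let D' : Set X := ⋃ i, P i ∩ φ ⁻¹' Q i
  refine ⟨φ, D', hφ, ?_, ?_, ?_, ?_, ?_⟩
  · exact iUnion_subset fun i x hx => (hPmem i x hx.1).1
  · exact .iUnion fun i => ((hMm _).diff (hMm _)).inter (φ.measurable ((hSm _).diff (hSm _)))
  · refine measure_mono_null (t := ⋃ i, P i \ φ ⁻¹' Q i) (fun x hx => ?_)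
      (measure_iUnion_null hφQ)
    have h0 := ht0 x hx.1
    have hfl : x ∈ P ⌊t x / θ⌋₊ := by
      refine ⟨⟨hx.1, ?_⟩, fun h => ?_⟩
      · have := Nat.lt_floor_add_one (t x / θ)
        rw [div_lt_iff₀ hθ] at this
        show t x < _
        simpa using this
      · have h1 : t x < ⌊t x / θ⌋₊ * θ := h.2
        have := Nat.floor_le (div_nonneg h0 hθ.le)
        rw [le_div_iff₀ hθ] at this
        linarith
    exact mem_iUnion.2 ⟨_, hfl, fun h' => hx.2 (mem_iUnion.2 ⟨_, hfl, h'⟩)⟩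
  · intro x hx
    obtain ⟨i, _, hi⟩ := mem_iUnion.1 hx
    exact hSE _ hi.1
  · intro x hx y hy
    obtain ⟨i, hi, hi'⟩ := mem_iUnion.1 hx
    obtain ⟨j, hj, hj'⟩ := mem_iUnion.1 hy
    obtain ⟨hxD, hx1, hx2⟩ := hPmem i x hi
    obtain ⟨hyD, hy1, hy2⟩ := hPmem j y hj
    have hux := abs_le.1 (huE _ (hSE _ hi'.1))
    have huy := abs_le.1 (huE _ (hSE _ hj'.1))
    simp only [ht] at hx1 hx2 hy1 hy2
    -- For `i < j` the term `u` does not increase the old difference. Within a layer `s` varies by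
    -- less than `θ` and `u` by at most `2 * ε`. For `j < i` the difference of `s` is negative and
    -- `u` contributes at most `2 * ε`.
    rcases lt_trichotomy i j with hij | hij | hij
    · have h1 : u (φ x) ≤ u (φ y) := hSu (i + 1) _ hi'.1 _ (hSE _ hj'.1)
        fun h => hj'.2 (hSmono (Nat.succ_le_of_lt hij) h)
      linarith [hsD x hxD y hyD]
    · subst hij
      linarith
    · have h1 : ((j : ℝ) + 1) * θ ≤ i * θ := by
        have : ((j : ℝ) + 1) ≤ i := by exact_mod_cast hij
        exact mul_le_mul_of_nonneg_right this hθ.le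
      linarith

/-- Since the running sum and the remaining terms add up to zero, some remaining term is not
strictly of the sign of the running sum; adding it keeps the absolute value at most `b`. The start
value `s` is arbitrary for the sake of the induction. -/
lemma exists_balanced_enumeration {a : ℕ → ℝ} {b : ℝ} (n : ℕ) : ∀ (S : Finset ℕ) (s : ℝ),
    S.card = n → (∀ i ∈ S, |a i| ≤ b) → |s| ≤ b → s + ∑ i ∈ S, a i = 0 →
    ∃ π : ℕ → ℕ, (∀ i < n, π i ∈ S) ∧ InjOn π (Iio n) ∧
      ∀ k ≤ n, |s + ∑ i ∈ Finset.range k, a (π i)| ≤ b := by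
  induction n with
  | zero =>
    intro S s hS ha hs h0
    refine ⟨id, by simp, by simp [InjOn], fun k hk => ?_⟩
    obtain rfl : k = 0 := by omega
    simpa using hs
  | succ n ih =>
    intro S s hS ha hs h0
    have hne : S.Nonempty := Finset.card_pos.1 (by omega)
    obtain ⟨i₀, hi₀, hb⟩ : ∃ i ∈ S, |s + a i| ≤ b := by
      by_contra! h
      rcases le_total 0 s with hs0 | hs0
      · have : 0 < ∑ i ∈ S, a i := by
          refine Finset.sum_pos (fun i hi => ?_) hne
          by_contra! hlt
          refine (h i hi).not_ge (abs_le.2 ?_)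
          have h1 := abs_le.1 (ha i hi)
          have h2 := abs_le.1 hs
          constructor <;> linarith
        linarith
      · have : ∑ i ∈ S, a i < 0 := by
          refine Finset.sum_neg (fun i hi => ?_) hne
          by_contra! hlt
          refine (h i hi).not_ge (abs_le.2 ?_)
          have h1 := abs_le.1 (ha i hi)
          have h2 := abs_le.1 hs
          constructor <;> linarith
        linarith
    obtain ⟨π, h1, h2, h3⟩ := ih (S.erase i₀) (s + a i₀) (by rw [Finset.card_erase_of_mem hi₀, hS]; rfl)
      (fun i hi => ha i (Finset.mem_of_mem_erase hi)) hb (by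
        rw [add_assoc, Finset.add_sum_erase _ _ hi₀, h0])
    refine ⟨fun k => Nat.casesOn k i₀ π, ?_, ?_, ?_⟩
    · rintro (_ | i) hi
      · exact hi₀
      · exact Finset.mem_of_mem_erase (h1 i (by omega))
    · rintro (_ | i) hi (_ | j) hj hij
      · rfl
      · exact absurd hij.symm (Finset.ne_of_mem_erase (h1 j (by simpa using hj)))
      · exact absurd hij (Finset.ne_of_mem_erase (h1 i (by simpa using hi)))
      · have : i = j := h2 (by simpa using hi) (by simpa using hj) hij
        rw [this]
    · rintro (_ | k) hk
      · simpa using hs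
      · rw [Finset.sum_range_succ', add_comm (∑ i ∈ _, _), ← add_assoc]
        exact h3 k (by omega)

end Couple

/-! ### Sorted cells, and sets that meet all of them equally. -/

section Mix

variable {X : Type*} [MeasurableSpace X] {μ : Measure X}

/-- The supremum of `w` on `A` separates the two means. The cross-multiplied form avoids dividing by
a possibly vanishing measure. -/
lemma measure_mul_setIntegral_le [IsFiniteMeasure μ] {w : X → ℝ} {W : ℝ} {A B : Set X}
    (hA : MeasurableSet A) (hB : MeasurableSet B)
    (hwA : IntegrableOn w A μ) (hwB : IntegrableOn w B μ)
    (hAW : ∀ x ∈ A, w x ≤ W)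
    (h : ∀ x ∈ A, ∀ y ∈ B, w x ≤ w y) :
    μ.real B * ∫ x in A, w x ∂μ ≤ μ.real A * ∫ x in B, w x ∂μ := by
  rcases A.eq_empty_or_nonempty with rfl | hne
  · simp
  set τ := sSup (w '' A) with hτ
  have hbdd : BddAbove (w '' A) := ⟨W, by rintro _ ⟨x, hx, rfl⟩; exact hAW x hx⟩
  have h1 : ∫ x in A, w x ∂μ ≤ μ.real A * τ := by
    calc ∫ x in A, w x ∂μ ≤ ∫ x in A, τ ∂μ :=
          setIntegral_mono_on hwA (integrableOn_const (measure_ne_top _ _)) hA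
            fun x hx => le_csSup hbdd (mem_image_of_mem _ hx)
      _ = μ.real A * τ := by simp
  have h2 : μ.real B * τ ≤ ∫ x in B, w x ∂μ := by
    calc μ.real B * τ = ∫ x in B, τ ∂μ := by simp
      _ ≤ _ := setIntegral_mono_on (integrableOn_const (measure_ne_top _ _)) hwB hB
            fun y hy => csSup_le (hne.image _) (by rintro _ ⟨x, hx, rfl⟩; exact h x hx y hy)
  calc μ.real B * ∫ x in A, w x ∂μ ≤ μ.real B * (μ.real A * τ) :=
        mul_le_mul_of_nonneg_left h1 measureReal_nonneg
    _ = μ.real A * (μ.real B * τ) := by ring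
    _ ≤ _ := mul_le_mul_of_nonneg_left h2 measureReal_nonneg

/-- The mean over `J i` is at most the mean over the next cell `c (i + 1)`, so the sum is compared
with the total shifted by one cell. The unmatched first and last cells cost `W * m` each. -/
lemma sum_setIntegral_le_of_sorted [IsFiniteMeasure μ] {w : X → ℝ} (hw : Measurable w) {W : ℝ}
    {m j : ℝ} (n : ℕ) {c J : ℕ → Set X} (hc : ∀ i < n, MeasurableSet (c i))
    (hJ : ∀ i < n, MeasurableSet (J i)) (hJc : ∀ i < n, J i ⊆ c i)
    (hcm : ∀ i < n, μ.real (c i) = m) (hJm : ∀ i < n, μ.real (J i) = j)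
    (hcW : ∀ i < n, ∀ x ∈ c i, |w x| ≤ W)
    (hsort : ∀ i i', i < i' → i' < n → ∀ x ∈ c i, ∀ y ∈ c i', w x ≤ w y) (hW : 0 ≤ W)
    (hm : 0 ≤ m) :
    ∑ i ∈ Finset.range n, ∫ x in J i, w x ∂μ ≤
      |∑ i ∈ Finset.range n, ∫ x in c i, w x ∂μ| + 2 * W * m := by
  rcases n with _ | k
  · simp; positivity
  have hwc : ∀ i < k + 1, IntegrableOn w (c i) μ := fun i hi =>
    Measure.integrableOn_of_bounded (M := W) (measure_ne_top _ _) hw.aestronglyMeasurable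
      ((ae_restrict_mem (hc i hi)).mono fun x hx => hcW i hi x hx)
  have hbound : ∀ i < k + 1, ∀ A ⊆ c i, MeasurableSet A → |∫ x in A, w x ∂μ| ≤ W * μ.real A := by
    intro i hi A hA hAm
    exact norm_setIntegral_le_of_norm_le_const (f := w) (measure_lt_top _ _)
      (fun x hx => hcW i hi x (hA hx))
  have hj0 : 0 ≤ j := by rw [← hJm 0 (by omega)]; exact measureReal_nonneg
  have hjm : j ≤ m := by
    rw [← hJm 0 (by omega), ← hcm 0 (by omega)]
    exact measureReal_mono (hJc 0 (by omega)) (measure_ne_top _ _)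
  rcases hm.eq_or_lt with hm0 | hm0
  · have hj : j = 0 := le_antisymm (hjm.trans hm0.ge) hj0
    have : ∑ i ∈ Finset.range (k + 1), ∫ x in J i, w x ∂μ = 0 := by
      refine Finset.sum_eq_zero fun i hi => ?_
      have hi := Finset.mem_range.1 hi
      have := hbound i hi _ (hJc i hi) (hJ i hi)
      rw [hJm i hi, hj, mul_zero] at this
      exact abs_nonpos_iff.1 this
    rw [this]; positivity
  have h1 : ∀ i ∈ Finset.range k, ∫ x in J i, w x ∂μ ≤ j / m * ∫ x in c (i + 1), w x ∂μ := by
    intro i hi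
    have hi := Finset.mem_range.1 hi
    have := measure_mul_setIntegral_le (hJ i (by omega)) (hc (i + 1) (by omega))
      ((hwc i (by omega)).mono_set (hJc i (by omega))) (hwc (i + 1) (by omega)) (W := W)
      (fun x hx => (abs_le.1 (hcW i (by omega) x (hJc i (by omega) hx))).2)
      (fun x hx y hy => hsort i (i + 1) (by omega) (by omega) x (hJc i (by omega) hx) y hy)
    rw [hcm _ (by omega), hJm _ (by omega)] at this
    rw [div_mul_eq_mul_div, le_div_iff₀ hm0]
    linarith
  have h2 : ∫ x in J k, w x ∂μ ≤ W * j := by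
    have := hbound k (by omega) _ (hJc k (by omega)) (hJ k (by omega))
    rw [hJm k (by omega)] at this
    exact (abs_le.1 this).2
  have h3 : -(W * m) ≤ ∫ x in c 0, w x ∂μ := by
    have := hbound 0 (by omega) _ Subset.rfl (hc 0 (by omega))
    rw [hcm 0 (by omega)] at this
    exact (abs_le.1 this).1
  have hjm1 : j / m ≤ 1 := (div_le_one hm0).2 hjm
  have hjm0 : 0 ≤ j / m := by positivity
  rw [Finset.sum_range_succ]
  have h4 := Finset.sum_le_sum h1
  rw [← Finset.mul_sum] at h4
  set A := ∑ i ∈ Finset.range k, ∫ x in c (i + 1), w x ∂μ with hA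
  have h5 : ∑ i ∈ Finset.range (k + 1), ∫ x in c i, w x ∂μ = A + ∫ x in c 0, w x ∂μ :=
    Finset.sum_range_succ' _ _
  rw [h5]
  have h6 : j / m * A ≤ |A + ∫ x in c 0, w x ∂μ| + W * m := by
    have h7 : A ≤ |A + ∫ x in c 0, w x ∂μ| + W * m := by
      linarith [le_abs_self (A + ∫ x in c 0, w x ∂μ)]
    have h8 : 0 ≤ |A + ∫ x in c 0, w x ∂μ| + W * m := by positivity
    calc j / m * A ≤ j / m * (|A + ∫ x in c 0, w x ∂μ| + W * m) :=
          mul_le_mul_of_nonneg_left h7 hjm0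
      _ ≤ 1 * _ := mul_le_mul_of_nonneg_right hjm1 h8
      _ = _ := one_mul _
  have h9 : W * j ≤ W * m := mul_le_mul_of_nonneg_left hjm hW
  linarith

lemma abs_sum_setIntegral_le_of_sorted [IsFiniteMeasure μ] {w : X → ℝ} (hw : Measurable w) {W : ℝ}
    {m j : ℝ} (n : ℕ) {c J : ℕ → Set X} (hc : ∀ i < n, MeasurableSet (c i))
    (hJ : ∀ i < n, MeasurableSet (J i)) (hJc : ∀ i < n, J i ⊆ c i)
    (hcm : ∀ i < n, μ.real (c i) = m) (hJm : ∀ i < n, μ.real (J i) = j)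
    (hcW : ∀ i < n, ∀ x ∈ c i, |w x| ≤ W)
    (hsort : ∀ i i', i < i' → i' < n → ∀ x ∈ c i, ∀ y ∈ c i', w x ≤ w y) (hW : 0 ≤ W)
    (hm : 0 ≤ m) :
    |∑ i ∈ Finset.range n, ∫ x in J i, w x ∂μ| ≤
      |∑ i ∈ Finset.range n, ∫ x in c i, w x ∂μ| + 2 * W * m := by
  rw [abs_le']
  refine ⟨sum_setIntegral_le_of_sorted hw n hc hJ hJc hcm hJm hcW hsort hW hm, ?_⟩
  -- The lower bound is the upper bound for `-w` with the cells in reversed order.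
  have h := sum_setIntegral_le_of_sorted (μ := μ) (w := fun x => -w x) hw.neg (W := W) (m := m)
    (j := j) n (c := fun i => c (n - 1 - i)) (J := fun i => J (n - 1 - i))
    (fun i hi => hc _ (by omega)) (fun i hi => hJ _ (by omega)) (fun i hi => hJc _ (by omega))
    (fun i hi => hcm _ (by omega)) (fun i hi => hJm _ (by omega))
    (fun i hi x hx => by rw [abs_neg]; exact hcW _ (by omega) x hx)
    (fun i i' h h' x hx y hy => neg_le_neg (hsort _ _ (by omega) (by omega) y hy x hx)) hW hm
  simp only [integral_neg, Finset.sum_neg_distrib, abs_neg] at h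
  rwa [Finset.sum_range_reflect (fun i => ∫ x in J i, w x ∂μ),
    Finset.sum_range_reflect (fun i => ∫ x in c i, w x ∂μ)] at h

lemma sum_setIntegral_inter [IsFiniteMeasure μ] {w : X → ℝ} (n : ℕ) {c : ℕ → Set X} {K : Set X}
    (hc : ∀ i < n, MeasurableSet (c i)) (hK : MeasurableSet K)
    (hd : ∀ i < n, ∀ j < n, i ≠ j → Disjoint (c i) (c j)) (hKc : ∀ x ∈ K, ∃ i < n, x ∈ c i)
    (hw : IntegrableOn w K μ) :
    ∫ x in K, w x ∂μ = ∑ i ∈ Finset.range n, ∫ x in K ∩ c i, w x ∂μ := by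
  rw [← integral_biUnion_finset]
  · congr 2
    ext x
    simp only [mem_iUnion, Finset.mem_range, mem_inter_iff, exists_prop]
    exact ⟨fun hx => (hKc x hx).imp fun i hi => ⟨hi.1, hx, hi.2⟩, fun ⟨i, hi, hx, _⟩ => hx⟩
  · exact fun i hi => hK.inter (hc i (Finset.mem_range.1 hi))
  · intro i hi j hj hij
    exact (hd i (by simpa using hi) j (by simpa using hj) hij).mono inter_subset_right
      inter_subset_right
  · exact fun i hi => hw.mono_set inter_subset_left

/-- Truncation approximates in mean. -/
lemma exists_truncation {w : X → ℝ} (hw : Integrable w μ) {η : ℝ}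
    (hη : 0 < η) : ∃ W : ℝ, 0 ≤ W ∧ ∫ x, |w x - max (-W) (min W (w x))| ∂μ < η := by
  have key : Tendsto (fun n : ℕ => ∫ x, |w x - max (-(n : ℝ)) (min n (w x))| ∂μ) atTop
      (𝓝 (∫ _, (0 : ℝ) ∂μ)) := by
    refine tendsto_integral_of_dominated_convergence (fun x => |w x|) (fun n => ?_) hw.abs ?_ ?_
    · exact (hw.aestronglyMeasurable.sub (aestronglyMeasurable_const.sup
        (aestronglyMeasurable_const.inf hw.aestronglyMeasurable))).norm
    · intro n
      refine Eventually.of_forall fun x => ?_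
      rw [Real.norm_eq_abs, abs_abs]
      have hn : (0 : ℝ) ≤ n := Nat.cast_nonneg n
      rcases le_total (w x) n with h | h
      · rw [min_eq_right h]
        rcases le_total (-(n : ℝ)) (w x) with h' | h'
        · rw [max_eq_right h']; simp
        · rw [max_eq_left h', abs_of_nonpos (by linarith), abs_of_nonpos (by linarith)]; linarith
      · rw [min_eq_left h, max_eq_right (by linarith), abs_of_nonneg (by linarith),
          abs_of_nonneg (by linarith)]; linarith
    · refine Eventually.of_forall fun x => tendsto_const_nhds.congr' ?_
      obtain ⟨N, hN⟩ := exists_nat_ge |w x|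
      filter_upwards [eventually_ge_atTop N] with n hn
      have h1 : |w x| ≤ n := hN.trans (by exact_mod_cast hn)
      rw [abs_le] at h1
      rw [min_eq_right h1.2, max_eq_right h1.1, sub_self, abs_zero]
  rw [integral_zero] at key
  obtain ⟨n, hn⟩ := ((tendsto_order.1 key).2 η hη).exists
  exact ⟨n, Nat.cast_nonneg n, hn⟩

/-- Cells sorted by `w`, each of mass `μ C / n`, such that a set meeting all cells in the same mass
has almost the mean of `C`. -/
lemma exists_mixing_cells [StandardBorelSpace X] [IsProbabilityMeasure μ] [NullSingletonClass μ]
    {C : Set X} (hC : MeasurableSet C) {w : X → ℝ} (hw : Measurable w) (hwi : Integrable w μ)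
    {η : ℝ} (hη : 0 < η) (N : ℕ) :
    ∃ (n : ℕ) (c : ℕ → Set X), N < n ∧ (∀ i, MeasurableSet (c i)) ∧
      Pairwise (Function.onFun Disjoint c) ∧ (∀ i, c i ⊆ C) ∧ (∀ i < n, μ (c i) = μ C / n) ∧
      μ (C \ ⋃ i ∈ Finset.range n, c i) = 0 ∧
      ∀ (K : Set X) (j : ℝ), MeasurableSet K → (∀ x ∈ K, ∃ i < n, x ∈ c i) →
        (∀ i < n, μ.real (K ∩ c i) = j) → |∫ x in K, w x ∂μ| ≤ |∫ x in C, w x ∂μ| + η := by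
  -- The error budget: truncation costs `η / 4` on `K` and on `C`, and the boundary cells cost `2 *
  -- W / n ≤ η / 2` by the choice of `n`.
  obtain ⟨W, hW, hWη⟩ := exists_truncation hwi (show 0 < η / 4 by positivity)
  obtain ⟨n, hn⟩ := exists_nat_gt (max (N : ℝ) (4 * W / η))
  have hnN : N < n := by exact_mod_cast (le_max_left _ _).trans_lt hn
  have hn0 : (0 : ℝ) < n := by exact_mod_cast (Nat.zero_le N).trans_lt hnN
  have hnW : 2 * W / n ≤ η / 2 := by
    have := ((le_max_right _ _).trans_lt hn).le
    rw [div_le_iff₀ hη] at this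
    rw [div_le_iff₀ hn0]; linarith
  have hn0' : (n : ℝ≥0∞) ≠ 0 := by
    simpa using (show n ≠ 0 by omega)
  -- The minimum with `n` stops the growth once all of `C` is used; cell `i` is the difference of
  -- segments `i + 1` and `i`.
  obtain ⟨S, hS0, hSmono, hSC, hSm, hSμ, hSw⟩ := exists_initial_segments μ hC hw
    (M := fun i => (min i n : ℕ) * (μ C / n)) (by simp)
    (fun i j hij => by dsimp only; gcongr)
    (fun i => by
      calc ((min i n : ℕ) : ℝ≥0∞) * (μ C / n) ≤ n * (μ C / n) := by gcongr; exact min_le_right _ _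
        _ = μ C := ENNReal.mul_div_cancel hn0' (by simp))
  let c : ℕ → Set X := fun i => S (i + 1) \ S i
  have hcm : ∀ i, MeasurableSet (c i) := fun i => (hSm _).diff (hSm _)
  have hcd : Pairwise (Function.onFun Disjoint c) := by
    refine (pairwise_disjoint_on c).2 fun i j hij => ?_
    exact Set.disjoint_left.2 fun x hx hx' => hx'.2 (hSmono (Nat.succ_le_of_lt hij) hx.1)
  have hcC : ∀ i, c i ⊆ C := fun i x hx => hSC _ hx.1
  have hcμ : ∀ i < n, μ (c i) = μ C / n := by
    intro i hi
    rw [measure_sdiff (hSmono (Nat.le_succ i)) (hSm _).nullMeasurableSet (measure_ne_top _ _),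
      hSμ, hSμ, min_eq_left (by omega), min_eq_left hi.le]
    push_cast
    rw [add_mul, one_mul]
    exact ENNReal.add_sub_cancel_left (ENNReal.mul_ne_top (by simp)
      (ENNReal.div_ne_top (measure_ne_top _ _) hn0'))
  have hcS : ∀ k, ⋃ i ∈ Finset.range k, c i = S k := by
    intro k
    ext x
    simp only [mem_iUnion, Finset.mem_range, exists_prop]
    constructor
    · rintro ⟨i, hi, hx⟩
      exact hSmono (Nat.succ_le_of_lt hi) hx.1
    · induction k with
      | zero => intro hx; rw [hS0] at hx; exact absurd hx (notMem_empty x)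
      | succ k ih =>
        intro hx
        by_cases hxk : x ∈ S k
        · obtain ⟨i, hi, h⟩ := ih hxk
          exact ⟨i, by omega, h⟩
        · exact ⟨k, by omega, hx, hxk⟩
  have hSn : μ (C \ S n) = 0 := by
    rw [measure_sdiff (hSC n) (hSm n).nullMeasurableSet (measure_ne_top _ _), hSμ, min_self,
      ENNReal.mul_div_cancel hn0' (by simp), tsub_self]
  refine ⟨n, c, hnN, hcm, hcd, hcC, hcμ, by rw [hcS]; exact hSn, ?_⟩
  intro K j hK hKc hKj
  let v : X → ℝ := fun x => max (-W) (min W (w x))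
  have hv : Measurable v := measurable_const.max (measurable_const.min hw)
  have hvW : ∀ x, |v x| ≤ W := fun x => by
    rw [abs_le]
    exact ⟨le_max_left _ _, max_le (by linarith) (min_le_left _ _)⟩
  have hvi : Integrable v μ := Integrable.of_bound hv.aestronglyMeasurable W
    (Eventually.of_forall hvW)
  have hdiff : ∀ A : Set X, MeasurableSet A → |∫ x in A, w x ∂μ - ∫ x in A, v x ∂μ| ≤ η / 4 := by
    intro A hA
    rw [← integral_sub hwi.integrableOn hvi.integrableOn]
    calc |∫ x in A, (w x - v x) ∂μ| ≤ ∫ x in A, |w x - v x| ∂μ := abs_integral_le_integral_abs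
      _ ≤ ∫ x, |w x - v x| ∂μ := setIntegral_le_integral (hwi.sub hvi).abs
          (Eventually.of_forall fun x => abs_nonneg _)
      _ ≤ η / 4 := hWη.le
  have hC' : ∫ x in C, v x ∂μ = ∑ i ∈ Finset.range n, ∫ x in c i, v x ∂μ := by
    have h1 : (C : Set X) =ᵐ[μ] (S n : Set X) := by
      refine (ae_le_set.2 hSn).antisymm (LE.le.eventuallyLE (hSC n))
    rw [setIntegral_congr_set h1, sum_setIntegral_inter n (c := c) (fun i _ => hcm i) (hSm n)
      (fun i _ j _ hij => hcd hij) (fun x hx => by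
        rw [← hcS n] at hx
        simpa using hx) hvi.integrableOn]
    refine Finset.sum_congr rfl fun i hi => ?_
    have : c i ⊆ S n := fun x hx => hSmono (Nat.succ_le_of_lt (Finset.mem_range.1 hi)) hx.1
    rw [inter_eq_right.2 this]
  have hK' := sum_setIntegral_inter n (c := c) (fun i _ => hcm i) hK (fun i _ j _ hij => hcd hij)
    hKc (hvi.integrableOn (s := K))
  have hm1 : (μ C / n).toReal ≤ 1 / n := by
    rw [ENNReal.toReal_div]
    simp only [ENNReal.toReal_natCast]
    gcongr
    exact ENNReal.toReal_le_of_le_ofReal zero_le_one (by simpa using prob_le_one)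
  have hmain := abs_sum_setIntegral_le_of_sorted (μ := μ) hv (W := W) (m := (μ C / n).toReal)
    (j := j) n (c := c) (J := fun i => K ∩ c i) (fun i _ => hcm i) (fun i _ => hK.inter (hcm i))
    (fun i _ => inter_subset_right) (fun i hi => by rw [Measure.real, hcμ i hi]) hKj
    (fun i _ x _ => hvW x) (fun i i' h h' x hx y hy => by
      have := hSw (i + 1) x hx.1 y (hcC _ hy) fun h'' => hy.2 (hSmono (Nat.succ_le_of_lt h) h'')
      exact max_le_max le_rfl (min_le_min le_rfl this)) hW ENNReal.toReal_nonneg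
  rw [← hK', ← hC'] at hmain
  have h1 := abs_le.1 (hdiff K hK)
  have h2 := abs_le.1 (hdiff C hC)
  have h3 : 2 * W * (μ C / n).toReal ≤ η / 2 := by
    calc 2 * W * (μ C / n).toReal ≤ 2 * W * (1 / n) := by gcongr
      _ = 2 * W / n := by ring
      _ ≤ _ := hnW
  have h4 : |∫ x in C, v x ∂μ| ≤ |∫ x in C, w x ∂μ| + η / 4 := by
    rw [abs_le]
    have := abs_le.1 (le_refl |∫ x in C, w x ∂μ|)
    constructor <;> linarith
  have h5 := abs_le.1 (hmain.trans (add_le_add h4 h3))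
  rw [abs_le]
  constructor <;> linarith

/-- Couplings of cells of equal mass such that the partial sums of `u` have small oscillation. -/
lemma exists_stack [StandardBorelSpace X] [IsProbabilityMeasure μ] [NullSingletonClass μ]
    {u : X → ℝ} (hu : Measurable u) {ε : ℝ} (hε : 0 < ε) {n : ℕ} {e : ℕ → Set X}
    (he : ∀ i, MeasurableSet (e i)) (heμ : ∀ i < n, μ (e i) = μ (e 0))
    (heu : ∀ i, ∀ x ∈ e i, |u x| ≤ ε) (k : ℕ) (hk : k + 1 ≤ n) :
    ∃ (φ : ℕ → X ≃ᵐ X) (D : Set X), (∀ l, MeasurePreserving (φ l) μ μ) ∧ (∀ x, φ 0 x = x) ∧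
      D ⊆ e 0 ∧ MeasurableSet D ∧ μ (e 0 \ D) = 0 ∧ (∀ l < k + 1, ∀ x ∈ D, φ l x ∈ e l) ∧
      ∀ l ≤ k + 1, ∀ x ∈ D, ∀ y ∈ D,
        ∑ i ∈ Finset.range l, u (φ i x) - ∑ i ∈ Finset.range l, u (φ i y) ≤ 3 * ε := by
  induction k with
  | zero =>
    refine ⟨fun _ => .refl X, e 0, fun _ => .id μ, fun _ => rfl, Subset.rfl, he 0, by simp, ?_, ?_⟩
    · intro l hl x hx
      obtain rfl : l = 0 := by omega
      exact hx
    · intro l hl x hx y hy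
      rcases l with _ | l
      · simp; linarith
      · obtain rfl : l = 0 := by omega
        simp only [zero_add, Finset.sum_range_one]
        have h1 := abs_le.1 (heu 0 x hx)
        have h2 := abs_le.1 (heu 0 y hy)
        show u x - u y ≤ _
        linarith
  | succ k ih =>
    obtain ⟨φ, D, hφ, h0, hD, hDm, hDμ, hDe, hosc⟩ := ih (by omega)
    have hDe' : μ D = μ (e (k + 1)) := by
      rw [heμ (k + 1) (by omega), ← measure_inter_add_sdiff (e 0) hDm, hDμ, add_zero,
        inter_eq_right.2 hD]
    -- The antitone coupling with `θ = ε` needs a bound of at least `2 * ε + θ = 3 * ε` and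
    -- preserves it, whatever the number of cells.
    obtain ⟨ψ, D', hψ, hD', hD'm, hD'μ, hψe, hψosc⟩ := exists_antitone_coupling μ hDm (he (k + 1))
      hDe' (s := fun x => ∑ i ∈ Finset.range (k + 1), u (φ i x)) (u := u)
      (Finset.measurable_sum _ fun i _ => hu.comp (φ i).measurable) hu hε (heu (k + 1))
      (R := 3 * ε) (by linarith) (hosc (k + 1) le_rfl)
    have hup : ∀ l < k + 1, Function.update φ (k + 1) ψ l = φ l := fun l hl =>
      Function.update_of_ne (by omega) _ _
    have hsum : ∀ l ≤ k + 1, ∀ x, ∑ i ∈ Finset.range l, u (Function.update φ (k + 1) ψ i x) =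
        ∑ i ∈ Finset.range l, u (φ i x) := fun l hl x =>
      Finset.sum_congr rfl fun i hi => by rw [hup i (by have := Finset.mem_range.1 hi; omega)]
    refine ⟨Function.update φ (k + 1) ψ, D', ?_, ?_, hD'.trans hD, hD'm, ?_, ?_, ?_⟩
    · intro l
      by_cases hl : l = k + 1
      · subst hl; rwa [Function.update_self]
      · rw [Function.update_of_ne hl]; exact hφ l
    · intro x; rw [hup 0 (by omega), h0]
    · refine measure_mono_null (fun x hx => ?_) (measure_union_null hDμ hD'μ)
      by_cases hxD : x ∈ D
      · exact Or.inr ⟨hxD, hx.2⟩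
      · exact Or.inl ⟨hx.1, hxD⟩
    · intro l hl x hx
      by_cases hlk : l = k + 1
      · subst hlk; rw [Function.update_self]; exact hψe x hx
      · rw [hup l (by omega)]; exact hDe l (by omega) x (hD' hx)
    · intro l hl x hx y hy
      by_cases hlk : l = k + 1 + 1
      · subst hlk
        rw [Finset.sum_range_succ _ (k + 1), Finset.sum_range_succ _ (k + 1), hsum _ le_rfl, hsum _ le_rfl,
          Function.update_self]
        exact hψosc x hx y hy
      · rw [hsum l (by omega), hsum l (by omega)]
        exact hosc l (by omega) x (hD' hx) y (hD' hy)

end Mix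

/-! ### Mixing clusters with bounded partial sums. -/

section MixStar

variable {X : Type*} [MeasurableSpace X] {μ : Measure X}

/-- Every value of `s` is within `R` of its mean over `D`, and the mean is at most `b` in absolute
value. -/
lemma abs_le_of_oscillation [IsFiniteMeasure μ] {D : Set X} (hD : MeasurableSet D) {s : X → ℝ}
    (hs : IntegrableOn s D μ) (hpos : 0 < μ.real D) {R b : ℝ}
    (hosc : ∀ x ∈ D, ∀ y ∈ D, s x - s y ≤ R) (hintg : |∫ x in D, s x ∂μ| ≤ b * μ.real D)
    {x : X} (hx : x ∈ D) : |s x| ≤ R + b := by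
  have hintg' := abs_le.1 hintg
  have hc : ∀ t : ℝ, ∫ _ in D, t ∂μ = t * μ.real D := fun t => by simp [mul_comm]
  have hci : ∀ t : ℝ, IntegrableOn (fun _ => t) D μ := fun t =>
    integrableOn_const (measure_ne_top _ _)
  have h1 : ∫ _ in D, (s x - R) ∂μ ≤ ∫ y in D, s y ∂μ :=
    setIntegral_mono_on (hci _) hs hD fun y hy => by linarith [hosc x hx y hy]
  have h2 : ∫ y in D, s y ∂μ ≤ ∫ _ in D, (s x + R) ∂μ :=
    setIntegral_mono_on hs (hci _) hD fun y hy => by linarith [hosc y hy x hx]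
  rw [hc] at h1 h2
  rw [abs_le]
  constructor
  · have : (-b) * μ.real D ≤ (s x + R) * μ.real D := by linarith
    linarith [le_of_mul_le_mul_right this hpos]
  · have : (s x - R) * μ.real D ≤ b * μ.real D := by linarith
    linarith [le_of_mul_le_mul_right this hpos]

/-- A partition of `C` into clusters that mixes `w` and keeps the partial sums of `u` bounded. -/
lemma exists_star_mix [StandardBorelSpace X] [IsProbabilityMeasure μ] [NullSingletonClass μ]
    {C : Set X} (hC : MeasurableSet C) {u : X → ℝ} (hu : Measurable u) {ε : ℝ} (hε : 0 < ε)
    (huC : ∀ x ∈ C, |u x| ≤ ε) (hintg : ∫ x in C, u x ∂μ = 0) {w : X → ℝ} (hw : Measurable w)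
    (hwi : Integrable w μ) {η : ℝ} (hη : 0 < η) (N : ℕ) :
    ∃ s : Star μ, s.C ⊆ C ∧ μ (C \ s.C) = 0 ∧ μ (s.D 0) ≤ (N : ℝ≥0∞)⁻¹ ∧
      (∀ x ∈ s.D 0, |s.total u x| ≤ 4 * ε) ∧ (∀ y ∈ s.C, |s.before u y| ≤ 4 * ε) ∧
      ∀ J, MeasurableSet J → |∫ x in s.C ∩ s.root ⁻¹' J, w x ∂μ| ≤ |∫ x in C, w x ∂μ| + η := by
  classical
  rcases eq_or_ne (μ C) 0 with hC0 | hC0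
  -- A null set gets no clusters at all; the averaging below needs cells of positive mass.
  · let s : Star μ :=
      { φ := fun _ => .refl X
        D := fun _ => ∅
        mp := fun _ => .id μ
        zero := fun _ => rfl
        meas := fun _ => .empty
        anti := fun _ => Subset.rfl
        fin := fun x => ⟨0, notMem_empty x⟩
        disj := fun n m x y hx => absurd hx (notMem_empty x) }
    have hsC : s.C = ∅ := by simp [Star.C, s]
    refine ⟨s, by simp [hsC], by simp [hsC, hC0], by simp [s], by simp [s], by simp [hsC], ?_⟩
    intro J hJ
    rw [hsC, empty_inter]; simp; positivity
  obtain ⟨n, c, hNn, hcm, hcd, hcC, hcμ, hcU, hmix⟩ := exists_mixing_cells hC hw hwi hη N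
  have hn0 : (n : ℝ≥0∞) ≠ 0 := by simpa using (show n ≠ 0 by omega)
  set m := (μ C / n).toReal with hm
  have hm0 : 0 < m := ENNReal.toReal_pos (ENNReal.div_ne_zero.2 ⟨hC0, by simp⟩)
    (ENNReal.div_ne_top (measure_ne_top _ _) hn0)
  have hui : IntegrableOn u C μ :=
    Measure.integrableOn_of_bounded (M := ε) (measure_ne_top _ _) hu.aestronglyMeasurable
      ((ae_restrict_mem hC).mono huC)
  have ha : ∀ i ∈ Finset.range n, |∫ x in c i, u x ∂μ| ≤ ε * m := by
    intro i hi
    have := norm_setIntegral_le_of_norm_le_const (f := u) (μ := μ) (s := c i) (C := ε)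
      (measure_lt_top _ _) (fun x hx => huC x (hcC i hx))
    rwa [Measure.real, hcμ i (Finset.mem_range.1 hi)] at this
  have hsum : ∑ i ∈ Finset.range n, ∫ x in c i, u x ∂μ = 0 := by
    have hU : MeasurableSet (⋃ i ∈ Finset.range n, c i) :=
      Finset.measurableSet_biUnion _ fun i _ => hcm i
    have hUC : ⋃ i ∈ Finset.range n, c i ⊆ C := iUnion₂_subset fun i _ => hcC i
    have h1 : (C : Set X) =ᵐ[μ] (⋃ i ∈ Finset.range n, c i : Set X) :=
      (ae_le_set.2 hcU).antisymm (LE.le.eventuallyLE hUC)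
    rw [setIntegral_congr_set h1, sum_setIntegral_inter n (c := c) (fun i _ => hcm i) hU
      (fun i _ j _ hij => hcd hij) (fun x hx => by simpa using hx) (hui.mono_set hUC)] at hintg
    rw [← hintg]
    refine Finset.sum_congr rfl fun i hi => ?_
    have h2 : c i ⊆ ⋃ i ∈ Finset.range n, c i := fun x hx => mem_iUnion₂.2 ⟨i, hi, hx⟩
    rw [inter_eq_right.2 h2]
  -- The cells are sorted by `w`, but the clusters traverse them in an order `π` for which the
  -- partial sums of the integrals of `u` stay within `ε * m`.
  obtain ⟨π, hπn, hπinj, hπsum⟩ := exists_balanced_enumeration (a := fun i => ∫ x in c i, u x ∂μ)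
    (b := ε * m) n (Finset.range n) 0 (by simp) ha (by simpa using by positivity) (by simpa using hsum)
  have hπn' : ∀ i < n, π i < n := fun i hi => Finset.mem_range.1 (hπn i hi)
  have hπsurj : ∀ i < n, ∃ l < n, π l = i := by
    intro i hi
    have h1 : (Finset.range n).image π = Finset.range n := by
      refine Finset.eq_of_subset_of_card_le (fun j hj => ?_) ?_
      · obtain ⟨l, hl, rfl⟩ := Finset.mem_image.1 hj
        exact hπn l (Finset.mem_range.1 hl)
      · rw [Finset.card_image_of_injOn]
        intro a ha b hb
        exact hπinj (by simpa using ha) (by simpa using hb)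
    have h2 : i ∈ (Finset.range n).image π := by rw [h1]; exact Finset.mem_range.2 hi
    obtain ⟨l, hl, h⟩ := Finset.mem_image.1 h2
    exact ⟨l, Finset.mem_range.1 hl, h⟩
  obtain ⟨k, rfl⟩ : ∃ k, n = k + 1 := ⟨n - 1, by omega⟩
  have heμ : ∀ i < k + 1, μ (c (π i)) = μ C / (k + 1 : ℕ) := fun i hi => hcμ _ (hπn' i hi)
  obtain ⟨φ, D, hφ, hφ0, hDe, hDm, hDμ, hφe, hosc⟩ := exists_stack (μ := μ) hu hε
    (n := k + 1) (e := fun i => c (π i)) (fun i => hcm _)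
    (fun i hi => by rw [heμ i hi, heμ 0 (by omega)]) (fun i x hx => huC x (hcC _ hx)) k le_rfl
  have hD : μ D = μ C / (k + 1 : ℕ) := by
    rw [← heμ 0 (by omega), ← measure_inter_add_sdiff (c (π 0)) hDm, hDμ, add_zero,
      inter_eq_right.2 hDe]
  have hDr : μ.real D = m := by rw [Measure.real, hD]
  let s : Star μ :=
    { φ := φ
      D := fun l => if l < k + 1 then D else ∅
      mp := hφ
      zero := hφ0
      meas := fun l => by split_ifs <;> simp [hDm]
      anti := fun l x hx => by
        by_cases h1 : l + 1 < k + 1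
        · rw [if_pos h1] at hx
          rwa [if_pos (by omega)]
        · rw [if_neg h1] at hx
          exact absurd hx (notMem_empty x)
      fin := fun x => ⟨k + 1, by simp⟩
      disj := fun l l' x y hx hy hxy => by
        by_cases h1 : l < k + 1
        · by_cases h2 : l' < k + 1
          · rw [if_pos h1] at hx
            rw [if_pos h2] at hy
            refine hπinj h1 h2 ?_
            by_contra hne
            exact Set.disjoint_left.1 (hcd hne) (hφe l h1 x hx) (hxy ▸ hφe l' h2 y hy)
          · rw [if_neg h2] at hy
            exact absurd hy (notMem_empty y)
        · rw [if_neg h1] at hx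
          exact absurd hx (notMem_empty x) }
  have hsD : ∀ l < k + 1, s.D l = D := fun l hl => if_pos hl
  have hsD' : ∀ l x, x ∈ s.D l → l < k + 1 ∧ x ∈ D := by
    intro l x hx
    by_cases h1 : l < k + 1
    · exact ⟨h1, hsD l h1 ▸ hx⟩
    · have : s.D l = ∅ := if_neg h1
      rw [this] at hx
      exact absurd hx (notMem_empty x)
  have hps : ∀ l ≤ k + 1, ∀ x ∈ D, |s.psum u l x| ≤ 4 * ε := by
    intro l hl x hx
    have hcomp : ∀ i < k + 1, IntegrableOn (fun x => u (φ i x)) D μ := fun i hi =>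
      Measure.integrableOn_of_bounded (M := ε) (measure_ne_top _ _)
        (hu.comp (φ i).measurable).aestronglyMeasurable
        ((ae_restrict_mem hDm).mono fun x hx => huC _ (hcC _ (hφe i hi x hx)))
    have h1 : ∫ x in D, s.psum u l x ∂μ = ∑ i ∈ Finset.range l, ∫ x in c (π i), u x ∂μ := by
      unfold Star.psum
      rw [integral_finsetSum _ fun i hi => hcomp i (by have := Finset.mem_range.1 hi; omega)]
      refine Finset.sum_congr rfl fun i hi => ?_
      have hi : i < k + 1 := by have := Finset.mem_range.1 hi; omega
      exact setIntegral_comp_eq (hφ i) (hφe i hi) hDm (hcm _) (by rw [heμ i hi, hD])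
        (measure_ne_top _ _) u
    have h2 := hπsum l hl
    rw [zero_add, ← h1] at h2
    -- Oscillation `3 * ε` from the couplings plus mean at most `ε` from the enumeration give `4 *
    -- ε`.
    have h3 := abs_le_of_oscillation hDm (s := s.psum u l)
      (integrable_finsetSum _ fun i hi => hcomp i (by have := Finset.mem_range.1 hi; omega))
      (by rw [hDr]; exact hm0) (hosc l hl) (by rwa [hDr]) hx
    linarith
  have hsC : ∀ y ∈ s.C, ∃ l < k + 1, ∃ x ∈ D, φ l x = y := by
    intro y hy
    obtain ⟨l, x, hx, hxy⟩ := s.exists_of_mem_C hy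
    obtain ⟨h1, h2⟩ := hsD' l x hx
    exact ⟨l, h1, x, h2, hxy⟩
  have himm : ∀ l (A : Set X), MeasurableSet A → μ (φ l '' A) = μ A := by
    intro l A hA
    rw [(φ l).image_eq_preimage_symm, (MeasurePreserving.symm (φ l) (hφ l)).measure_preimage
      hA.nullMeasurableSet]
  refine ⟨s, ?_, ?_, ?_, ?_, ?_, ?_⟩
  · intro y hy
    obtain ⟨l, hl, x, hx, rfl⟩ := hsC y hy
    exact hcC _ (hφe l hl x hx)
  · refine measure_mono_null (t := (C \ ⋃ i ∈ Finset.range (k + 1), c i) ∪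
      ⋃ l ∈ Finset.range (k + 1), (c (π l) \ φ l '' D)) (fun y hy => ?_)
      (measure_union_null hcU ((measure_biUnion_null_iff (Finset.countable_toSet _)).2
        fun l hl => ?_))
    · by_cases hyU : y ∈ ⋃ i ∈ Finset.range (k + 1), c i
      · right
        simp only [mem_iUnion, Finset.mem_range, exists_prop] at hyU ⊢
        obtain ⟨i, hi, hyi⟩ := hyU
        obtain ⟨l, hl, rfl⟩ := hπsurj i hi
        refine ⟨l, hl, hyi, ?_⟩
        rintro ⟨x, hx, rfl⟩
        exact hy.2 (s.mem_C (n := l) (by rw [hsD l hl]; exact hx))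
      · exact Or.inl ⟨hy.1, hyU⟩
    · have hl : l < k + 1 := by simpa using hl
      rw [measure_sdiff (by rintro _ ⟨x, hx, rfl⟩; exact hφe l hl x hx)
        ((φ l).measurableSet_image.2 hDm).nullMeasurableSet (measure_ne_top _ _), heμ l hl,
        himm l D hDm, hD, tsub_self]
  · rw [hsD 0 (by omega), hD, div_eq_mul_inv]
    calc μ C * ((k + 1 : ℕ) : ℝ≥0∞)⁻¹ ≤ 1 * ((k + 1 : ℕ) : ℝ≥0∞)⁻¹ := by gcongr; exact prob_le_one
      _ ≤ (N : ℝ≥0∞)⁻¹ := by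
        rw [one_mul]
        exact ENNReal.inv_le_inv.2 (by exact_mod_cast hNn.le)
  · intro x hx
    rw [s.total_of_last u (n := k) (by rwa [hsD k (by omega), ← hsD 0 (by omega)])
      (fun h => by have := (hsD' _ _ h).1; omega)]
    exact hps _ le_rfl x (hsD' _ _ hx).2
  · intro y hy
    obtain ⟨l, x, hx, rfl⟩ := s.exists_of_mem_C hy
    rw [s.before_φ u hx]
    exact hps l (hsD' _ _ hx).1.le x (hsD' _ _ hx).2
  · intro J hJ
    refine hmix _ (μ.real (J ∩ D)) (s.measurableSet_C.inter (s.measurable_root hJ)) ?_ ?_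
    · intro y hy
      obtain ⟨l, hl, x, hx, rfl⟩ := hsC y hy.1
      exact ⟨π l, hπn' l hl, hφe l hl x hx⟩
    · intro i hi
      obtain ⟨l, hl, rfl⟩ := hπsurj i hi
      -- A cluster has exactly one point in each cell, so a union of clusters meets every cell in
      -- the mass of its set of roots.
      have : s.C ∩ s.root ⁻¹' J ∩ c (π l) = φ l '' (J ∩ D) := by
        ext y
        constructor
        · rintro ⟨⟨hy, hyJ⟩, hyc⟩
          obtain ⟨l', x, hx, rfl⟩ := s.exists_of_mem_C hy
          obtain ⟨h1, h2⟩ := hsD' _ _ hx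
          have hll : l' = l := by
            refine hπinj h1 hl ?_
            by_contra hne
            exact Set.disjoint_left.1 (hcd hne) (hφe l' h1 x h2) hyc
          subst hll
          rw [mem_preimage, s.root_φ hx] at hyJ
          exact ⟨x, ⟨hyJ, h2⟩, rfl⟩
        · rintro ⟨x, ⟨hxJ, hxD⟩, rfl⟩
          have hx : x ∈ s.D l := by rw [hsD l hl]; exact hxD
          refine ⟨⟨s.mem_C hx, ?_⟩, hφe l hl x hxD⟩
          show s.root (s.φ l x) ∈ J
          rwa [s.root_φ hx]
      rw [this, Measure.real, himm l _ (hJ.inter hDm), Measure.real]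

end MixStar

/-! ### Columns almost independent of a given set. -/

namespace Columns

variable {X : Type*} [MeasurableSpace X] {μ : Measure X} {f : X → ℝ}

/-- The mass of `S`, collected at the base points of the columns, is absolutely continuous because
`p` pulls null sets back to null sets; `w` is its density. -/
lemma exists_density [IsFiniteMeasure μ] (c : Columns μ f) (S : Set X) :
    ∃ w : X → ℝ, Measurable w ∧ Integrable w μ ∧
      ∀ J, MeasurableSet J → ∫ x in J, w x ∂μ = μ.real (S ∩ c.p ⁻¹' J) := by
  set ν := (μ.restrict S).map c.p with hν
  have hac : ν ≪ μ := by
    refine (Measure.AbsolutelyContinuous.map ?_ c.quasi_p.measurable).trans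
      c.quasi_p.absolutelyContinuous
    exact Measure.restrict_le_self.absolutelyContinuous
  refine ⟨fun x => (ν.rnDeriv μ x).toReal, (Measure.measurable_rnDeriv ν μ).ennreal_toReal,
    Measure.integrable_toReal_rnDeriv, fun J hJ => ?_⟩
  rw [Measure.setIntegral_toReal_rnDeriv hac, Measure.real, Measure.real, hν,
    Measure.map_apply c.quasi_p.measurable hJ,
    Measure.restrict_apply (c.quasi_p.measurable hJ), inter_comm]

/-- Up to `δ`, every union of columns within `W` is independent of `A`. -/
def Mixed (c : Columns μ f) (A W : Set X) (δ : ℝ) : Prop := ∀ J, MeasurableSet J →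
  |μ.real (A ∩ W ∩ c.p ⁻¹' J) - μ.real A * μ.real (W ∩ c.p ⁻¹' J)| ≤ δ

/-- A union of new columns is also a union of old ones, so later concatenations do not spoil the
independence. -/
lemma Mixed.mono {c c' : Columns μ f} {A W W' : Set X} {δ δ' : ℝ} (h : c.Mixed A W δ)
    (hc : c.Ext c' W' δ') : c'.Mixed A W δ := by
  intro J hJ
  have : c'.p ⁻¹' J = c.p ⁻¹' (c'.p ⁻¹' J) := by
    ext x; simp only [mem_preimage, hc.p_comp]
  rw [this]
  exact h _ (c'.quasi_p.measurable hJ)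

/-- Columns can be concatenated so that they become almost independent of a given set. -/
lemma exists_ext_mix [StandardBorelSpace X] [IsProbabilityMeasure μ] [NullSingletonClass μ]
    (c : Columns μ f) {W : Set X} (hW : MeasurableSet W) (hsat : c.Sat W)
    (hfi : IntegrableOn f W μ) (hintg : ∫ x in W, f x ∂μ = 0) {ε : ℝ} (hε : 0 < ε)
    (hu : ∀ᵐ x ∂μ, x ∈ c.B ∩ W → |c.u x| ≤ ε) (A : Set X) {η : ℝ}
    (hη : 0 < η) (N : ℕ) :
    ∃ c', c.Ext c' W (4 * ε) ∧ (∀ᵐ x ∂μ, x ∈ c'.B ∩ W → |c'.u x| ≤ 4 * ε) ∧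
      μ (c'.B ∩ W) ≤ (N : ℝ≥0∞)⁻¹ ∧
      c'.Mixed A W (|μ.real (A ∩ W) - μ.real A * μ.real W| + η) := by
  obtain ⟨w₁, hw₁, hw₁i, hw₁J⟩ := c.exists_density (A ∩ W)
  obtain ⟨w₂, hw₂, hw₂i, hw₂J⟩ := c.exists_density W
  -- Over a base point `w` measures by how much its column exceeds its due share of `A`. Its
  -- integral over `J` is the deviation from independence of the union of columns over `J`.
  set w : X → ℝ := fun x => w₁ x - μ.real A * w₂ x with hw
  have hwm : Measurable w := hw₁.sub (hw₂.const_mul _)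
  have hwi : Integrable w μ := hw₁i.sub (hw₂i.const_mul _)
  have hwJ : ∀ J, MeasurableSet J → ∫ x in J, w x ∂μ =
      μ.real (A ∩ W ∩ c.p ⁻¹' J) - μ.real A * μ.real (W ∩ c.p ⁻¹' J) := by
    intro J hJ
    rw [integral_sub hw₁i.integrableOn (hw₂i.const_mul _).integrableOn, integral_const_mul,
      hw₁J J hJ, hw₂J J hJ]
  have hpBW : ∀ x ∈ W, c.p x ∈ c.B ∩ W := fun x hx => ⟨c.p_mem x, (hsat x).1 hx⟩
  -- All mass is collected on `c.B ∩ W`, so `w` may be integrated there only.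
  have hwBW : ∀ J, MeasurableSet J → ∫ x in J, w x ∂μ = ∫ x in J ∩ (c.B ∩ W), w x ∂μ := by
    intro J hJ
    have h1 : ∀ x ∈ W, (x ∈ c.p ⁻¹' J ↔ x ∈ c.p ⁻¹' (J ∩ (c.B ∩ W))) := fun x hx => by
      simp only [mem_preimage, mem_inter_iff]
      exact ⟨fun h => ⟨h, hpBW x hx⟩, fun h => h.1⟩
    rw [hwJ J hJ, hwJ _ (hJ.inter (c.meas_B.inter hW))]
    have h2 : ∀ V ⊆ W, V ∩ c.p ⁻¹' J = V ∩ c.p ⁻¹' (J ∩ (c.B ∩ W)) := fun V hV => by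
      ext x
      exact and_congr_right fun h => h1 x (hV h)
    rw [h2 (A ∩ W) inter_subset_right, h2 W Subset.rfl]
  set C := c.B ∩ W ∩ {x | |c.u x| ≤ ε} with hC
  have hCm : MeasurableSet C := (c.meas_B.inter hW).inter
    (measurableSet_le c.meas_u.abs measurable_const)
  have hCeq : (C : Set X) =ᵐ[μ] (c.B ∩ W : Set X) := by
    refine eventuallyEq_set.2 ?_
    filter_upwards [hu] with x hx using ⟨fun h => h.1, fun h => ⟨h, hx h⟩⟩
  have hzero := (c.integral_u hW hsat hfi (c.integrableOn_u hu hW)).trans hintg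
  obtain ⟨s, h1, h2, h3, h4, h5, h6⟩ := exists_star_mix hCm c.meas_u hε (fun x hx => hx.2)
    (by rw [setIntegral_congr_set hCeq, hzero]) hwm hwi hη N
  have hs : s.C ⊆ c.B := fun x hx => (h1 hx).1.1
  have hsCeq : (s.C : Set X) =ᵐ[μ] (c.B ∩ W : Set X) :=
    (LE.le.eventuallyLE h1).antisymm (ae_le_set.2 h2) |>.trans hCeq
  have hnull : μ ((c.B ∩ W) \ s.C) = 0 := ae_le_set.1 hsCeq.symm.le
  refine ⟨c.step s hs, c.ext_step s hs (fun x hx => (h1 hx).1.2) hsat (by linarith) h5, ?_, ?_, ?_⟩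
  · refine c.step_u_bound s hs h4 ?_
    filter_upwards [measure_eq_zero_iff_ae_notMem.1 hnull] with x hx hxB hxs
    exact absurd ⟨hxB, hxs⟩ hx
  · calc μ ((c.step s hs).B ∩ W) ≤ μ (((c.B ∩ W) \ s.C) ∪ s.D 0) := by
          refine measure_mono ?_
          rintro x ⟨hx | hx, hxW⟩
          · exact Or.inl ⟨⟨hx.1, hxW⟩, hx.2⟩
          · exact Or.inr hx
      _ ≤ μ ((c.B ∩ W) \ s.C) + μ (s.D 0) := measure_union_le _ _
      _ ≤ _ := by rw [hnull, zero_add]; exact h3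
  · intro J hJ
    have h7 := h6 J hJ
    have h8 : (s.C ∩ s.root ⁻¹' J : Set X) =ᵐ[μ] (s.root ⁻¹' J ∩ (c.B ∩ W) : Set X) := by
      rw [inter_comm]
      exact (ae_eq_refl _).inter hsCeq
    rw [setIntegral_congr_set h8, ← hwBW _ (s.measurable_root hJ), hwJ _ (s.measurable_root hJ),
      setIntegral_congr_set hCeq] at h7
    have h9 := hwBW univ .univ
    rw [univ_inter, hwJ univ .univ, preimage_univ, inter_univ, inter_univ] at h9
    rw [← h9] at h7
    exact h7

end Columns

/-! ### The induction step of the construction. -/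

namespace Columns

variable {X : Type*} [MeasurableSpace X] {μ : Measure X} {f : X → ℝ}

lemma Ext.p_off {c c' : Columns μ f} {W : Set X} {δ : ℝ} (h : c.Ext c' W δ) {x : X} (hx : x ∉ W) :
    c'.p x = c.p x := by
  have h1 : c.p x ∉ W := fun h1 => hx ((h.sat x).2 (by rw [← h.p_comp]; exact (h.sat _).1 h1))
  rw [← h.p_comp, c'.p_base _ (h.off_B _ h1 (c.p_mem x))]

lemma Ext.sat_of_subset {c c' : Columns μ f} {W V : Set X} {δ : ℝ} (h : c.Ext c' W δ)
    (hV : c.Sat V) (hWV : W ⊆ V) : c'.Sat V := by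
  intro x
  by_cases hx : x ∈ W
  · exact ⟨fun _ => hWV ((h.sat x).1 hx), fun _ => hWV hx⟩
  · rw [h.p_off hx]; exact hV x

/-- The columns within `Y` have sums at most `ε`, the points outside of `Y` are columns of height
one. -/
structure Stage (c : Columns μ f) (Y : Set X) (ε : ℝ) : Prop where
  sat : c.Sat Y
  off_B : ∀ x ∉ Y, x ∈ c.B
  off_u : ∀ x ∉ Y, c.u x = f x
  small : ∀ᵐ x ∂μ, x ∈ c.B ∩ Y → |c.u x| ≤ ε

lemma Stage.sat_of_subset {c : Columns μ f} {Y V : Set X} {ε : ℝ} (h : c.Stage Y ε) (hYV : Y ⊆ V) :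
    c.Sat V := by
  intro x
  by_cases hx : x ∈ Y
  · exact ⟨fun _ => hYV ((h.sat x).1 hx), fun _ => hYV hx⟩
  · rw [c.p_base x (h.off_B x hx)]

lemma Stage.sat_sdiff {c : Columns μ f} {Y : Set X} (V : Set X) {ε : ℝ} (h : c.Stage Y ε) :
    c.Sat (V \ Y) := by
  intro x
  by_cases hx : x ∈ Y
  · exact ⟨fun h' => absurd hx h'.2, fun h' => absurd ((h.sat x).1 hx) h'.2⟩
  · rw [c.p_base x (h.off_B x hx)]

/-- Three moves. First the sums on the new part `Y' \ Y` are halved until they are at most `ε`; this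
may change `g` a lot, but only off `Y`. Then `Y'` is mixed, which costs `4 * ε` and leaves sums up
to `4 * ε`. Finally three halvings bring them to `ε / 2` at a cost of `16 * ε`. On `Y` the total
change is `20 * ε`. -/
lemma Stage.exists_next [StandardBorelSpace X] [IsProbabilityMeasure μ] [NullSingletonClass μ]
    (hf : Measurable f) {c : Columns μ f} {Y Y' : Set X} {ε : ℝ} (hε : 0 < ε) (h : c.Stage Y ε)
    (hY : MeasurableSet Y) (hY' : MeasurableSet Y') (hYY' : Y ⊆ Y')
    {M : ℝ} (hfM : ∀ x ∈ Y', |f x| ≤ M) (hintg : ∫ x in Y, f x ∂μ = 0)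
    (hintg' : ∫ x in Y', f x ∂μ = 0) (A : Set X) {η : ℝ} (hη : 0 < η) (N : ℕ) :
    ∃ c' : Columns μ f, c'.Stage Y' (ε / 2) ∧ c'.B ⊆ c.B ∧
      (∀ x, c.Θ x ∉ c.B → c'.Θ x = c.Θ x) ∧ (∀ x ∈ Y, |c'.g x - c.g x| ≤ 20 * ε) ∧
      μ (c'.B ∩ Y') ≤ (N : ℝ≥0∞)⁻¹ ∧
      c'.Mixed A Y' (|μ.real (A ∩ Y') - μ.real A * μ.real Y'| + η) := by
  have hfi' : IntegrableOn f Y' μ :=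
    Measure.integrableOn_of_bounded (M := M) (measure_ne_top _ _) hf.aestronglyMeasurable
      ((ae_restrict_mem hY').mono hfM)
  have hW : MeasurableSet (Y' \ Y) := hY'.diff hY
  have hintW : ∫ x in Y' \ Y, f x ∂μ = 0 := by
    rw [setIntegral_sdiff hY hfi' hYY', hintg, hintg', sub_zero]
  obtain ⟨n, hn⟩ := pow_unbounded_of_one_lt (M / ε) (one_lt_two)
  have hMn : M ≤ ε * 2 ^ n := by
    rw [div_lt_iff₀ hε] at hn; linarith
  obtain ⟨c₁, e₁, b₁⟩ := c.exists_ext_small hW (h.sat_sdiff Y') (hfi'.mono_set sdiff_subset) hintW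
    (ε := ε * 2 ^ n) (by positivity) (Eventually.of_forall fun x hx => by
      rw [h.off_u x hx.2.2]; exact (hfM x hx.2.1).trans hMn) n
  rw [mul_div_assoc, div_self (by positivity), mul_one] at b₁
  have hu₁ : ∀ᵐ x ∂μ, x ∈ c₁.B ∩ Y' → |c₁.u x| ≤ ε := by
    filter_upwards [b₁, h.small] with x hx hx' hxB
    by_cases hxY : x ∈ Y
    · rw [e₁.off_u x fun h' => h'.2 hxY]
      exact hx' ⟨e₁.B_sub hxB.1, hxY⟩
    · exact hx ⟨hxB.1, hxB.2, hxY⟩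
  have hsat₁ : c₁.Sat Y' := e₁.sat_of_subset (h.sat_of_subset hYY') sdiff_subset
  obtain ⟨c₂, e₂, b₂, hB₂, hm₂⟩ := c₁.exists_ext_mix hY' hsat₁ hfi' hintg' hε hu₁ A hη N
  obtain ⟨c₃, e₃, b₃⟩ := c₂.exists_ext_small hY' e₂.sat hfi' hintg' (ε := 4 * ε) (by positivity) b₂ 3
  have e₂₃ := e₂.trans e₃
  refine ⟨c₃, ⟨e₃.sat, ?_, ?_, ?_⟩, e₂₃.B_sub.trans e₁.B_sub, ?_, ?_, ?_, hm₂.mono e₃⟩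
  · intro x hx
    exact e₂₃.off_B x hx (e₁.off_B x (fun h' => hx h'.1) (h.off_B x fun h' => hx (hYY' h')))
  · intro x hx
    rw [e₂₃.off_u x hx, e₁.off_u x fun h' => hx h'.1, h.off_u x fun h' => hx (hYY' h')]
  · filter_upwards [b₃] with x hx hxB
    have := hx hxB
    norm_num at this
    linarith
  · intro x hx
    have h1 := e₁.Θ_eq x hx
    rw [← h1]
    exact e₂₃.Θ_eq x (h1 ▸ fun h2 => hx (e₁.B_sub h2))
  · intro x hx
    rw [← e₁.off_g x fun h' => h'.2 hx]
    exact (e₂₃.close x).trans (by linarith)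
  · exact (measure_mono (inter_subset_inter_left _ e₃.B_sub)).trans hB₂

end Columns

/-! ### Invariant sets, and a recurrent generating system. -/

section Limit

variable {X : Type*} [MeasurableSpace X] {μ : Measure X}

lemma exists_invariant_null_superset (Θ : X ≃ᵐ X) (hΘ : MeasurePreserving Θ μ μ) {N : Set X}
    (hN : μ N = 0) : ∃ Z, N ⊆ Z ∧ MeasurableSet Z ∧ μ Z = 0 ∧ ∀ x, x ∈ Z ↔ Θ x ∈ Z := by
  set S := toMeasurable μ N
  have hS : MeasurableSet S := measurableSet_toMeasurable _ _
  have hS0 : μ S = 0 := by rw [measure_toMeasurable, hN]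
  have hΘ' : MeasurePreserving Θ.symm μ μ := hΘ.symm
  refine ⟨(⋃ n, Θ^[n] ⁻¹' S) ∪ ⋃ n, Θ.symm^[n] ⁻¹' S, ?_, ?_, ?_, ?_⟩
  · exact fun x hx => Or.inl (mem_iUnion.2 ⟨0, subset_toMeasurable μ N hx⟩)
  · exact (MeasurableSet.iUnion fun n => (Θ.measurable.iterate n) hS).union
      (MeasurableSet.iUnion fun n => (Θ.symm.measurable.iterate n) hS)
  · refine measure_union_null (measure_iUnion_null fun n => ?_) (measure_iUnion_null fun n => ?_)
    · rw [(hΘ.iterate n).measure_preimage hS.nullMeasurableSet, hS0]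
    · rw [(hΘ'.iterate n).measure_preimage hS.nullMeasurableSet, hS0]
  · intro x
    simp only [mem_union, mem_iUnion, mem_preimage]
    constructor
    · rintro (⟨_ | n, h⟩ | ⟨n, h⟩)
      · exact Or.inr ⟨1, by simpa using h⟩
      · exact Or.inl ⟨n, by simpa using h⟩
      · exact Or.inr ⟨n + 1, by simpa using h⟩
    · rintro (⟨n, h⟩ | ⟨_ | n, h⟩)
      · exact Or.inl ⟨n + 1, by simpa using h⟩
      · exact Or.inl ⟨1, by simpa using h⟩
      · exact Or.inr ⟨n, by simpa using h⟩

/-- A set that is invariant under a transformation extending the columns is a union of columns. -/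
lemma Columns.exists_preimage_ae_eq {f : X → ℝ} (c : Columns μ f) {T : X → X}
    (hT : ∀ᵐ x ∂μ, c.Θ x ∉ c.B → T x = c.Θ x) {I : Set X} (hI : MeasurableSet I)
    (hTI : T ⁻¹' I = I) : ∃ J, MeasurableSet J ∧ c.p ⁻¹' J =ᵐ[μ] I := by
  -- `link` needs a pointwise hypothesis. Adding to `I` an invariant null set that contains the
  -- exceptional points provides it.
  obtain ⟨Z, hNZ, hZ, hZ0, hinv⟩ := exists_invariant_null_superset c.Θ c.mp (ae_iff.1 hT)
  refine ⟨I ∪ Z, hI.union hZ, ?_⟩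
  have hlink := c.link (fun x => x ∈ I ∪ Z) (fun x hx => by
    by_cases hxZ : x ∈ Z
    · exact ⟨fun _ => Or.inr ((hinv x).1 hxZ), fun _ => Or.inr hxZ⟩
    · have hxZ' : c.Θ x ∉ Z := fun h => hxZ ((hinv x).2 h)
      have h1 : T x = c.Θ x := by
        by_contra hne
        exact hxZ (hNZ fun h => hne (h hx))
      have h2 : x ∈ I ↔ c.Θ x ∈ I := by
        rw [← h1]; conv_lhs => rw [← hTI]
        rfl
      simp only [mem_union, hxZ, hxZ', or_false, h2])
  refine eventuallyEq_set.2 ?_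
  filter_upwards [measure_eq_zero_iff_ae_notMem.1 hZ0] with x hx
  rw [mem_preimage, ← hlink x]
  simp [hx]

/-- On a probability space the inequality for the complement is the reverse inequality. -/
lemma measurePreserving_of_le [IsProbabilityMeasure μ] {T : X → X} (hT : Measurable T)
    (h : ∀ A, MeasurableSet A → μ (T ⁻¹' A) ≤ μ A) : MeasurePreserving T μ μ := by
  refine ⟨hT, Measure.ext fun A hA => ?_⟩
  rw [Measure.map_apply hT hA]
  refine le_antisymm (h A hA) ?_
  have h1 := h Aᶜ hA.compl
  rw [preimage_compl, prob_compl_eq_one_sub (hT hA), prob_compl_eq_one_sub hA] at h1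
  exact (ENNReal.sub_le_sub_iff_left prob_le_one ENNReal.one_ne_top).1 h1

/-- A countable generating π-system in which each member occurs infinitely often. -/
lemma exists_piSystem_enumeration (X : Type*) [MeasurableSpace X] [StandardBorelSpace X] :
    ∃ A : ℕ → Set X, (∀ k, MeasurableSet (A k)) ∧ IsPiSystem (range A) ∧
      ‹MeasurableSpace X› = MeasurableSpace.generateFrom (range A) ∧
      ∀ k, ∃ᶠ n in atTop, A n = A k := by
  obtain ⟨e, he⟩ := exists_measurableEmbedding_real X
  -- The first component of the decoded pair selects a rational half-line; the idle second component
  -- makes each set recur.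
  let A : ℕ → Set X := fun k => e ⁻¹' Iic (((Denumerable.eqv ℚ).symm k.unpair.1 : ℚ) : ℝ)
  have hr : range A = (fun s => e ⁻¹' s) '' (⋃ a : ℚ, {Iic (a : ℝ)}) := by
    ext s
    simp only [mem_range, mem_image, mem_iUnion, mem_singleton_iff, A]
    constructor
    · rintro ⟨k, rfl⟩
      exact ⟨_, ⟨_, rfl⟩, rfl⟩
    · rintro ⟨_, ⟨a, rfl⟩, rfl⟩
      exact ⟨Nat.pair ((Denumerable.eqv ℚ) a) 0, by simp⟩
  refine ⟨A, fun k => he.measurable measurableSet_Iic, ?_, ?_, ?_⟩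
  · rw [hr]
    have := Real.isPiSystem_Iic_rat.comap e
    rintro _ ⟨s, hs, rfl⟩ _ ⟨t, ht, rfl⟩ hne
    have := this _ ⟨s, hs, rfl⟩ _ ⟨t, ht, rfl⟩ hne
    obtain ⟨r, hr, hr'⟩ := this
    exact ⟨r, hr, hr'⟩
  · rw [hr, ← MeasurableSpace.comap_generateFrom, ← Real.borel_eq_generateFrom_Iic_rat,
      ← BorelSpace.measurable_eq (α := ℝ)]
    exact he.comap_eq.symm
  · intro k
    refine frequently_atTop.2 fun n => ⟨Nat.pair k.unpair.1 n, Nat.right_le_pair _ _, ?_⟩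
    simp [A]

end Limit

/-! ### The limit transformation, its ergodicity and its transfer function. -/

section Construction

variable {X : Type*} [MeasurableSpace X] {μ : Measure X}

/-- An increasing sequence of partial transformations that are eventually defined almost everywhere
has a limit. -/
lemma exists_limit_transformation [StandardBorelSpace X] [IsProbabilityMeasure μ]
    [NullSingletonClass μ] {Θ : ℕ → X ≃ᵐ X} (hΘ : ∀ k, MeasurePreserving (Θ k) μ μ)
    {B : ℕ → Set X} (hB : ∀ k, MeasurableSet (B k)) (hBs : ∀ k, B (k + 1) ⊆ B k)
    (hΘs : ∀ k x, Θ k x ∉ B k → Θ (k + 1) x = Θ k x)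
    (hB0 : Tendsto (fun k => μ (B k)) atTop (𝓝 0)) :
    ∃ T : X ≃ᵐ X, MeasurePreserving T μ μ ∧ (∀ k, ∀ᵐ x ∂μ, Θ k x ∉ B k → T x = Θ k x) ∧
      ∀ᵐ x ∂μ, ∃ k, Θ k x ∉ B k := by
  classical
  have hstab : ∀ k x, Θ k x ∉ B k → ∀ j ≥ k, Θ j x = Θ k x ∧ Θ j x ∉ B j := by
    intro k x hx j hj
    induction j, hj using Nat.le_induction with
    | base => exact ⟨rfl, hx⟩
    | succ j hj ih =>
      have h1 := hΘs j x ih.2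
      exact ⟨h1.trans ih.1, h1 ▸ fun h => ih.2 (hBs j h)⟩
  have hμB : ∀ k, μ (Θ k ⁻¹' B k) = μ (B k) := fun k =>
    (hΘ k).measure_preimage (hB k).nullMeasurableSet
  set X₀ : Set X := ⋃ k, (Θ k ⁻¹' B k)ᶜ with hX₀
  have hX₀m : MeasurableSet X₀ := .iUnion fun k => ((Θ k).measurable (hB k)).compl
  have hX₀0 : μ X₀ᶜ = 0 := by
    have h1 : ∀ k, μ X₀ᶜ ≤ μ (B k) := fun k => by
      rw [← hμB]
      refine measure_mono fun x hx => ?_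
      by_contra h
      exact hx (mem_iUnion.2 ⟨k, h⟩)
    exact le_antisymm (ge_of_tendsto' hB0 h1) bot_le
  have hex : ∀ x, ∃ k, Θ k x ∉ B k ∨ x ∉ X₀ := by
    intro x
    by_cases hx : x ∈ X₀
    · obtain ⟨k, hk⟩ := mem_iUnion.1 hx
      exact ⟨k, Or.inl hk⟩
    · exact ⟨0, Or.inr hx⟩
  let F : X → X := fun x => Θ (Nat.find (hex x)) x
  have hF : Measurable F := by
    refine Star.measurable_of_idx (F := fun n x => Θ n x) (measurable_find _ fun k => ?_)
      fun n => (Θ n).measurable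
    exact ((Θ k).measurable (hB k)).compl.union hX₀m.compl
  have hFΘ : ∀ k x, Θ k x ∉ B k → F x = Θ k x := by
    intro k x hx
    have hx₀ : x ∈ X₀ := mem_iUnion.2 ⟨k, hx⟩
    have h1 := (Nat.find_spec (hex x)).resolve_right (not_not.2 hx₀)
    exact ((hstab _ x h1 _ (Nat.find_le (Or.inl hx))).1).symm
  have hinj : InjOn F X₀ := by
    intro x hx y hy hxy
    obtain ⟨k, hk⟩ := mem_iUnion.1 hx
    obtain ⟨j, hj⟩ := mem_iUnion.1 hy
    have h1 := hstab k x hk _ (le_max_left k j)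
    have h2 := hstab j y hj _ (le_max_right k j)
    rw [hFΘ _ _ h1.2, hFΘ _ _ h2.2] at hxy
    exact (Θ _).injective hxy
  obtain ⟨T, hT⟩ := exists_measurableEquiv_ae_eq hF hX₀m hX₀0 hinj
  refine ⟨T, measurePreserving_of_le T.measurable fun A hA => ?_, fun k => ?_, ?_⟩
  -- The limit agrees with `Θ k` off a set of measure `μ (B k)`, and these measures tend to zero.
  · have h1 : ∀ k, μ (T ⁻¹' A) ≤ μ A + μ (B k) := by
      intro k
      have h2 : (T ⁻¹' A : Set X) =ᵐ[μ] (F ⁻¹' A : Set X) := by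
        refine eventuallyEq_set.2 ?_
        filter_upwards [hT] with x hx
        rw [mem_preimage, mem_preimage, hx]
      rw [measure_congr h2]
      calc μ (F ⁻¹' A) ≤ μ (Θ k ⁻¹' A ∪ Θ k ⁻¹' B k) := by
            refine measure_mono fun x hx => ?_
            by_cases h : Θ k x ∈ B k
            · exact Or.inr h
            · exact Or.inl (by rw [mem_preimage, ← hFΘ k x h]; exact hx)
        _ ≤ μ (Θ k ⁻¹' A) + μ (Θ k ⁻¹' B k) := measure_union_le _ _
        _ = _ := by rw [hμB, (hΘ k).measure_preimage hA.nullMeasurableSet]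
    have h3 : Tendsto (fun k => μ A + μ (B k)) atTop (𝓝 (μ A + 0)) := tendsto_const_nhds.add hB0
    rw [add_zero] at h3
    exact ge_of_tendsto' h3 h1
  · filter_upwards [hT] with x hx hxk
    rw [hx, hFΘ k x hxk]
  · filter_upwards [measure_eq_zero_iff_ae_notMem.1 hX₀0] with x hx
    simpa [X₀] using hx

/-- An invariant set `I` is, at every stage, almost everywhere a union of columns, hence almost
independent of `A k`. As each set recurs infinitely often with errors tending to zero and the `Y k`
fill the space, `I` is independent of the generating system and so of its own complement: `μ I * μ
Iᶜ = 0`. -/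
lemma preErgodic_of_mixed [StandardBorelSpace X] [IsProbabilityMeasure μ] {f : X → ℝ}
    {T : X → X} {c : ℕ → Columns μ f}
    (hT : ∀ k, ∀ᵐ x ∂μ, (c k).Θ x ∉ (c k).B → T x = (c k).Θ x) {A : ℕ → Set X}
    (hA : ∀ k, MeasurableSet (A k)) (hpi : IsPiSystem (range A))
    (hgen : ‹MeasurableSpace X› = MeasurableSpace.generateFrom (range A))
    (hfreq : ∀ k, ∃ᶠ n in atTop, A n = A k) {Y : ℕ → Set X} (hY : ∀ k, MeasurableSet (Y k))
    (hY0 : Tendsto (fun k => μ (Y k)ᶜ) atTop (𝓝 0)) {η : ℕ → ℝ} (hη : Tendsto η atTop (𝓝 0))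
    (hmix : ∀ k, (c k).Mixed (A k) (Y k)
      (|μ.real (A k ∩ Y k) - μ.real (A k) * μ.real (Y k)| + η k)) :
    PreErgodic T μ := by
  refine ⟨fun {I} hI hTI => ?_⟩
  have hlim : ∀ S, MeasurableSet S → Tendsto (fun k => μ.real (S ∩ Y k)) atTop (𝓝 (μ.real S)) := by
    intro S hS
    have h1 : Tendsto (fun k => μ.real (Y k)ᶜ) atTop (𝓝 0) := by
      exact (ENNReal.tendsto_toReal ENNReal.zero_ne_top).comp hY0
    have h2 : ∀ k, |μ.real (S ∩ Y k) - μ.real S| ≤ μ.real (Y k)ᶜ := by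
      intro k
      have h3 := measureReal_inter_add_sdiff (μ := μ) (s := S) (hY k)
      have h4 : μ.real (S \ Y k) ≤ μ.real (Y k)ᶜ := measureReal_mono (fun x hx => hx.2)
      have h5 : 0 ≤ μ.real (S \ Y k) := measureReal_nonneg
      rw [abs_le]; constructor <;> linarith
    rw [tendsto_iff_dist_tendsto_zero]
    exact squeeze_zero (fun _ => dist_nonneg) h2 h1
  have hindep : ∀ k, μ.real (A k ∩ I) = μ.real (A k) * μ.real I := by
    intro k
    have hb : ∀ n, A n = A k → |μ.real (A k ∩ I ∩ Y n) - μ.real (A k) * μ.real (I ∩ Y n)| ≤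
        |μ.real (A k ∩ Y n) - μ.real (A k) * μ.real (Y n)| + η n := by
      intro n hn
      obtain ⟨J, hJ, hJI⟩ := (c n).exists_preimage_ae_eq (hT n) hI hTI
      have h1 := hmix n J hJ
      have h2 : ∀ S : Set X, μ.real (S ∩ (c n).p ⁻¹' J) = μ.real (I ∩ S) := fun S => by
        rw [inter_comm I]
        exact measureReal_congr ((ae_eq_refl S).inter hJI)
      rw [h2, h2, hn] at h1
      rwa [show A k ∩ I ∩ Y n = I ∩ (A k ∩ Y n) by
        rw [inter_comm (A k), inter_assoc]]
    have hL : Tendsto (fun n => |μ.real (A k ∩ I ∩ Y n) - μ.real (A k) * μ.real (I ∩ Y n)|) atTop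
        (𝓝 |μ.real (A k ∩ I) - μ.real (A k) * μ.real I|) :=
      ((hlim _ ((hA k).inter hI)).sub ((hlim _ hI).const_mul _)).abs
    have hY1 : Tendsto (fun n => μ.real (Y n)) atTop (𝓝 1) := by
      have := hlim univ .univ
      simpa using this
    have hR : Tendsto (fun n => |μ.real (A k ∩ Y n) - μ.real (A k) * μ.real (Y n)| + η n) atTop
        (𝓝 0) := by
      have := (((hlim _ (hA k)).sub (hY1.const_mul (μ.real (A k)))).abs).add hη
      simpa using this
    have hle := ge_of_tendsto_of_frequently (hR.sub hL)
      ((hfreq k).mono fun n hn => sub_nonneg.2 (hb n hn))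
    have := abs_nonpos_iff.1 (by linarith : |μ.real (A k ∩ I) - μ.real (A k) * μ.real I| ≤ 0)
    linarith
  have hmeas : μ.restrict I = μ I • μ := by
    refine ext_of_generate_finite (range A) hgen hpi ?_ ?_
    · rintro _ ⟨k, rfl⟩
      rw [Measure.restrict_apply (hA k), Measure.smul_apply, smul_eq_mul]
      have := hindep k
      rw [Measure.real, Measure.real, Measure.real, ← ENNReal.toReal_mul] at this
      rw [(ENNReal.toReal_eq_toReal_iff' (measure_ne_top _ _)
        (ENNReal.mul_ne_top (measure_ne_top _ _) (measure_ne_top _ _))).1 this, mul_comm]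
    · simp
  have h1 : μ I * μ Iᶜ = 0 := by
    have := congrArg (fun ν : Measure X => ν Iᶜ) hmeas
    simpa [Measure.restrict_apply hI.compl] using this.symm
  rw [eventuallyConst_set]
  rcases mul_eq_zero.1 h1 with h | h
  · right
    exact measure_eq_zero_iff_ae_notMem.1 h
  · left
    have := measure_eq_zero_iff_ae_notMem.1 h
    filter_upwards [this] with x hx
    simpa using hx

lemma tendsto_zero_of_le_inv_add {b : ℕ → ℝ≥0∞} {y : ℕ → ℝ≥0∞} (hy : Tendsto y atTop (𝓝 0))
    (hb : ∀ k : ℕ, b k ≤ (k : ℝ≥0∞)⁻¹ + y k) : Tendsto b atTop (𝓝 0) := by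
  have h := ENNReal.tendsto_inv_nat_nhds_zero.add hy
  rw [add_zero] at h
  exact tendsto_of_tendsto_of_tendsto_of_le_of_le tendsto_const_nhds h (fun _ => bot_le) hb

/-- The main construction: columns with small sums can be extended to an ergodic transformation for
which `f` is a coboundary. -/
theorem exists_ergodic_of_columns [StandardBorelSpace X] [IsProbabilityMeasure μ]
    [NullSingletonClass μ] {f : X → ℝ} (hf : Measurable f) {Y : ℕ → Set X}
    (hY : ∀ n, MeasurableSet (Y n)) (hYm : Monotone Y) (hYU : μ (⋃ n, Y n)ᶜ = 0)
    (hb : ∀ n, ∃ M, ∀ x ∈ Y n, |f x| ≤ M) (hintg : ∀ n, ∫ x in Y n, f x ∂μ = 0)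
    (c₀ : Columns μ f) (h₀ : c₀.Stage (Y 0) 1) :
    ∃ (T : ErgodicAut μ) (g : X → ℝ), IsCoboundarySolution μ f T g ∧
      ∀ᵐ x ∂μ, c₀.Θ x ∉ c₀.B → T.1 x = c₀.Θ x := by
  obtain ⟨A, hA, hpi, hgen, hfreq⟩ := exists_piSystem_enumeration X
  choose M hM using hb
  -- Stage `k` has tolerance `2⁻ᵏ`. These are summable, so on each `Y n` the transfer functions form
  -- a Cauchy sequence from stage `n` on.
  have step : ∀ k (c : Columns μ f), c.Stage (Y k) ((1 / 2) ^ k) → ∃ c' : Columns μ f,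
      c'.Stage (Y (k + 1)) ((1 / 2) ^ (k + 1)) ∧ c'.B ⊆ c.B ∧
      (∀ x, c.Θ x ∉ c.B → c'.Θ x = c.Θ x) ∧ (∀ x ∈ Y k, |c'.g x - c.g x| ≤ 20 * (1 / 2) ^ k) ∧
      μ (c'.B ∩ Y (k + 1)) ≤ (k : ℝ≥0∞)⁻¹ ∧
      c'.Mixed (A k) (Y (k + 1)) (|μ.real (A k ∩ Y (k + 1)) -
        μ.real (A k) * μ.real (Y (k + 1))| + 1 / ((k : ℝ) + 1)) := by
    intro k c hc
    obtain ⟨c', h1, h2⟩ := hc.exists_next hf (by positivity) (hY k) (hY (k + 1))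
      (hYm (Nat.le_succ k)) (hM (k + 1)) (hintg k) (hintg (k + 1)) (A k)
      (show (0 : ℝ) < 1 / ((k : ℝ) + 1) by positivity) k
    refine ⟨c', ?_, h2⟩
    rw [pow_succ]
    convert h1 using 1
    ring
  choose! next hnext using step
  let c : ℕ → Columns μ f := fun n => Nat.rec c₀ (fun k d => next k d) n
  have hc : ∀ k, (c k).Stage (Y k) ((1 / 2) ^ k) := by
    intro k
    induction k with
    | zero => rw [pow_zero]; exact h₀
    | succ k ih => exact (hnext k _ ih).1
  have hcn := fun k => (hnext k _ (hc k)).2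
  have hYc : Tendsto (fun k => μ (Y k)ᶜ) atTop (𝓝 0) := by
    have h1 := tendsto_measure_iInter_atTop (μ := μ) (s := fun k => (Y k)ᶜ)
      (fun k => (hY k).compl.nullMeasurableSet)
      (fun i j hij => compl_subset_compl.2 (hYm hij)) ⟨0, measure_ne_top _ _⟩
    rwa [← compl_iUnion, hYU] at h1
  have hYc' : Tendsto (fun k => μ (Y (k + 1))ᶜ) atTop (𝓝 0) := hYc.comp (tendsto_add_atTop_nat 1)
  have hB0 : Tendsto (fun k => μ (c k).B) atTop (𝓝 0) := by
    refine (tendsto_add_atTop_iff_nat 1).1 (tendsto_zero_of_le_inv_add hYc' fun k => ?_)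
    rw [← measure_inter_add_sdiff (c (k + 1)).B (hY (k + 1))]
    exact add_le_add (hcn k).2.2.2.1 (measure_mono fun x hx => hx.2)
  obtain ⟨T, hT, hTΘ, hTex⟩ := exists_limit_transformation (fun k => (c k).mp)
    (fun k => (c k).meas_B) (fun k => (hcn k).1) (fun k => (hcn k).2.1) hB0
  have hpre : PreErgodic T μ :=
    preErgodic_of_mixed (fun k => hTΘ (k + 1)) hA hpi hgen hfreq (fun k => hY (k + 1)) hYc'
      (tendsto_one_div_add_atTop_nhds_zero_nat (𝕜 := ℝ)) (fun k => (hcn k).2.2.2.2)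
  have herg : Ergodic T μ := { toMeasurePreserving := hT, toPreErgodic := hpre }
  have hconv : ∀ᵐ x ∂μ, ∃ l, Tendsto (fun k => (c k).g x) atTop (𝓝 l) := by
    filter_upwards [measure_eq_zero_iff_ae_notMem.1 hYU] with x hx
    simp only [mem_compl_iff, not_not, mem_iUnion] at hx
    obtain ⟨n, hn⟩ := hx
    refine cauchySeq_tendsto_of_complete ?_
    refine (cauchySeq_shift n).1 (cauchySeq_of_le_geometric (1 / 2) (20 * (1 / 2) ^ n)
      (by norm_num) fun k => ?_)
    have := (hcn (k + n)).2.2.1 x (hYm (Nat.le_add_left n k) hn)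
    rw [dist_comm, Real.dist_eq]
    calc |(c (k + 1 + n)).g x - (c (k + n)).g x| = |(c (k + n + 1)).g x - (c (k + n)).g x| := by
          rw [show k + 1 + n = k + n + 1 by ring]
      _ ≤ 20 * (1 / 2) ^ (k + n) := this
      _ = _ := by rw [pow_add]; ring
  obtain ⟨g, hg, hgl⟩ := measurable_limit_of_tendsto_metrizable_ae (L := atTop)
    (fun k => (c k).meas_g.aemeasurable) hconv
  refine ⟨⟨T, herg⟩, g, ⟨hg, ?_⟩, hTΘ 0⟩
  filter_upwards [hgl, hT.quasiMeasurePreserving.ae hgl, hTex, ae_all_iff.2 hTΘ] with x h1 h2 h3 h4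
  obtain ⟨k, hk⟩ := h3
  have hstab : ∀ j ≥ k, (c j).Θ x ∉ (c j).B := by
    intro j hj
    induction j, hj using Nat.le_induction with
    | base => exact hk
    | succ j hj ih =>
      have h5 : (c (j + 1)).Θ x = (c j).Θ x := (hcn j).2.1 x ih
      exact h5 ▸ fun h => ih ((hcn j).1 h)
  -- Once `x` is not at the top of its column, the coboundary equation at `x` holds at all later
  -- stages with the same image point, and passes to the limit.
  refine tendsto_nhds_unique (tendsto_const_nhds.congr' ?_) (h1.sub h2)
  filter_upwards [eventually_ge_atTop k] with j hj
  rw [h4 j (hstab j hj)]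
  exact (c j).eq_inner x (hstab j hj)

end Construction

/-! ### Exhaustion by sets on which `f` is bounded with integral zero. -/

section Levels

variable {X : Type*}

/-- The sets `{0 < h ≤ k}`. -/
def posLevel (h : X → ℝ) (k : ℕ) : Set X := {x | 0 < h x ∧ h x ≤ k}

lemma posLevel_mono (h : X → ℝ) : Monotone (posLevel h) := fun _ _ hij _ hx =>
  ⟨hx.1, hx.2.trans (by exact_mod_cast hij)⟩

lemma iUnion_posLevel (h : X → ℝ) : ⋃ k, posLevel h k = {x | 0 < h x} := by
  ext x
  simp only [posLevel, mem_iUnion, mem_ofPred_eq, exists_and_left]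
  exact ⟨fun hx => hx.1, fun hx => ⟨hx, exists_nat_ge _⟩⟩

end Levels

section Exhaustion

variable {X : Type*} [MeasurableSpace X] {μ : Measure X}

/-- The intermediate value property of nonatomic measures, for the finite measure with density `h`
on `E'`. -/
lemma exists_setLIntegral_eq_between [StandardBorelSpace X] [NullSingletonClass μ]
    {h : X → ℝ≥0∞} {E E' : Set X} (hE : MeasurableSet E)
    (hE' : MeasurableSet E') (hEE' : E ⊆ E') (hfin : ∫⁻ x in E', h x ∂μ ≠ ∞) {t : ℝ≥0∞}
    (ht : ∫⁻ x in E, h x ∂μ ≤ t) (ht' : t ≤ ∫⁻ x in E', h x ∂μ) :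
    ∃ R, E ⊆ R ∧ R ⊆ E' ∧ MeasurableSet R ∧ ∫⁻ x in R, h x ∂μ = t := by
  set κ := (μ.restrict E').withDensity h with hκ
  have hκf : IsFiniteMeasure κ := isFiniteMeasure_withDensity hfin
  have hκn : NullSingletonClass κ := ⟨fun x =>
    (withDensity_absolutelyContinuous _ _) (measure_singleton x)⟩
  have hκE : ∀ R ⊆ E', MeasurableSet R → κ R = ∫⁻ x in R, h x ∂μ := by
    intro R hR hRm
    rw [hκ, withDensity_apply _ hRm, Measure.restrict_restrict hRm, inter_eq_left.2 hR]
  obtain ⟨R, h1, h2, h3, h4⟩ := exists_measure_eq_between κ hE hE' hEE'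
    ((hκE E hEE' hE).trans_le ht) (ht'.trans_eq (hκE E' Subset.rfl hE').symm)
  exact ⟨R, h1, h2, h3, (hκE R h2 h3).symm.trans h4⟩

lemma measurableSet_posLevel {h : X → ℝ} (hh : Measurable h) (k : ℕ) :
    MeasurableSet (posLevel h k) :=
  (measurableSet_lt measurable_const hh).inter (measurableSet_le hh measurable_const)

lemma setLIntegral_posLevel_ne_top [IsFiniteMeasure μ] (h : X → ℝ) (k : ℕ) :
    ∫⁻ x in posLevel h k, ENNReal.ofReal (h x) ∂μ ≠ ∞ := by
  refine (setLIntegral_lt_top_of_le_nnreal (measure_ne_top _ _) ⟨k, fun x hx => ?_⟩).ne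
  simpa using ENNReal.ofReal_le_ofReal hx.2

lemma setLIntegral_pos (h : X → ℝ) (hh : AEMeasurable h μ) :
    ∫⁻ x in {x | 0 < h x}, ENNReal.ofReal (h x) ∂μ = ∫⁻ x, ENNReal.ofReal (h x) ∂μ := by
  rw [← lintegral_indicator₀ (nullMeasurableSet_lt aemeasurable_const hh)]
  refine lintegral_congr fun x => ?_
  by_cases hx : x ∈ {x | 0 < h x}
  · rw [indicator_of_mem hx]
  · rw [indicator_of_notMem hx, ENNReal.ofReal_of_nonpos (not_lt.1 hx)]

lemma tendsto_setLIntegral_posLevel {h : X → ℝ} (hh : Measurable h) :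
    Tendsto (fun k => ∫⁻ x in posLevel h k, ENNReal.ofReal (h x) ∂μ) atTop
      (𝓝 (∫⁻ x, ENNReal.ofReal (h x) ∂μ)) := by
  rw [← setLIntegral_pos h hh.aemeasurable, ← iUnion_posLevel,
    setLIntegral_iUnion_of_directed _ (posLevel_mono h).directed_le]
  exact tendsto_atTop_iSup fun i j hij => lintegral_mono_set (posLevel_mono h hij)

/-- With a finite total, nested sets whose integrals converge to the total leave out only a set on
which the integral of `h` is zero, which is null because `h` is positive there. -/
lemma exists_exhaustion_of_finite [StandardBorelSpace X] [IsFiniteMeasure μ] [NullSingletonClass μ]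
    {h : X → ℝ} (hh : Measurable h) (hfin : ∫⁻ x, ENNReal.ofReal (h x) ∂μ ≠ ∞) {t : ℕ → ℝ≥0∞}
    (htm : Monotone t) (ht : ∀ k, t k ≤ ∫⁻ x in posLevel h k, ENNReal.ofReal (h x) ∂μ)
    (htl : Tendsto t atTop (𝓝 (∫⁻ x, ENNReal.ofReal (h x) ∂μ))) :
    ∃ P : ℕ → Set X, Monotone P ∧ (∀ k, MeasurableSet (P k)) ∧ (∀ k, P k ⊆ posLevel h k) ∧
      (∀ k, ∫⁻ x in P k, ENNReal.ofReal (h x) ∂μ = t k) ∧ μ ({x | 0 < h x} \ ⋃ k, P k) = 0 := by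
  let Good : ℕ → Set X → Prop := fun k P => MeasurableSet P ∧ P ⊆ posLevel h k ∧
    ∫⁻ x in P, ENNReal.ofReal (h x) ∂μ = t k
  have step : ∀ k P, Good k P → ∃ P', Good (k + 1) P' ∧ P ⊆ P' := by
    rintro k P ⟨h1, h2, h3⟩
    obtain ⟨R, r1, r2, r3, r4⟩ := exists_setLIntegral_eq_between h1
      (measurableSet_posLevel hh (k + 1)) (h2.trans (posLevel_mono h (Nat.le_succ k)))
      (setLIntegral_posLevel_ne_top h (k + 1)) (h3.trans_le (htm (Nat.le_succ k))) (ht (k + 1))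
    exact ⟨R, ⟨r3, r2, r4⟩, r1⟩
  choose! next hnext hsub using step
  obtain ⟨P₀, -, r2, r3, r4⟩ := exists_setLIntegral_eq_between (t := t 0) .empty
    (measurableSet_posLevel hh 0) (empty_subset _) (setLIntegral_posLevel_ne_top (μ := μ) h 0)
    (by simp) (ht 0)
  let P : ℕ → Set X := fun n => Nat.rec P₀ (fun k Q => next k Q) n
  have hP : ∀ k, Good k (P k) := by
    intro k
    induction k with
    | zero => exact ⟨r3, r2, r4⟩
    | succ k ih => exact hnext k _ ih
  have hmono : Monotone P := monotone_nat_of_le_succ fun k => hsub k _ (hP k)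
  have hPU : MeasurableSet (⋃ k, P k) := .iUnion fun k => (hP k).1
  refine ⟨P, hmono, fun k => (hP k).1, fun k => (hP k).2.1, fun k => (hP k).2.2, ?_⟩
  have hpos : MeasurableSet {x | 0 < h x} := measurableSet_lt measurable_const hh
  have hsubU : ⋃ k, P k ⊆ {x | 0 < h x} := iUnion_subset fun k x hx => ((hP k).2.1 hx).1
  have h1 : ∫⁻ x in ⋃ k, P k, ENNReal.ofReal (h x) ∂μ = ∫⁻ x, ENNReal.ofReal (h x) ∂μ := by
    rw [setLIntegral_iUnion_of_directed _ hmono.directed_le]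
    refine tendsto_nhds_unique (tendsto_atTop_iSup fun i j hij => lintegral_mono_set (hmono hij)) ?_
    refine htl.congr fun k => (hP k).2.2.symm
  have h2 : ∫⁻ x in {x | 0 < h x} \ ⋃ k, P k, ENNReal.ofReal (h x) ∂μ = 0 := by
    have h3 := lintegral_inter_add_sdiff (μ := μ) (fun x => ENNReal.ofReal (h x)) {x | 0 < h x} hPU
    rw [inter_eq_right.2 hsubU, h1, setLIntegral_pos h hh.aemeasurable] at h3
    exact (ENNReal.add_right_inj hfin).1 (h3.trans (add_zero _).symm)
  rw [setLIntegral_eq_zero_iff (hpos.diff hPU) hh.ennreal_ofReal] at h2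
  refine measure_mono_null (fun x hx => ?_) h2
  intro h3
  have h4 := h3 hx
  rw [ENNReal.ofReal_eq_zero] at h4
  exact absurd hx.1 (not_lt.2 h4)

/-- Exhaustions of `{h > 0}` and of `{h' > 0}` by sets on which `h` and `h'` are bounded with equal
integrals. -/
lemma exists_exhaustions [StandardBorelSpace X] [IsFiniteMeasure μ] [NullSingletonClass μ]
    {h h' : X → ℝ} (hh : Measurable h) (hh' : Measurable h')
    (heq : ∫⁻ x, ENNReal.ofReal (h x) ∂μ = ∫⁻ x, ENNReal.ofReal (h' x) ∂μ) :
    ∃ (P P' : ℕ → Set X) (m : ℕ → ℕ), Monotone P ∧ Monotone P' ∧ (∀ k, MeasurableSet (P k)) ∧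
      (∀ k, MeasurableSet (P' k)) ∧ (∀ k, P k ⊆ posLevel h (m k)) ∧
      (∀ k, P' k ⊆ posLevel h' (m k)) ∧
      (∀ k, ∫⁻ x in P k, ENNReal.ofReal (h x) ∂μ = ∫⁻ x in P' k, ENNReal.ofReal (h' x) ∂μ) ∧
      μ ({x | 0 < h x} \ ⋃ k, P k) = 0 ∧ μ ({x | 0 < h' x} \ ⋃ k, P' k) = 0 := by
  set a : ℕ → ℝ≥0∞ := fun k => ∫⁻ x in posLevel h k, ENNReal.ofReal (h x) ∂μ with ha
  set a' : ℕ → ℝ≥0∞ := fun k => ∫⁻ x in posLevel h' k, ENNReal.ofReal (h' x) ∂μ with ha'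
  have hat : Tendsto a atTop (𝓝 (∫⁻ x, ENNReal.ofReal (h x) ∂μ)) :=
    tendsto_setLIntegral_posLevel hh
  have hat' : Tendsto a' atTop (𝓝 (∫⁻ x, ENNReal.ofReal (h' x) ∂μ)) :=
    tendsto_setLIntegral_posLevel hh'
  have ham : Monotone a := fun i j hij => lintegral_mono_set (posLevel_mono h hij)
  have ham' : Monotone a' := fun i j hij => lintegral_mono_set (posLevel_mono h' hij)
  -- For infinite integrals the target at step `k` is the larger of the two integrals at level `m
  -- k`, where the levels are so sparse that both functions attain it by level `m (k + 1)`. The sets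
  -- then contain the full level sets, so they exhaust.
  by_cases hfin : ∫⁻ x, ENNReal.ofReal (h x) ∂μ = ∞
  · rw [hfin] at heq hat
    rw [← heq] at hat'
    have hstep : ∀ m : ℕ, ∃ m', m < m' ∧ max (a m) (a' m) ≤ a m' ∧ max (a m) (a' m) ≤ a' m' := by
      intro m
      have hlt : max (a m) (a' m) < ∞ := max_lt
        (setLIntegral_posLevel_ne_top h m).lt_top (setLIntegral_posLevel_ne_top h' m).lt_top
      obtain ⟨m', h1, h2, h3⟩ := ((eventually_gt_atTop m).and
        ((hat.eventually (lt_mem_nhds hlt)).and (hat'.eventually (lt_mem_nhds hlt)))).exists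
      exact ⟨m', h1, h2.le, h3.le⟩
    choose nx hnx1 hnx2 hnx3 using hstep
    let m : ℕ → ℕ := fun n => Nat.rec 0 (fun _ k => nx k) n
    have hm : StrictMono m := strictMono_nat_of_lt_succ fun k => hnx1 (m k)
    have key : ∀ (q : X → ℝ), Measurable q →
        (∀ k, ∫⁻ x in posLevel q (m k), ENNReal.ofReal (q x) ∂μ ≤ max (a (m k)) (a' (m k))) →
        (∀ k, max (a (m k)) (a' (m k)) ≤ ∫⁻ x in posLevel q (m (k + 1)), ENNReal.ofReal (q x) ∂μ) →
        ∃ P : ℕ → Set X, Monotone P ∧ (∀ k, MeasurableSet (P k)) ∧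
          (∀ k, P k ⊆ posLevel q (m (k + 1))) ∧
          (∀ k, ∫⁻ x in P k, ENNReal.ofReal (q x) ∂μ = max (a (m k)) (a' (m k))) ∧
          μ ({x | 0 < q x} \ ⋃ k, P k) = 0 := by
      intro q hq h1 h2
      choose P hP1 hP2 hP3 hP4 using fun k => exists_setLIntegral_eq_between
        (measurableSet_posLevel hq (m k)) (measurableSet_posLevel hq (m (k + 1)))
        (posLevel_mono q (hm.monotone (Nat.le_succ k))) (setLIntegral_posLevel_ne_top q _)
        (h1 k) (h2 k)
      refine ⟨P, monotone_nat_of_le_succ fun k => (hP2 k).trans (hP1 (k + 1)), hP3, hP2, hP4, ?_⟩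
      have : {x | 0 < q x} ⊆ ⋃ k, P k := by
        rw [← iUnion_posLevel]
        exact iUnion_subset fun k => ((posLevel_mono q (hm.le_apply)).trans (hP1 k)).trans
          (subset_iUnion P k)
      rw [sdiff_eq_empty.2 this, measure_empty]
    obtain ⟨P, p1, p2, p3, p4, p5⟩ := key h hh (fun k => le_max_left _ _) (fun k => hnx2 (m k))
    obtain ⟨P', q1, q2, q3, q4, q5⟩ := key h' hh' (fun k => le_max_right _ _) (fun k => hnx3 (m k))
    exact ⟨P, P', fun k => m (k + 1), p1, q1, p2, q2, p3, q3, fun k => (p4 k).trans (q4 k).symm,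
      p5, q5⟩
  -- For finite integrals the target is the smaller of the two integrals, available to both
  -- functions and convergent to the common total.
  · have htm : Monotone fun k => min (a k) (a' k) := ham.min ham'
    have htl : Tendsto (fun k => min (a k) (a' k)) atTop
        (𝓝 (∫⁻ x, ENNReal.ofReal (h x) ∂μ)) := by
      have := hat.min hat'
      rwa [← heq, min_self] at this
    obtain ⟨P, p1, p2, p3, p4, p5⟩ := exists_exhaustion_of_finite hh hfin htm
      (fun k => min_le_left _ _) htl
    obtain ⟨P', q1, q2, q3, q4, q5⟩ := exists_exhaustion_of_finite hh' (heq ▸ hfin) htm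
      (fun k => min_le_right _ _) (heq ▸ htl)
    exact ⟨P, P', id, p1, q1, p2, q2, p3, q3, fun k => (p4 k).trans (q4 k).symm, p5, q5⟩

lemma setIntegral_eq_zero_of_lintegral_eq [IsFiniteMeasure μ] {f : X → ℝ} {Y : Set X}
    (hf : IntegrableOn f Y μ)
    (h : ∫⁻ x in Y, ENNReal.ofReal (f x) ∂μ = ∫⁻ x in Y, ENNReal.ofReal (-f x) ∂μ) :
    ∫ x in Y, f x ∂μ = 0 := by
  rw [integral_eq_lintegral_pos_part_sub_lintegral_neg_part hf, h, sub_self]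

theorem exists_ergodic_of_lintegral_eq [StandardBorelSpace X] [IsProbabilityMeasure μ]
    [NullSingletonClass μ] {f : X → ℝ} (hf : Measurable f)
    (heq : ∫⁻ x, ENNReal.ofReal (f x) ∂μ = ∫⁻ x, ENNReal.ofReal (-f x) ∂μ) :
    ∃ (T : ErgodicAut μ) (g : X → ℝ), IsCoboundarySolution μ f T g := by
  obtain ⟨P, Q, m, p1, q1, p2, q2, p3, q3, hPQ, p5, q5⟩ := exists_exhaustions hf hf.neg heq
  let Z : Set X := {x | f x = 0}
  have hZ : MeasurableSet Z := measurableSet_eq_fun hf measurable_const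
  let V : ℕ → Set X := fun k => (P k ∪ Q k) ∪ Z
  have hV : ∀ k, MeasurableSet (V k) := fun k => ((p2 k).union (q2 k)).union hZ
  have hVm : Monotone V := fun i j hij =>
    union_subset_union_left _ (union_subset_union (p1 hij) (q1 hij))
  have hVb : ∀ k, ∀ x ∈ V k, |f x| ≤ m k := by
    rintro k x ((hx | hx) | hx)
    · have := p3 k hx
      rw [abs_of_pos this.1]; exact this.2
    · have := q3 k hx
      have h1 : 0 < -f x := this.1
      rw [abs_of_neg (by linarith)]; exact this.2
    · have : f x = 0 := hx
      rw [this]; simp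
  have hVint : ∀ k, ∫ x in V k, f x ∂μ = 0 := by
    intro k
    refine setIntegral_eq_zero_of_lintegral_eq
      (Measure.integrableOn_of_bounded (M := m k) (measure_ne_top _ _) hf.aestronglyMeasurable
        ((ae_restrict_mem (hV k)).mono (hVb k))) ?_
    have key : ∀ (R S : Set X) (q : X → ℝ), MeasurableSet R → MeasurableSet S → R ⊆ S →
        (∀ x ∈ S, x ∉ R → q x ≤ 0) →
        ∫⁻ x in S, ENNReal.ofReal (q x) ∂μ = ∫⁻ x in R, ENNReal.ofReal (q x) ∂μ := by
      intro R S q hR hS hRS hq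
      rw [← lintegral_inter_add_sdiff (fun x => ENNReal.ofReal (q x)) S hR, inter_eq_right.2 hRS]
      have : ∫⁻ x in S \ R, ENNReal.ofReal (q x) ∂μ = ∫⁻ x in S \ R, 0 ∂μ :=
        setLIntegral_congr_fun (hS.diff hR) fun x hx =>
          ENNReal.ofReal_of_nonpos (hq x hx.1 hx.2)
      rw [this]; simp
    rw [key (P k) (V k) f (p2 k) (hV k) (fun x hx => Or.inl (Or.inl hx)),
      key (Q k) (V k) (fun x => -f x) (q2 k) (hV k) (fun x hx => Or.inl (Or.inr hx))]
    · exact hPQ k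
    · rintro x ((hx | hx) | hx) hx'
      · have := (p3 k hx).1
        linarith
      · exact absurd hx hx'
      · have : f x = 0 := hx
        rw [this]; simp
    · rintro x ((hx | hx) | hx) hx'
      · exact absurd hx hx'
      · have h1 : 0 < -f x := (q3 k hx).1
        linarith
      · exact le_of_eq hx
  -- Starting with the empty set makes the columns of height one an admissible initial stage,
  -- whatever the size of `f`.
  let Y : ℕ → Set X := fun n => Nat.casesOn n ∅ V
  have hYm : Monotone Y := by
    refine monotone_nat_of_le_succ ?_
    rintro (_ | k)
    · exact empty_subset _
    · exact hVm (Nat.le_succ k)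
  have hYU : μ (⋃ n, Y n)ᶜ = 0 := by
    refine measure_mono_null (fun x hx => ?_) (measure_union_null p5 q5)
    have hxV : ∀ k, x ∉ V k := fun k h => hx (mem_iUnion.2 ⟨k + 1, h⟩)
    rcases lt_trichotomy (f x) 0 with h | h | h
    · refine Or.inr ⟨show 0 < -f x by linarith, fun h' => ?_⟩
      obtain ⟨k, hk⟩ := mem_iUnion.1 h'
      exact hxV k (Or.inl (Or.inr hk))
    · exact absurd (Or.inr h) (hxV 0)
    · refine Or.inl ⟨h, fun h' => ?_⟩
      obtain ⟨k, hk⟩ := mem_iUnion.1 h'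
      exact hxV k (Or.inl (Or.inl hk))
  have hYb : ∀ n, ∃ M : ℝ, ∀ x ∈ Y n, |f x| ≤ M := by
    rintro (_ | k)
    · exact ⟨0, fun x hx => absurd hx (notMem_empty x)⟩
    · exact ⟨m k, hVb k⟩
  have hYint : ∀ n, ∫ x in Y n, f x ∂μ = 0 := by
    rintro (_ | k)
    · show ∫ x in (∅ : Set X), f x ∂μ = 0
      simp
    · exact hVint k
  obtain ⟨T, g, hTg, -⟩ := exists_ergodic_of_columns (μ := μ) hf (Y := Y)
    (by rintro (_ | k); exacts [.empty, hV k]) hYm hYU hYb hYint (Columns.trivial hf)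
    { sat := fun x => Iff.rfl
      off_B := fun x _ => mem_univ x
      off_u := fun x _ => rfl
      small := Eventually.of_forall fun x hx => absurd hx.2 (notMem_empty x) }
  exact ⟨T, g, hTg⟩

theorem exists_coboundarySolution_iff [StandardBorelSpace X] [IsProbabilityMeasure μ]
    [NullSingletonClass μ] {f : X → ℝ} (hf : AEMeasurable f μ) :
    (∃ (T : ErgodicAut μ) (g : X → ℝ), IsCoboundarySolution μ f T g) ↔
      ∫⁻ x in {x | 0 < f x}, ENNReal.ofReal (f x) ∂μ =
        ∫⁻ x in {x | f x < 0}, ENNReal.ofReal (-f x) ∂μ := by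
  have h1 := setLIntegral_pos (μ := μ) f hf
  have h2 := setLIntegral_pos (μ := μ) (fun x => -f x) hf.neg
  simp only [Left.neg_pos_iff] at h2
  rw [h1, h2]
  have hcongr : ∀ f' : X → ℝ, f =ᵐ[μ] f' →
      ∫⁻ x, ENNReal.ofReal (f x) ∂μ = ∫⁻ x, ENNReal.ofReal (f' x) ∂μ ∧
      ∫⁻ x, ENNReal.ofReal (-f x) ∂μ = ∫⁻ x, ENNReal.ofReal (-f' x) ∂μ := fun f' h =>
    ⟨lintegral_congr_ae (h.mono fun x hx => congrArg ENNReal.ofReal hx),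
      lintegral_congr_ae (h.mono fun x hx => congrArg (fun t => ENNReal.ofReal (-t)) hx)⟩
  constructor
  · rintro ⟨T, g, hg, hTg⟩
    obtain ⟨e1, e2⟩ := hcongr _ hTg
    rw [e1, e2]
    exact lintegral_coboundary T.2.toMeasurePreserving hg
  · intro h
    have hae := hf.ae_eq_mk
    obtain ⟨e1, e2⟩ := hcongr _ hae
    rw [e1, e2] at h
    obtain ⟨T, g, hg, hTg⟩ := exists_ergodic_of_lintegral_eq hf.measurable_mk h
    exact ⟨T, g, hg, by filter_upwards [hae, hTg] with x hx hx'; rw [hx, hx']⟩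

end Exhaustion

/-! ### Rokhlin's lemma. -/

section Rokhlin

variable {X : Type*} [MeasurableSpace X] {μ : Measure X}

/-- Rokhlin's lemma: an ergodic transformation has towers of any height that almost fill the
space. -/
lemma exists_rokhlin_tower [StandardBorelSpace X] [IsProbabilityMeasure μ] [NullSingletonClass μ]
    (T : X ≃ᵐ X) (hT : Ergodic T μ) {N : ℕ} (hN : 0 < N) {ε : ℝ≥0∞} (hε : ε ≠ 0) :
    ∃ B, MeasurableSet B ∧ (∀ i < N, ∀ j < N, ∀ x ∈ B, ∀ y ∈ B, T^[i] x = T^[j] y → i = j) ∧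
      1 ≤ N * μ B + ε ∧ N * μ B ≤ 1 ∧
      μ (⋃ i ∈ Finset.range N, T.symm^[i] ⁻¹' B)ᶜ ≤ ε := by
  classical
  have hN0 : (N : ℝ≥0∞) ≠ 0 := by simpa using hN.ne'
  -- A set of positive measure at most `ε / N`. By ergodicity almost every point enters it, and the
  -- time `n` of first entry decreases by one with each step until then.
  obtain ⟨A, -, hA, hAμ⟩ := exists_subset_measure_eq μ (S := univ) .univ (t := min 1 (ε / N))
    (by rw [measure_univ]; exact min_le_left _ _)
  have hA0 : μ A ≠ 0 := by
    rw [hAμ]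
    refine (lt_min zero_lt_one ?_).ne'
    exact ENNReal.div_pos hε (by simp)
  have hAε : N * μ A ≤ ε := by
    rw [hAμ]
    calc N * min 1 (ε / N) ≤ N * (ε / N) := by gcongr; exact min_le_right _ _
      _ ≤ ε := ENNReal.mul_div_le
  set E : Set X := ⋃ k, T^[k] ⁻¹' A with hE
  have hEm : MeasurableSet E := .iUnion fun k => (T.measurable.iterate k) hA
  have hE0 : μ Eᶜ = 0 := by
    have hsub : T ⁻¹' E ⊆ E := by
      intro x hx
      obtain ⟨k, hk⟩ := mem_iUnion.1 hx
      exact mem_iUnion.2 ⟨k + 1, hk⟩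
    rcases hT.ae_empty_or_univ_of_preimage_ae_le hEm.nullMeasurableSet
      (LE.le.eventuallyLE hsub) with h | h
    · have h1 : A ⊆ E := fun x hx => mem_iUnion.2 ⟨0, hx⟩
      have h2 : μ E = 0 := by rw [measure_congr h, measure_empty]
      exact absurd (measure_mono_null h1 h2) hA0
    · rw [← ae_eq_univ.1 h]
  have hex : ∀ x, ∃ k, T^[k] x ∈ A ∨ x ∉ E := by
    intro x
    by_cases hx : x ∈ E
    · obtain ⟨k, hk⟩ := mem_iUnion.1 hx
      exact ⟨k, Or.inl hk⟩
    · exact ⟨0, Or.inr hx⟩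
  let n : X → ℕ := fun x => Nat.find (hex x)
  have hn : Measurable n := measurable_find _ fun k =>
    ((T.measurable.iterate k) hA).union hEm.compl
  have hnA : ∀ x ∈ E, T^[n x] x ∈ A := fun x hx =>
    (Nat.find_spec (hex x)).resolve_right (not_not.2 hx)
  have hnlt : ∀ x, ∀ k < n x, T^[k] x ∉ A := fun x k hk h => Nat.find_min (hex x) hk (Or.inl h)
  have hneq : ∀ x r, T^[r] x ∈ A → (∀ k < r, T^[k] x ∉ A) → x ∈ E ∧ n x = r := by
    intro x r h1 h2
    have hx : x ∈ E := mem_iUnion.2 ⟨r, h1⟩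
    refine ⟨hx, le_antisymm (Nat.find_le (Or.inl h1)) ?_⟩
    by_contra! hlt
    exact h2 _ hlt (hnA x hx)
  -- Over `B` the first `N` levels have entry times with residues `N - 1, …, 0` modulo `N`, so
  -- levels of different height are disjoint.
  set B : Set X := E ∩ {x | n x % N = N - 1} with hB
  have hBm : MeasurableSet B := hEm.inter (hn (.of_discrete (s := {k : ℕ | k % N = N - 1})))
  have hshift : ∀ i < N, ∀ x ∈ B, T^[i] x ∈ E ∧ n (T^[i] x) = n x - i ∧ i ≤ n x := by
    intro i hi x hx
    have h1 : n x % N = N - 1 := hx.2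
    have h2 : i ≤ n x := by have := Nat.mod_le (n x) N; omega
    have h3 := hneq (T^[i] x) (n x - i) (by
      rw [← Function.iterate_add_apply, Nat.sub_add_cancel h2]; exact hnA x hx.1) (fun k hk => by
      rw [← Function.iterate_add_apply]; exact hnlt x _ (by omega))
    exact ⟨h3.1, h3.2, h2⟩
  have hTs : MeasurePreserving T.symm μ μ := hT.toMeasurePreserving.symm
  have hinv : ∀ i x, T^[i] (T.symm^[i] x) = x := fun i x =>
    (Function.RightInverse.iterate T.right_inv i) x
  have hinv' : ∀ i x, T.symm^[i] (T^[i] x) = x := fun i x =>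
    (Function.LeftInverse.iterate T.left_inv i) x
  have hdisj : ∀ i < N, ∀ j < N, ∀ x ∈ B, ∀ y ∈ B, T^[i] x = T^[j] y → i = j := by
    intro i hi j hj x hx y hy hxy
    obtain ⟨-, h1, h2⟩ := hshift i hi x hx
    obtain ⟨-, h3, h4⟩ := hshift j hj y hy
    rw [hxy, h3] at h1
    have hx2 : n x % N = N - 1 := hx.2
    have hy2 : n y % N = N - 1 := hy.2
    have h5 : n x + j = n y + i := by omega
    have hdx := Nat.div_add_mod (n x) N
    have hdy := Nat.div_add_mod (n y) N
    have h6 : (N * (n x / N) + j) % N = (N * (n y / N) + i) % N := by congr 1; omega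
    rwa [Nat.mul_add_mod, Nat.mul_add_mod, Nat.mod_eq_of_lt hj, Nat.mod_eq_of_lt hi, eq_comm] at h6
  have hcover : (⋃ i ∈ Finset.range N, T.symm^[i] ⁻¹' B)ᶜ ⊆
      Eᶜ ∪ ⋃ l ∈ Finset.range N, T.symm^[l] ⁻¹' A := by
    intro x hx
    by_contra hcon
    simp only [mem_union, mem_compl_iff, not_or, not_not, mem_iUnion, Finset.mem_range, exists_prop,
      mem_preimage, not_exists, not_and] at hcon hx
    obtain ⟨hxE, hxA⟩ := hcon
    set r := n x with hr
    have hrN : r % N < N := Nat.mod_lt _ hN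
    -- Going back `i` steps reaches `B`, unless the backward orbit meets `A` in fewer than `N`
    -- steps. The latter happens on a set of measure at most `N * μ A ≤ ε`.
    set i := N - 1 - r % N with hi
    refine hx i (by omega) ?_
    set y := T.symm^[i] x with hy
    have hyx : T^[i] y = x := hinv i x
    have h1 := hneq y (r + i) (by rw [Function.iterate_add_apply, hyx]; exact hnA x hxE) (by
      intro k hk hkA
      rcases lt_or_ge k i with h | h
      · refine hxA (i - k) (by omega) ?_
        have : T.symm^[i - k] x = T^[k] y := by
          rw [← hyx]
          conv_lhs => rw [show i = (i - k) + k by omega, Function.iterate_add_apply,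
            show (i - k + k) - k = i - k by omega, hinv']
        rw [this]; exact hkA
      · have h2 : T^[k] y = T^[k - i] x := by
          rw [← hyx, ← Function.iterate_add_apply, Nat.sub_add_cancel h]
        exact hnlt x (k - i) (by omega) (h2 ▸ hkA))
    refine ⟨h1.1, ?_⟩
    show n y % N = N - 1
    rw [h1.2]
    have hd := Nat.div_add_mod r N
    have : r + i = N * (r / N) + (N - 1) := by omega
    rw [this, Nat.mul_add_mod, Nat.mod_eq_of_lt (by omega)]
  have hpre : ∀ i (S : Set X), MeasurableSet S → μ (T.symm^[i] ⁻¹' S) = μ S := fun i S hS =>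
    (hTs.iterate i).measure_preimage hS.nullMeasurableSet
  have hmiss : μ (⋃ i ∈ Finset.range N, T.symm^[i] ⁻¹' B)ᶜ ≤ ε := by
    calc μ (⋃ i ∈ Finset.range N, T.symm^[i] ⁻¹' B)ᶜ
        ≤ μ Eᶜ + μ (⋃ l ∈ Finset.range N, T.symm^[l] ⁻¹' A) :=
          (measure_mono hcover).trans (measure_union_le _ _)
      _ ≤ 0 + ∑ l ∈ Finset.range N, μ (T.symm^[l] ⁻¹' A) :=
          add_le_add hE0.le (measure_biUnion_finset_le _ _)
      _ = N * μ A := by simp [hpre _ A hA]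
      _ ≤ ε := hAε
  have htot : μ (⋃ i ∈ Finset.range N, T.symm^[i] ⁻¹' B) = N * μ B := by
    rw [measure_biUnion_finset]
    · simp [hpre _ B hBm]
    · intro i hi j hj hij
      refine Set.disjoint_left.2 fun x hx hx' => hij ?_
      exact hdisj i (by simpa using hi) j (by simpa using hj) _ hx _ hx' (by rw [hinv, hinv])
    · exact fun i _ => (T.symm.measurable.iterate i) hBm
  refine ⟨B, hBm, hdisj, ?_, htot ▸ prob_le_one, hmiss⟩
  have hU : MeasurableSet (⋃ i ∈ Finset.range N, T.symm^[i] ⁻¹' B) :=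
    Finset.measurableSet_biUnion _ fun i _ => (T.symm.measurable.iterate i) hBm
  calc (1 : ℝ≥0∞) = μ (⋃ i ∈ Finset.range N, T.symm^[i] ⁻¹' B) +
        μ (⋃ i ∈ Finset.range N, T.symm^[i] ⁻¹' B)ᶜ := by
        rw [measure_add_measure_compl hU, measure_univ]
    _ ≤ N * μ B + ε := by rw [htot]; gcongr

end Rokhlin

/-! ### Rokhlin towers with nonvanishing sums, and arranged pieces of their bases. -/

section Concat

variable {X : Type*}

/-- Concatenation of two sequences, the first of length `n`. -/
def concat (n : ℕ) (c c' : ℕ → Set X) : ℕ → Set X := fun k => if k < n then c k else c' (k - n)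

lemma concat_of_lt {n : ℕ} {c c' : ℕ → Set X} {k : ℕ} (h : k < n) : concat n c c' k = c k :=
  if_pos h

lemma concat_of_ge {n : ℕ} {c c' : ℕ → Set X} {k : ℕ} (h : n ≤ k) :
    concat n c c' k = c' (k - n) := if_neg (by omega)

end Concat

section Tower

variable {X : Type*} [MeasurableSpace X] {μ : Measure X}

/-- Two consecutive Birkhoff sums differ by `f ∘ T^[N]`; if both vanished almost everywhere, so
would `f`. -/
lemma exists_birkhoffSum_ne_zero {T : X → X} (hT : MeasurePreserving T μ μ) {f : X → ℝ}
    (hf : Measurable f) (hf0 : μ {x | f x ≠ 0} ≠ 0) (N₀ : ℕ) :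
    ∃ N ≥ N₀, μ {x | birkhoffSum T f N x ≠ 0} ≠ 0 := by
  by_contra! h
  have h1 := h N₀ le_rfl
  have h2 := h (N₀ + 1) (Nat.le_succ _)
  have hm : MeasurableSet {x | f x ≠ 0} := (measurableSet_eq_fun hf measurable_const).compl
  refine hf0 ?_
  rw [← (hT.iterate N₀).measure_preimage hm.nullMeasurableSet]
  refine measure_mono_null (fun x hx => ?_) (measure_union_null h1 h2)
  by_contra hcon
  simp only [mem_union, mem_ofPred_eq, not_or, not_not] at hcon
  rw [birkhoffSum_succ, hcon.1, zero_add] at hcon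
  exact hx hcon.2

/-- There are Rokhlin towers over whose base the sums of `f` do not vanish. -/
lemma exists_tower_birkhoffSum_ne_zero [StandardBorelSpace X] [IsProbabilityMeasure μ]
    [NullSingletonClass μ] (T : X ≃ᵐ X) (hT : Ergodic T μ) {f : X → ℝ} (hf : Measurable f)
    (hf0 : μ {x | f x ≠ 0} ≠ 0) {N₀ : ℕ} (hN₀ : 0 < N₀) {ε : ℝ≥0∞} (hε : ε ≠ 0) :
    ∃ N ≥ N₀, ∃ B, MeasurableSet B ∧
      (∀ i < N, ∀ j < N, ∀ x ∈ B, ∀ y ∈ B, T^[i] x = T^[j] y → i = j) ∧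
      1 ≤ N * μ B + ε ∧ N * μ B ≤ 1 ∧ μ (B ∩ {x | birkhoffSum T f N x ≠ 0}) ≠ 0 := by
  obtain ⟨N, hN, hS⟩ := exists_birkhoffSum_ne_zero hT.toMeasurePreserving hf hf0 N₀
  set S := {x | birkhoffSum T f N x ≠ 0} with hSdef
  obtain ⟨B, hB, hd, h1, h2, h3⟩ := exists_rokhlin_tower T hT (hN₀.trans_le hN)
    (ε := min ε (μ S / 2)) (lt_min (pos_iff_ne_zero.2 hε) (ENNReal.half_pos hS)).ne'
  have hTs : MeasurePreserving T.symm μ μ := hT.toMeasurePreserving.symm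
  -- The tower misses at most half of the mass of `S`, so `S` meets the `j`-th level for some `j`.
  -- That level is the base of a tower of the same height and mass and serves as the new base.
  obtain ⟨j, hj⟩ : ∃ j, μ (T.symm^[j] ⁻¹' B ∩ S) ≠ 0 := by
    by_contra! h
    have h4 : μ S ≤ μ S / 2 := by
      calc μ S ≤ μ ((⋃ i ∈ Finset.range N, T.symm^[i] ⁻¹' B)ᶜ ∪
            ⋃ j, T.symm^[j] ⁻¹' B ∩ S) := by
            refine measure_mono fun x hx => ?_
            by_cases hxU : x ∈ ⋃ i ∈ Finset.range N, T.symm^[i] ⁻¹' B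
            · obtain ⟨i, _, hi⟩ := mem_iUnion₂.1 hxU
              exact Or.inr (mem_iUnion.2 ⟨i, hi, hx⟩)
            · exact Or.inl hxU
        _ ≤ μ (⋃ i ∈ Finset.range N, T.symm^[i] ⁻¹' B)ᶜ + μ (⋃ j, T.symm^[j] ⁻¹' B ∩ S) :=
            measure_union_le _ _
        _ ≤ μ S / 2 := by
            rw [measure_iUnion_null h, add_zero]
            exact h3.trans (min_le_right _ _)
    exact absurd h4 (not_le.2 (ENNReal.half_lt_self hS (measure_ne_top _ _)))
  have hμ : μ (T.symm^[j] ⁻¹' B) = μ B := (hTs.iterate j).measure_preimage hB.nullMeasurableSet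
  have hinv : ∀ x, T^[j] (T.symm^[j] x) = x := (Function.RightInverse.iterate T.right_inv j)
  refine ⟨N, hN, T.symm^[j] ⁻¹' B, (T.symm.measurable.iterate j) hB, ?_, ?_, ?_, hj⟩
  · intro i hi i' hi' x hx y hy hxy
    refine hd i hi i' hi' _ hx _ hy (T.injective.iterate j ?_)
    rw [← Function.iterate_add_apply, ← Function.iterate_add_apply, add_comm j, add_comm j,
      Function.iterate_add_apply, Function.iterate_add_apply, hinv, hinv, hxy]
  · rw [hμ]; exact h1.trans (by gcongr; exact min_le_left _ _)
  · rw [hμ]; exact h2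

/-- `c 0, …, c (n - 1)` are disjoint subsets of `S` of mass `t`. -/
structure IsPieces (μ : Measure X) (S : Set X) (n : ℕ) (t : ℝ≥0∞) (c : ℕ → Set X) : Prop where
  meas : ∀ i < n, MeasurableSet (c i)
  sub : ∀ i < n, c i ⊆ S
  disj : ∀ i < n, ∀ j < n, ∀ x ∈ c i, x ∈ c j → i = j
  mass : ∀ i < n, μ (c i) = t

lemma exists_isPieces [StandardBorelSpace X] [IsFiniteMeasure μ] [NullSingletonClass μ] {S : Set X}
    (hS : MeasurableSet S) {n : ℕ} {t : ℝ≥0∞} (ht : t ≠ ∞) (h : μ S = n * t) :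
    ∃ c, IsPieces μ S n t c := by
  -- With constant weight the initial segments are just an increasing chain of prescribed masses;
  -- the pieces are its differences.
  obtain ⟨R, -, hRm, hRS, hRme, hRμ, -⟩ := exists_initial_segments μ hS
    (w := fun _ => 0) measurable_const (M := fun i => (min i n : ℕ) * t) (by simp)
    (fun i j hij => by dsimp only; gcongr)
    (fun i => by rw [h]; gcongr; exact min_le_right _ _)
  refine ⟨fun i => R (i + 1) \ R i, fun i _ => (hRme _).diff (hRme _),
    fun i _ x hx => hRS _ hx.1, fun i _ j _ x hx hx' => ?_, fun i hi => ?_⟩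
  · by_contra hne
    rcases lt_or_gt_of_ne hne with hij | hij
    · exact hx'.2 (hRm (Nat.succ_le_of_lt hij) hx.1)
    · exact hx.2 (hRm (Nat.succ_le_of_lt hij) hx'.1)
  · rw [measure_sdiff (hRm (Nat.le_succ i)) (hRme _).nullMeasurableSet (measure_ne_top _ _),
      hRμ, hRμ, min_eq_left (by omega), min_eq_left hi.le]
    push_cast
    rw [add_mul, one_mul]
    exact ENNReal.add_sub_cancel_left (ENNReal.mul_ne_top (by simp) ht)

lemma IsPieces.append {S S' : Set X} {n n' : ℕ} {t : ℝ≥0∞} {c c' : ℕ → Set X}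
    (h : IsPieces μ S n t c) (h' : IsPieces μ S' n' t c') (hd : Disjoint S S') :
    IsPieces μ (S ∪ S') (n + n') t (concat n c c') where
  meas := fun i hi => by
    rcases lt_or_ge i n with h1 | h1
    · rw [concat_of_lt h1]; exact h.meas i h1
    · rw [concat_of_ge h1]; exact h'.meas _ (by omega)
  sub := fun i hi => by
    rcases lt_or_ge i n with h1 | h1
    · rw [concat_of_lt h1]; exact (h.sub i h1).trans subset_union_left
    · rw [concat_of_ge h1]; exact (h'.sub _ (by omega)).trans subset_union_right
  disj := fun i hi j hj x hx hx' => by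
    rcases lt_or_ge i n with h1 | h1 <;> rcases lt_or_ge j n with h2 | h2
    · rw [concat_of_lt h1] at hx; rw [concat_of_lt h2] at hx'
      exact h.disj i h1 j h2 x hx hx'
    · rw [concat_of_lt h1] at hx; rw [concat_of_ge h2] at hx'
      exact absurd (h'.sub _ (by omega) hx') (Set.disjoint_left.1 hd (h.sub i h1 hx))
    · rw [concat_of_ge h1] at hx; rw [concat_of_lt h2] at hx'
      exact absurd (h'.sub _ (by omega) hx) (Set.disjoint_left.1 hd (h.sub j h2 hx'))
    · rw [concat_of_ge h1] at hx; rw [concat_of_ge h2] at hx'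
      have := h'.disj _ (by omega) _ (by omega) x hx hx'
      omega
  mass := fun i hi => by
    rcases lt_or_ge i n with h1 | h1
    · rw [concat_of_lt h1]; exact h.mass i h1
    · rw [concat_of_ge h1]; exact h'.mass _ (by omega)

lemma measure_sdiff_of_mass [IsFiniteMeasure μ] {S S' : Set X} (hS' : MeasurableSet S')
    (hsub : S' ⊆ S) {a b : ℕ} {t : ℝ≥0∞} (ht : t ≠ ∞) (h : μ S = (a + b : ℕ) * t)
    (h' : μ S' = a * t) : μ (S \ S') = b * t := by
  rw [measure_sdiff hsub hS'.nullMeasurableSet (measure_ne_top _ _), h, h']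
  push_cast
  rw [add_mul]
  exact ENNReal.add_sub_cancel_left (ENNReal.mul_ne_top (by simp) ht)

/-- Cut `B` into pieces of equal mass such that the first two fifths lie in `V`, and `q` consecutive
pieces before the end of the first fifth lie in `U`. -/
lemma exists_isPieces_arranged [StandardBorelSpace X] [IsFiniteMeasure μ] [NullSingletonClass μ]
    {B V U : Set X} (hB : MeasurableSet B) (hV : MeasurableSet V) (hU : MeasurableSet U)
    (hVB : V ⊆ B) (hUV : U ⊆ V) (hVμ : 2 * (μ B / 5) ≤ μ V) (hUμ : μ U ≠ 0) (q : ℕ) :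
    ∃ (m : ℕ) (t : ℝ≥0∞) (c : ℕ → Set X), 0 < m ∧ 4 * q ≤ m ∧ (5 * m : ℕ) * t = μ B ∧ t ≠ ∞ ∧
      IsPieces μ B (5 * m) t c ∧ (∀ k < 2 * m, c k ⊆ V) ∧
      ∀ k, m - q ≤ k → k < m → c k ⊆ U := by
  obtain ⟨m₀, hm₀⟩ := ENNReal.exists_nat_mul_gt hUμ
    (ENNReal.mul_ne_top (ENNReal.natCast_ne_top q) (measure_ne_top μ B))
  -- The summand `4 * q` keeps the pieces in `U` in the last quarter of the first fifth; `m₀` makes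
  -- the pieces so small that `q` of them fit into `U`.
  set m := m₀ + 4 * q + 1 with hm
  set t := μ B / (5 * m : ℕ) with ht
  have h5m : ((5 * m : ℕ) : ℝ≥0∞) ≠ 0 := by simp [hm]
  have htt : t ≠ ∞ := ENNReal.div_ne_top (measure_ne_top _ _) h5m
  have hBt : μ B = (5 * m : ℕ) * t := (ENNReal.mul_div_cancel h5m (ENNReal.natCast_ne_top _)).symm
  have hqU : q * t ≤ μ U := by
    rw [ht, ← mul_div_assoc]
    refine ENNReal.div_le_of_le_mul ?_
    refine hm₀.le.trans ?_
    rw [mul_comm]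
    gcongr
    exact_mod_cast (by omega : m₀ ≤ 5 * m)
  have h2m : (2 * m : ℕ) * t ≤ μ V := by
    refine le_trans (le_of_eq ?_) hVμ
    have : μ B / 5 = m * t := by
      rw [hBt]
      push_cast
      rw [mul_assoc, mul_comm, ENNReal.mul_div_cancel_right (by simp) (by simp)]
    rw [this]; push_cast; ring
  obtain ⟨U', hU'U, hU'm, hU'μ⟩ := exists_subset_measure_eq μ hU hqU
  obtain ⟨G, hU'G, hGV, hGm, hGμ⟩ := exists_measure_eq_between μ hU'm hV (hU'U.trans hUV)
    (t := (2 * m : ℕ) * t) (by rw [hU'μ]; gcongr; omega) h2m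
  have hGU' : μ (G \ U') = (2 * m - q : ℕ) * t := measure_sdiff_of_mass hU'm hU'G htt
    (by rw [hGμ]; congr 2; omega) hU'μ
  obtain ⟨G', hG'G, hG'm, hG'μ⟩ := exists_subset_measure_eq μ (hGm.diff hU'm)
    (t := (m - q : ℕ) * t) (by rw [hGU']; gcongr; omega)
  have hrest : μ ((G \ U') \ G') = m * t := measure_sdiff_of_mass hG'm hG'G htt
    (by rw [hGU']; congr 2; omega) hG'μ
  have hlast : μ (B \ G) = (3 * m : ℕ) * t := measure_sdiff_of_mass hGm (hGV.trans hVB) htt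
    (by rw [hBt]; congr 2; omega) hGμ
  -- The order is: `m - q` pieces of `V`, `q` pieces of `U`, `m` further pieces of `V`, and `3 * m`
  -- pieces of the rest of `B`.
  obtain ⟨c₁, hc₁⟩ := exists_isPieces hG'm htt hG'μ
  obtain ⟨c₂, hc₂⟩ := exists_isPieces hU'm htt hU'μ
  obtain ⟨c₃, hc₃⟩ := exists_isPieces ((hGm.diff hU'm).diff hG'm) htt hrest
  obtain ⟨c₄, hc₄⟩ := exists_isPieces (hB.diff hGm) htt hlast
  have h12 := hc₁.append hc₂ (Set.disjoint_left.2 fun x hx hx' => (hG'G hx).2 hx')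
  have h123 := h12.append hc₃ (Set.disjoint_left.2 fun x hx hx' => by
    rcases hx with hx | hx
    · exact hx'.2 hx
    · exact hx'.1.2 hx)
  have h1234 := h123.append hc₄ (Set.disjoint_left.2 fun x hx hx' => by
    rcases hx with (hx | hx) | hx
    · exact hx'.2 (hG'G hx).1
    · exact hx'.2 (hU'G hx)
    · exact hx'.2 hx.1.1)
  have hnum : m - q + q + m + 3 * m = 5 * m := by omega
  rw [hnum] at h1234
  refine ⟨m, t, _, by omega, by omega, hBt.symm, htt,
    ⟨h1234.meas, fun i hi => (h1234.sub i hi).trans ?_, h1234.disj, h1234.mass⟩, ?_, ?_⟩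
  · rintro x (((hx | hx) | hx) | hx)
    · exact hVB (hGV (hG'G hx).1)
    · exact hVB (hGV (hU'G hx))
    · exact hVB (hGV hx.1.1)
    · exact hx.1
  · intro k hk
    rw [concat_of_lt (by omega)]
    refine (h123.sub k (by omega)).trans ?_
    rintro x ((hx | hx) | hx)
    · exact hGV (hG'G hx).1
    · exact hGV (hU'G hx)
    · exact hGV hx.1.1
  · intro k hk1 hk2
    rw [concat_of_lt (by omega), concat_of_lt (by omega), concat_of_ge hk1]
    exact (hc₂.sub _ (by omega)).trans hU'U

end Tower

/-! ### Stacking columns to produce large Birkhoff sums near `T`. -/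

section Density

variable {X : Type*} [MeasurableSpace X] {μ : Measure X}

/-- The iterates of a measurable equivalence. -/
def iterEquiv (T : X ≃ᵐ X) : ℕ → X ≃ᵐ X
  | 0 => .refl X
  | n + 1 => T.trans (iterEquiv T n)

lemma iterEquiv_apply (T : X ≃ᵐ X) (n : ℕ) (x : X) : iterEquiv T n x = T^[n] x := by
  induction n generalizing x with
  | zero => rfl
  | succ n ih => rw [Function.iterate_succ_apply, ← ih]; rfl

/-- The point at height `n` of the tower of towers over `b`: the columns of height `N` over
`φ 0 b, φ 1 b, …` are stacked. -/
def stackPoint (T : X → X) (N : ℕ) (φ : ℕ → X ≃ᵐ X) (n : ℕ) (b : X) : X :=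
  T^[n % N] (φ (n / N) b)

/-- Stacking equal pieces of the base of a Rokhlin tower of `T` extends to an ergodic
transformation near `T`. -/
lemma exists_ergodic_stack [StandardBorelSpace X] [IsProbabilityMeasure μ] [NullSingletonClass μ]
    (T : X ≃ᵐ X) (hT : MeasurePreserving T μ μ) {N M : ℕ} (hN : 0 < N) (hM : 0 < M) {B : Set X}
    (hd : ∀ i < N, ∀ j < N, ∀ x ∈ B, ∀ y ∈ B, T^[i] x = T^[j] y → i = j) {t : ℝ≥0∞}
    {c : ℕ → Set X} (hc : IsPieces μ B M t c) :
    ∃ (T' : ErgodicAut μ) (φ : ℕ → X ≃ᵐ X) (D : Set X), MeasurableSet D ∧ μ D = t ∧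
      (∀ k < M, ∀ b ∈ D, φ k b ∈ c k) ∧
      μ {x | T'.1 x ≠ T x} ≤ (1 - (N * M : ℕ) * t) + M * t ∧
      (∀ L ≤ N * M, MeasurableSet (⋃ n ∈ Finset.range L, stackPoint T N φ n '' D) ∧
        μ (⋃ n ∈ Finset.range L, stackPoint T N φ n '' D) = L * t) ∧
      ∀ᵐ x ∂μ, ∀ n j b, b ∈ D → n + j < N * M → x = stackPoint T N φ n b →
        T'.1^[j] x = stackPoint T N φ (n + j) b := by
  classical
  have hex : ∀ k, ∃ e : X ≃ᵐ X, MeasurePreserving e μ μ ∧ (k < M → μ (c 0 \ e ⁻¹' c k) = 0) := by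
    intro k
    by_cases hk : k < M
    · obtain ⟨e, h1, h2⟩ := exists_measurePreserving_preimage_ae_eq μ (hc.meas 0 hM) (hc.meas k hk)
        ((hc.mass 0 hM).trans (hc.mass k hk).symm)
      exact ⟨e, h1, fun _ => h2⟩
    · exact ⟨.refl X, .id μ, fun h => absurd h hk⟩
  choose φ₀ hφ₀ hφ₀c using hex
  -- The root of a cluster is its own point of level `0`, so the map for `k = 0` must be the
  -- identity.
  let φ : ℕ → X ≃ᵐ X := fun k => if k = 0 then .refl X else φ₀ k
  have hφ : ∀ k, MeasurePreserving (φ k) μ μ := by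
    intro k
    by_cases hk : k = 0
    · simp only [φ, hk, if_true]; exact .id μ
    · simp only [φ, hk, if_false]; exact hφ₀ k
  have hφc : ∀ k < M, μ (c 0 \ φ k ⁻¹' c k) = 0 := by
    intro k hkM
    by_cases hk : k = 0
    · subst hk
      have : c 0 \ φ 0 ⁻¹' c 0 = ∅ := by
        ext x; simp [φ]
      rw [this, measure_empty]
    · simp only [φ, hk, if_false]; exact hφ₀c k hkM
  let D : Set X := c 0 ∩ ⋂ k ∈ Finset.range M, φ k ⁻¹' c k
  have hDm : MeasurableSet D := (hc.meas 0 hM).inter (Finset.measurableSet_biInter _ fun k hk =>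
    (φ k).measurable (hc.meas k (Finset.mem_range.1 hk)))
  have hDc : ∀ k < M, ∀ b ∈ D, φ k b ∈ c k := fun k hk b hb =>
    mem_iInter₂.1 hb.2 k (Finset.mem_range.2 hk)
  have hDμ : μ D = t := by
    rw [← hc.mass 0 hM]
    refine le_antisymm (measure_mono inter_subset_left) ?_
    have h1 : μ (c 0 \ D) = 0 := by
      refine measure_mono_null (t := ⋃ k ∈ Finset.range M, c 0 \ φ k ⁻¹' c k) (fun x hx => ?_)
        ((measure_biUnion_null_iff (Finset.countable_toSet _)).2 fun k hk =>
          hφc k (by simpa using hk))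
      by_contra hcon
      simp only [mem_iUnion, not_exists] at hcon
      refine hx.2 ⟨hx.1, mem_iInter₂.2 fun k hk => ?_⟩
      by_contra h
      exact hcon k hk ⟨hx.1, h⟩
    calc μ (c 0) ≤ μ (D ∪ (c 0 \ D)) := measure_mono fun x hx => by
          by_cases h : x ∈ D
          · exact Or.inl h
          · exact Or.inr ⟨hx, h⟩
      _ ≤ μ D + μ (c 0 \ D) := measure_union_le _ _
      _ = μ D := by rw [h1, add_zero]
  let ψ : ℕ → X ≃ᵐ X := fun n => (φ (n / N)).trans (iterEquiv T (n % N))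
  have hψ : ∀ n x, ψ n x = stackPoint T N φ n x := fun n x => iterEquiv_apply T _ _
  have hψmp : ∀ n, MeasurePreserving (ψ n) μ μ := by
    intro n
    have h1 : (ψ n : X → X) = T^[n % N] ∘ φ (n / N) := funext fun x => hψ n x
    rw [h1]
    exact (hT.iterate _).comp (hφ _)
  have hdiv : ∀ n < N * M, n / N < M := fun n hn => Nat.div_lt_of_lt_mul hn
  have hψinj : ∀ n < N * M, ∀ m < N * M, ∀ x ∈ D, ∀ y ∈ D, ψ n x = ψ m y → n = m := by
    intro n hn m hm x hx y hy hxy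
    rw [hψ, hψ, stackPoint, stackPoint] at hxy
    have h1 := hDc _ (hdiv n hn) x hx
    have h2 := hDc _ (hdiv m hm) y hy
    have h3 := hd _ (Nat.mod_lt n hN) _ (Nat.mod_lt m hN) _ (hc.sub _ (hdiv n hn) h1) _
      (hc.sub _ (hdiv m hm) h2) hxy
    rw [h3] at hxy
    have h4 := T.injective.iterate _ hxy
    have h5 := hc.disj _ (hdiv n hn) _ (hdiv m hm) _ h1 (h4 ▸ h2)
    rw [← Nat.div_add_mod n N, ← Nat.div_add_mod m N, h3, h5]
  let s : Star μ :=
    { φ := ψ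
      D := fun l => if l < N * M then D else ∅
      mp := hψmp
      zero := fun x => by rw [hψ]; simp [stackPoint, φ]
      meas := fun l => by split_ifs <;> simp [hDm]
      anti := fun l x hx => by
        by_cases h1 : l + 1 < N * M
        · rw [if_pos h1] at hx
          rwa [if_pos (by omega)]
        · rw [if_neg h1] at hx
          exact absurd hx (notMem_empty x)
      fin := fun x => ⟨N * M, by simp⟩
      disj := fun l l' x y hx hy hxy => by
        by_cases h1 : l < N * M
        · by_cases h2 : l' < N * M
          · rw [if_pos h1] at hx
            rw [if_pos h2] at hy
            exact hψinj l h1 l' h2 x hx y hy hxy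
          · rw [if_neg h2] at hy
            exact absurd hy (notMem_empty y)
        · rw [if_neg h1] at hx
          exact absurd hx (notMem_empty x) }
  have hsD : ∀ l < N * M, s.D l = D := fun l hl => if_pos hl
  have hsD' : ∀ l x, x ∈ s.D l → l < N * M ∧ x ∈ D := by
    intro l x hx
    by_cases h1 : l < N * M
    · exact ⟨h1, hsD l h1 ▸ hx⟩
    · have : s.D l = ∅ := if_neg h1
      rw [this] at hx
      exact absurd hx (notMem_empty x)
  let c₀ : Columns μ (fun _ : X => (0 : ℝ)) :=
    (Columns.trivial measurable_const).step s (subset_univ _)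
  -- The coboundary construction for the zero function, whose column sums are zero, completes the
  -- stack to an ergodic transformation. The transfer function is discarded.
  obtain ⟨T', g, -, hT'⟩ := exists_ergodic_of_columns (μ := μ) (f := fun _ => 0) measurable_const
    (Y := fun _ => univ) (fun _ => .univ) (fun _ _ _ => Subset.rfl)
    (by rw [iUnion_const, compl_univ, measure_empty])
    (fun _ => ⟨0, by simp⟩) (fun _ => by simp) c₀
    { sat := fun x => Iff.rfl
      off_B := fun x hx => absurd (mem_univ x) hx
      off_u := fun x hx => absurd (mem_univ x) hx
      small := Eventually.of_forall fun x _ => by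
        have : c₀.u x = 0 := by
          show s.total (fun _ => 0) x = 0
          simp [Star.total, Star.psum]
        rw [this]; simp }
  have hstep : ∀ᵐ x ∂μ, ∀ n b, b ∈ D → n + 1 < N * M → x = ψ n b → T'.1 x = ψ (n + 1) b := by
    filter_upwards [hT'] with x hx n b hb hn hxn
    have hb1 : b ∈ s.D (n + 1) := by rw [hsD _ hn]; exact hb
    have hperm : c₀.Θ x = ψ (n + 1) b := by
      rw [hxn]
      exact s.perm_φ hb1
    rw [← hperm]
    refine hx ?_
    rw [hperm]
    rintro (h | h)
    · exact h.2 (s.mem_C hb1)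
    · have := s.disj _ 0 _ _ hb1 h (by rw [s.zero])
      omega
  have himg : ∀ n, stackPoint T N φ n '' D = (ψ n).symm ⁻¹' D := by
    intro n
    rw [← (ψ n).image_eq_preimage_symm]
    exact image_congr fun x _ => (hψ n x).symm
  have himgm : ∀ n, MeasurableSet (stackPoint T N φ n '' D) := fun n => by
    rw [himg]; exact (ψ n).symm.measurable hDm
  have himgμ : ∀ n, μ (stackPoint T N φ n '' D) = t := fun n => by
    rw [himg, (MeasurePreserving.symm (ψ n) (hψmp n)).measure_preimage hDm.nullMeasurableSet, hDμ]
  have hunion : ∀ L ≤ N * M, MeasurableSet (⋃ n ∈ Finset.range L, stackPoint T N φ n '' D) ∧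
      μ (⋃ n ∈ Finset.range L, stackPoint T N φ n '' D) = L * t := by
    intro L hL
    refine ⟨Finset.measurableSet_biUnion _ fun n _ => himgm n, ?_⟩
    rw [measure_biUnion_finset]
    · simp [himgμ]
    · intro i hi j hj hij
      have hi : i < L := by simpa using hi
      have hj : j < L := by simpa using hj
      refine Set.disjoint_left.2 ?_
      rintro _ ⟨x, hx, rfl⟩ ⟨y, hy, hxy⟩
      refine hij (hψinj i (by omega) j (by omega) x hx y hy ?_)
      rw [hψ, hψ, hxy]
    · exact fun n _ => himgm n
  refine ⟨T', φ, D, hDm, hDμ, hDc, ?_, hunion, ?_⟩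
  · have hU := hunion (N * M) le_rfl
    -- Within the stack `T'` can differ from `T` only at the top level `N - 1` of one of the `M`
    -- concatenated columns, where it passes to the next column.
    have hlast : μ (⋃ k ∈ Finset.range M, stackPoint T N φ (N * k + (N - 1)) '' D) ≤ M * t := by
      refine (measure_biUnion_finset_le _ _).trans ?_
      simp [himgμ]
    calc μ {x | T'.1 x ≠ T x} ≤ μ ((⋃ n ∈ Finset.range (N * M), stackPoint T N φ n '' D)ᶜ ∪
          ⋃ k ∈ Finset.range M, stackPoint T N φ (N * k + (N - 1)) '' D) := by
          refine measure_mono_ae ?_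
          filter_upwards [hstep] with x hx hne
          by_contra hcon
          refine hne ?_
          have h1 : x ∈ ⋃ n ∈ Finset.range (N * M), stackPoint T N φ n '' D := by
            by_contra h; exact hcon (Or.inl h)
          obtain ⟨n, hn, b, hb, rfl⟩ := mem_iUnion₂.1 h1
          have hn := Finset.mem_range.1 hn
          have hmod : n % N + 1 < N := by
            by_contra hge
            refine hcon (Or.inr (mem_iUnion₂.2 ⟨n / N, Finset.mem_range.2 (hdiv n hn), b, hb, ?_⟩))
            have := Nat.mod_lt n hN
            have := Nat.div_add_mod n N
            congr 1
            omega
          have hn1 : n + 1 = N * (n / N) + (n % N + 1) := by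
            have := Nat.div_add_mod n N; omega
          have hlt : n + 1 < N * M := by
            have h2 := hdiv n hn
            have h3 : N * (n / N + 1) ≤ N * M := Nat.mul_le_mul_left N h2
            rw [hn1]; rw [Nat.mul_add] at h3; omega
          rw [hx n b hb hlt (hψ n b).symm, hψ, stackPoint, stackPoint]
          have hd1 : (n + 1) / N = n / N := by
            rw [hn1, Nat.mul_add_div hN, Nat.div_eq_of_lt hmod, add_zero]
          have hd2 : (n + 1) % N = n % N + 1 := by
            conv_lhs => rw [hn1]
            rw [Nat.mul_add_mod, Nat.mod_eq_of_lt hmod]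
          rw [hd1, hd2, Function.iterate_succ_apply']
      _ ≤ μ (⋃ n ∈ Finset.range (N * M), stackPoint T N φ n '' D)ᶜ +
          μ (⋃ k ∈ Finset.range M, stackPoint T N φ (N * k + (N - 1)) '' D) := measure_union_le _ _
      _ ≤ _ := by
          rw [prob_compl_eq_one_sub hU.1, hU.2]
          gcongr
  · have hall : ∀ᵐ x ∂μ, ∀ j, ∀ n b, b ∈ D → n + 1 < N * M → T'.1^[j] x = ψ n b →
        T'.1 (T'.1^[j] x) = ψ (n + 1) b := by
      refine ae_all_iff.2 fun j => ?_
      exact (T'.2.toMeasurePreserving.iterate j).quasiMeasurePreserving.ae hstep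
    filter_upwards [hall] with x hx n j b hb hnj hxn
    induction j with
    | zero => simpa using hxn
    | succ j ih =>
      rw [Function.iterate_succ_apply', hx j (n + j) b hb (by omega)
        ((ih (by omega)).trans (hψ _ _).symm), hψ]
      rfl

/-- The lowest `N * k + i` levels are `k` complete columns and the first `i` levels of the next one.
-/
lemma sum_stackPoint {T : X → X} {N : ℕ} (hN : 0 < N) (φ : ℕ → X ≃ᵐ X) (f : X → ℝ) (b : X)
    (k : ℕ) {i : ℕ} (hi : i ≤ N) :
    ∑ l ∈ Finset.range (N * k + i), f (stackPoint T N φ l b) =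
      ∑ j ∈ Finset.range k, birkhoffSum T f N (φ j b) + birkhoffSum T f i (φ k b) := by
  have hcol : ∀ k, ∀ i ≤ N, ∑ l ∈ Finset.range i, f (stackPoint T N φ (N * k + l) b) =
      birkhoffSum T f i (φ k b) := by
    intro k i hi
    refine Finset.sum_congr rfl fun l hl => ?_
    have hl : l < N := (Finset.mem_range.1 hl).trans_le hi
    rw [stackPoint, Nat.mul_add_div hN, Nat.mul_add_mod, Nat.mod_eq_of_lt hl,
      Nat.div_eq_of_lt hl, add_zero]
  rw [Finset.sum_range_add, hcol k i hi]
  congr 1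
  induction k with
  | zero => simp
  | succ k ih => rw [Nat.mul_succ, Finset.sum_range_add, hcol k N le_rfl, ih, Finset.sum_range_succ]

/-- Near `T` there are ergodic transformations with large Birkhoff sums. -/
lemma exists_near_birkhoffSum_large [StandardBorelSpace X] [IsProbabilityMeasure μ]
    [NullSingletonClass μ] (T : X ≃ᵐ X) (hT : MeasurePreserving T μ μ) {f : X → ℝ}
    {N : ℕ} (hN : 0 < N) {B V U : Set X} (hB : MeasurableSet B) (hV : MeasurableSet V)
    (hU : MeasurableSet U) (hVB : V ⊆ B) (hUV : U ⊆ V)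
    (hd : ∀ i < N, ∀ j < N, ∀ x ∈ B, ∀ y ∈ B, T^[i] x = T^[j] y → i = j)
    (hVμ : 2 * (μ B / 5) ≤ μ V) (hUμ : μ U ≠ 0) {a W : ℝ} (ha : 0 < a)
    (hV0 : ∀ x ∈ V, 0 ≤ birkhoffSum T f N x) (hU0 : ∀ x ∈ U, a ≤ birkhoffSum T f N x)
    (hVW : ∀ x ∈ V, ∀ i ≤ N, |birkhoffSum T f i x| ≤ W) (hNB : 5 / 6 < N * μ.real B) (K : ℝ) :
    ∃ T' : ErgodicAut μ, μ {x | T'.1 x ≠ T x} ≤ (1 - N * μ B) + μ B ∧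
      ∃ n, 1 / 8 < μ.real {x | K < birkhoffSum T'.1 f n x} := by
  -- The `q` columns over `U` contribute at least `q * a`; this must exceed `K` and the `2 * W` lost
  -- to the incomplete columns at both ends of the orbit segment.
  obtain ⟨q, hq⟩ := exists_nat_gt ((K + 2 * W) / a)
  rw [div_lt_iff₀ ha] at hq
  obtain ⟨m, t, c, hm, hqm, hmt, ht, hc, hcV, hcU⟩ := exists_isPieces_arranged hB hV hU hVB hUV
    hVμ hUμ q
  obtain ⟨T', φ, D, hDm, hDμ, hDc, hnear, hunion, hpath⟩ := exists_ergodic_stack T hT hN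
    (M := 5 * m) (by omega) hd hc
  refine ⟨T', ?_, N * m, ?_⟩
  · rw [Nat.cast_mul, mul_assoc, hmt] at hnear
    exact hnear
  have hL : N * (m - q) ≤ N * (5 * m) := Nat.mul_le_mul_left N (by omega)
  obtain ⟨hGm, hGμ⟩ := hunion _ hL
  -- An orbit segment of length `N * m` that starts below column `m - q` runs through all `q`
  -- columns over `U` and stays within the first `2 * m` columns, which lie over `V`.
  set G := ⋃ n ∈ Finset.range (N * (m - q)), stackPoint T N φ n '' D with hG
  have hsub : μ.real G ≤ μ.real {x | K < birkhoffSum T'.1 f (N * m) x} := by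
    refine ENNReal.toReal_mono (measure_ne_top _ _) (measure_mono_ae ?_)
    filter_upwards [hpath] with x hx hxG
    obtain ⟨n, hn, b, hb, hxb⟩ := mem_iUnion₂.1 hxG
    have hn := Finset.mem_range.1 hn
    obtain ⟨k, i, hk, hi, hnk⟩ : ∃ k i, k < m - q ∧ i < N ∧ n = N * k + i :=
      ⟨n / N, n % N, Nat.div_lt_of_lt_mul hn, Nat.mod_lt n hN, (Nat.div_add_mod n N).symm⟩
    have hn5 : n + N * m ≤ N * (5 * m) := by
      have h1 : N * (m - q) + N * m ≤ N * (5 * m) := by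
        rw [← Nat.mul_add]; exact Nat.mul_le_mul_left N (by omega)
      omega
    have h1 : birkhoffSum T'.1 f (N * m) x =
        ∑ l ∈ Finset.range (N * m), f (stackPoint T N φ (n + l) b) := by
      refine Finset.sum_congr rfl fun l hl => ?_
      rw [hx n l b hb (by have := Finset.mem_range.1 hl; omega) hxb.symm]
    have h2 : ∑ l ∈ Finset.range (n + N * m), f (stackPoint T N φ l b) =
        ∑ j ∈ Finset.range (k + m), birkhoffSum T f N (φ j b) + birkhoffSum T f i (φ (k + m) b) := by
      rw [← sum_stackPoint hN φ f b (k + m) hi.le]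
      congr 2
      rw [hnk]; ring
    have h3 := sum_stackPoint (T := T) hN φ f b k hi.le
    rw [← hnk] at h3
    rw [Finset.sum_range_add, h3, Finset.sum_range_add] at h2
    have hφV : ∀ j < 2 * m, φ j b ∈ V := fun j hj => hcV j hj (hDc j (by omega) b hb)
    have h4 := abs_le.1 (hVW _ (hφV k (by omega)) i hi.le)
    have h5 := abs_le.1 (hVW _ (hφV (k + m) (by omega)) i hi.le)
    have h6 : q * a ≤ ∑ l ∈ Finset.range m, birkhoffSum T f N (φ (k + l) b) := by
      calc q * a = ∑ l ∈ Finset.Ico (m - q - k) (m - k), a := by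
            rw [Finset.sum_const, Nat.card_Ico, nsmul_eq_mul]
            congr 2; omega
        _ ≤ ∑ l ∈ Finset.Ico (m - q - k) (m - k), birkhoffSum T f N (φ (k + l) b) := by
            refine Finset.sum_le_sum fun l hl => ?_
            have hl := Finset.mem_Ico.1 hl
            exact hU0 _ (hcU (k + l) (by omega) (by omega) (hDc _ (by omega) b hb))
        _ ≤ _ := by
            refine Finset.sum_le_sum_of_subset_of_nonneg (fun l hl => ?_) fun l hl _ => ?_
            · have hl := Finset.mem_Ico.1 hl
              exact Finset.mem_range.2 (by omega)
            · have hl := Finset.mem_range.1 hl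
              exact hV0 _ (hφV _ (by omega))
    show K < birkhoffSum T'.1 f (N * m) x
    rw [h1]
    linarith
  refine lt_of_lt_of_le ?_ hsub
  have h1 : μ.real G = (N * (m - q : ℕ) : ℝ) * t.toReal := by
    rw [Measure.real, hGμ, ENNReal.toReal_mul, ENNReal.toReal_natCast, Nat.cast_mul]
  have h2 : μ.real B = 5 * m * t.toReal := by
    rw [Measure.real, ← hmt, ENNReal.toReal_mul, ENNReal.toReal_natCast]; push_cast; rfl
  -- The measure of `G` is at least `3 / 4 * (1 / 5) * (N * μ.real B)`, and `N * μ.real B > 5 / 6`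
  -- makes this larger than `1 / 8`.
  have h3 : (3 : ℝ) / 4 * m ≤ (m - q : ℕ) := by
    have h4 : (4 * q : ℝ) ≤ m := by exact_mod_cast hqm
    rw [Nat.cast_sub (by omega)]; linarith
  rw [h1]
  have h5 : (0 : ℝ) ≤ N * t.toReal := by positivity
  have h6 := mul_le_mul_of_nonneg_left h3 h5
  rw [h2] at hNB
  nlinarith

end Density

/-! ### Density of transformations with large Birkhoff sums. -/

lemma birkhoffSum_neg_apply {X : Type*} (T : X → X) (f : X → ℝ) (n : ℕ) (x : X) :
    birkhoffSum T (fun y => -f y) n x = -birkhoffSum T f n x := by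
  simp [birkhoffSum]

section NearLarge

variable {X : Type*} [MeasurableSpace X] {μ : Measure X}

lemma measurable_birkhoffSum {T : X → X} (hT : Measurable T) {f : X → ℝ} (hf : Measurable f)
    (n : ℕ) : Measurable (birkhoffSum T f n) := by
  have : birkhoffSum T f n = fun x => ∑ i ∈ Finset.range n, f (T^[i] x) := rfl
  rw [this]
  exact Finset.measurable_sum _ fun i _ => hf.comp (hT.iterate i)

/-- The column sum is bounded below by some `1 / (r + 1)` on a part of `B` of positive measure. All
partial sums are bounded by `W` off a small set, and for large `W` the set where the column sum is
nonnegative still keeps more than two fifths of `B`. -/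
lemma exists_near_of_tower [StandardBorelSpace X] [IsProbabilityMeasure μ]
    [NullSingletonClass μ] (T : X ≃ᵐ X) (hT : MeasurePreserving T μ μ) {f : X → ℝ}
    (hf : Measurable f) {N : ℕ} (hN : 0 < N) {B : Set X} (hB : MeasurableSet B)
    (hd : ∀ i < N, ∀ j < N, ∀ x ∈ B, ∀ y ∈ B, T^[i] x = T^[j] y → i = j)
    (hNB : 5 / 6 < N * μ.real B) (hpos : μ (B ∩ {x | 0 < birkhoffSum T f N x}) ≠ 0)
    (hhalf : μ B / 2 ≤ μ (B ∩ {x | 0 ≤ birkhoffSum T f N x})) (K : ℝ) :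
    ∃ T' : ErgodicAut μ, μ {x | T'.1 x ≠ T x} ≤ (1 - N * μ B) + μ B ∧
      ∃ n, 1 / 8 < μ.real {x | K < birkhoffSum T'.1 f n x} := by
  set u := birkhoffSum T f N with hu
  have hS : ∀ i, Measurable (birkhoffSum T f i) := measurable_birkhoffSum T.measurable hf
  have hum : Measurable u := hS N
  have hB0 : μ B ≠ 0 := fun h => hpos (measure_mono_null inter_subset_left h)
  obtain ⟨r, hr⟩ : ∃ r : ℕ, μ (B ∩ {x | 1 / ((r : ℝ) + 1) ≤ u x}) ≠ 0 := by
    by_contra! h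
    refine hpos (measure_mono_null (fun x hx => ?_) (measure_iUnion_null h))
    obtain ⟨r, hr⟩ := exists_nat_one_div_lt (show 0 < u x from hx.2)
    exact mem_iUnion.2 ⟨r, hx.1, hr.le⟩
  set a : ℝ := 1 / ((r : ℝ) + 1) with ha
  have ha0 : 0 < a := by positivity
  let Q : ℕ → Set X := fun W => {x | ∀ i ≤ N, |birkhoffSum T f i x| ≤ W}
  have hQm : ∀ W, MeasurableSet (Q W) := by
    intro W
    have : Q W = ⋂ i, ⋂ (_ : i ≤ N), {x | |birkhoffSum T f i x| ≤ W} := by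
      ext x; simp [Q]
    rw [this]
    exact .iInter fun i => .iInter fun _ => measurableSet_le (hS i).abs measurable_const
  have hQmono : Monotone Q := fun W W' h x hx i hi => (hx i hi).trans (by exact_mod_cast h)
  have hQU : ⋃ W, Q W = univ := by
    ext x
    simp only [mem_iUnion, mem_univ, iff_true]
    obtain ⟨W, hW⟩ := exists_nat_ge (∑ i ∈ Finset.range (N + 1), |birkhoffSum T f i x|)
    refine ⟨W, fun i hi => le_trans ?_ hW⟩
    exact Finset.single_le_sum (f := fun i => |birkhoffSum T f i x|) (fun i _ => abs_nonneg _)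
      (Finset.mem_range.2 (by omega))
  have hlim : ∀ S : Set X, Tendsto (fun W => μ (S ∩ Q W)) atTop (𝓝 (μ S)) := by
    intro S
    have h1 := tendsto_measure_iUnion_atTop (μ := μ) (s := fun W => S ∩ Q W)
      (fun W W' h => inter_subset_inter_right S (hQmono h))
    rwa [← inter_iUnion, hQU, inter_univ] at h1
  have hlt : 2 * (μ B / 5) < μ (B ∩ {x | 0 ≤ u x}) := by
    refine lt_of_lt_of_le ?_ hhalf
    have hBt : μ B ≠ ∞ := measure_ne_top _ _
    rw [← ENNReal.toReal_lt_toReal (ENNReal.mul_ne_top (by simp) (ENNReal.div_ne_top hBt (by simp)))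
      (ENNReal.div_ne_top hBt (by simp))]
    have := ENNReal.toReal_pos hB0 hBt
    rw [ENNReal.toReal_mul, ENNReal.toReal_div, ENNReal.toReal_div]
    simp only [ENNReal.toReal_ofNat]
    linarith
  obtain ⟨W, hW1, hW2⟩ := (((hlim _).eventually (lt_mem_nhds hlt)).and
    ((hlim _).eventually (lt_mem_nhds (pos_iff_ne_zero.2 hr)))).exists
  refine exists_near_birkhoffSum_large T hT hN hB (V := B ∩ {x | 0 ≤ u x} ∩ Q W)
    (U := B ∩ {x | a ≤ u x} ∩ Q W) (W := W) (a := a)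
    ((hB.inter (measurableSet_le measurable_const hum)).inter (hQm W))
    ((hB.inter (measurableSet_le measurable_const hum)).inter (hQm W))
    (fun x hx => hx.1.1) (fun x hx => ⟨⟨hx.1.1, ha0.le.trans hx.1.2⟩, hx.2⟩) hd hW1.le hW2.ne' ha0
    (fun x hx => hx.1.2) (fun x hx => hx.1.2) (fun x hx => hx.2) hNB K

/-- The transformations with large Birkhoff sums are dense in the uniform topology. -/
lemma exists_near_abs_birkhoffSum_large [StandardBorelSpace X] [IsProbabilityMeasure μ]
    [NullSingletonClass μ] (T : ErgodicAut μ) {f : X → ℝ} (hf : Measurable f)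
    (hf0 : μ {x | f x ≠ 0} ≠ 0) {ε : ℝ≥0∞} (hε : ε ≠ 0) (K : ℝ) :
    ∃ T' : ErgodicAut μ, μ {x | T'.1 x ≠ T.1 x} < ε ∧
      ∃ n, 1 / 8 < μ.real {x | K < |birkhoffSum T'.1 f n x|} := by
  obtain ⟨δ, hδ0, hδ⟩ := exists_between (pos_iff_ne_zero.2 hε)
  obtain ⟨N₀, hN₀⟩ := ENNReal.exists_inv_nat_lt (ENNReal.half_pos hδ0.ne').ne'
  obtain ⟨N, hN, B, hB, hd, h1, h2, h3⟩ := exists_tower_birkhoffSum_ne_zero T.1 T.2 hf hf0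
    -- Half of `δ` is for the points missed by the tower, the other half for the tops of the
    -- columns, and `1 - 1 / 7 > 5 / 6`.
    (N₀ := N₀ + 1) (by omega) (ε := min (δ / 2) (1 / 7))
    (lt_min (ENNReal.half_pos hδ0.ne') (by simp)).ne'
  have hN0 : 0 < N := by omega
  have hnear : 1 - N * μ B + μ B < ε := by
    have e1 : 1 - N * μ B ≤ δ / 2 :=
      tsub_le_iff_left.2 (h1.trans (by gcongr; exact min_le_left _ _))
    have e2 : μ B ≤ δ / 2 := by
      refine le_trans ?_ hN₀.le
      rw [ENNReal.le_inv_iff_mul_le, mul_comm]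
      refine le_trans ?_ h2
      gcongr
      omega
    calc 1 - N * μ B + μ B ≤ δ / 2 + δ / 2 := add_le_add e1 e2
      _ = δ := ENNReal.add_halves δ
      _ < ε := hδ
  have hNB : 5 / 6 < N * μ.real B := by
    have e1 : (1 : ℝ≥0∞) ≤ N * μ B + 1 / 7 := h1.trans (by gcongr; exact min_le_right _ _)
    have e2 := ENNReal.toReal_mono (by
      refine ENNReal.add_ne_top.2 ⟨ENNReal.mul_ne_top (by simp) (measure_ne_top _ _), by simp⟩) e1
    rw [ENNReal.toReal_add (ENNReal.mul_ne_top (by simp) (measure_ne_top _ _)) (by simp),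
      ENNReal.toReal_mul, ENNReal.toReal_div] at e2
    simp only [ENNReal.toReal_one, ENNReal.toReal_natCast, ENNReal.toReal_ofNat] at e2
    change 1 ≤ N * μ.real B + 1 / 7 at e2
    linarith
  have hm := measurable_birkhoffSum T.1.measurable hf N
  have hsplit : ∀ v : X → ℝ, Measurable v → (μ B / 2 ≤ μ (B ∩ {x | 0 ≤ v x}) ∨
      μ B / 2 ≤ μ (B ∩ {x | 0 < -v x})) := by
    intro v hv
    by_contra! h
    have e1 : μ B ≤ μ (B ∩ {x | 0 ≤ v x}) + μ (B ∩ {x | 0 < -v x}) := by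
      refine le_trans (measure_mono fun x hx => ?_) (measure_union_le _ _)
      rcases le_or_gt 0 (v x) with h' | h'
      · exact Or.inl ⟨hx, h'⟩
      · exact Or.inr ⟨hx, show 0 < -v x by linarith⟩
    have e2 := e1.trans_lt (ENNReal.add_lt_add h.1 h.2)
    rw [ENNReal.add_halves] at e2
    exact lt_irrefl _ e2
  have main : ∀ h : X → ℝ, Measurable h →
      μ (B ∩ {x | 0 < birkhoffSum T.1 h N x}) ≠ 0 →
      μ B / 2 ≤ μ (B ∩ {x | 0 ≤ birkhoffSum T.1 h N x}) →
      (∀ T' n x, |birkhoffSum T' h n x| = |birkhoffSum T' f n x|) →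
      ∃ T' : ErgodicAut μ, μ {x | T'.1 x ≠ T.1 x} < ε ∧
        ∃ n, 1 / 8 < μ.real {x | K < |birkhoffSum T'.1 f n x|} := by
    intro h hh e1 e2 habs
    obtain ⟨T', t1, n, t2⟩ := exists_near_of_tower T.1 T.2.toMeasurePreserving hh hN0 hB hd hNB
      e1 e2 K
    refine ⟨T', t1.trans_lt hnear, n, t2.trans_le (measureReal_mono fun x hx => ?_)⟩
    show K < |birkhoffSum T'.1 f n x|
    rw [← habs]
    exact lt_of_lt_of_le hx (le_abs_self _)
  have hneg : ∀ x, birkhoffSum T.1 (fun y => -f y) N x = -birkhoffSum T.1 f N x :=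
    birkhoffSum_neg_apply _ f N
  have habs : ∀ (T' : X → X) n x, |birkhoffSum T' (fun y => -f y) n x| = |birkhoffSum T' f n x| :=
    fun T' n x => by rw [birkhoffSum_neg_apply, abs_neg]
  have hor : μ (B ∩ {x | 0 < birkhoffSum T.1 f N x}) ≠ 0 ∨
      μ (B ∩ {x | 0 < birkhoffSum T.1 (fun y => -f y) N x}) ≠ 0 := by
    by_contra! h
    refine h3 (measure_mono_null (fun x hx => ?_) (measure_union_null h.1 h.2))
    have hx2 : birkhoffSum T.1 f N x ≠ 0 := hx.2
    rcases lt_or_gt_of_ne hx2 with h' | h'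
    · exact Or.inr ⟨hx.1, by rw [mem_ofPred_eq, hneg]; linarith⟩
    · exact Or.inl ⟨hx.1, h'⟩
  have hB2 : μ B / 2 ≠ 0 := by
    intro h0
    have : μ B = 0 := by simpa using h0
    exact h3 (measure_mono_null inter_subset_left this)
  -- The sign of `f` is chosen so that the column sum is nonnegative on half of the base and
  -- positive somewhere. If it is nonnegative on half but almost nowhere positive, `-f` serves, with
  -- column sum nonnegative almost everywhere on the base.
  rcases hsplit _ hm with hs | hs
  · by_cases hp : μ (B ∩ {x | 0 < birkhoffSum T.1 f N x}) = 0
    · refine main _ hf.neg (hor.resolve_left (not_not.2 hp)) ?_ habs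
      refine ENNReal.half_le_self.trans ?_
      have hae : ∀ᵐ x ∂μ, x ∉ B ∩ {x | 0 < birkhoffSum T.1 f N x} :=
        measure_eq_zero_iff_ae_notMem.1 hp
      refine measure_mono_ae ?_
      filter_upwards [hae] with x hx hxB
      refine ⟨hxB, ?_⟩
      show 0 ≤ birkhoffSum T.1 (fun y => -f y) N x
      rw [hneg]
      by_contra! hlt
      exact hx ⟨hxB, show 0 < birkhoffSum T.1 f N x by linarith⟩
    · exact main f hf hp hs fun _ _ _ => rfl
  · have heq : {x | 0 < birkhoffSum T.1 (fun y => -f y) N x} =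
        {x | 0 < -birkhoffSum T.1 f N x} := by
      ext x; simp only [mem_ofPred_eq, hneg]
    refine main _ hf.neg ?_ ?_ habs
    · show μ (B ∩ {x | 0 < birkhoffSum T.1 (fun y => -f y) N x}) ≠ 0
      rw [heq]
      exact ne_of_gt ((pos_iff_ne_zero.2 hB2).trans_le hs)
    · refine hs.trans (measure_mono fun x hx => ⟨hx.1, ?_⟩)
      show 0 ≤ birkhoffSum T.1 (fun y => -f y) N x
      rw [hneg]
      exact le_of_lt hx.2

end NearLarge

/-! ### Continuity of Birkhoff sums in the weak topology. -/

section WeakContinuity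

variable {X : Type*} [MeasurableSpace X] {μ : Measure X}

attribute [local instance] ErgodicAut.weakTopology

lemma tendsto_measure_image_symmDiff (T : ErgodicAut μ) {C : Set X} (hC : MeasurableSet C) :
    Tendsto (fun T' : ErgodicAut μ => μ ((T'.1 '' C) ∆ (T.1 '' C))) (𝓝 T) (𝓝 0) := by
  rw [ENNReal.tendsto_nhds_zero]
  intro ε hε
  have ho : IsOpen {T' : ErgodicAut μ | μ ((T'.1 '' C) ∆ (T.1 '' C)) < ε} :=
    .basic _ ⟨T, C, ε, hC, hε, rfl⟩
  filter_upwards [ho.mem_nhds (by simpa using hε)] with T' hT'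
  exact le_of_lt hT'

/-- The topology is defined by images. Since `T'` preserves `μ`, the preimages of `B` under `T'` and
`T` differ by as much as the images of `T⁻¹ B`. Iterates follow by induction and the triangle
inequality. -/
lemma tendsto_measure_preimage_iterate_symmDiff (T : ErgodicAut μ) (i : ℕ) {A : Set X}
    (hA : MeasurableSet A) :
    Tendsto (fun T' : ErgodicAut μ => μ ((T'.1^[i] ⁻¹' A) ∆ (T.1^[i] ⁻¹' A))) (𝓝 T) (𝓝 0) := by
  have hone : ∀ {B : Set X}, MeasurableSet B →
      Tendsto (fun T' : ErgodicAut μ => μ ((T'.1 ⁻¹' B) ∆ (T.1 ⁻¹' B))) (𝓝 T) (𝓝 0) := by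
    intro B hB
    refine (tendsto_measure_image_symmDiff T (T.1.measurable hB)).congr fun T' => ?_
    have hm : MeasurableSet ((T'.1 '' (T.1 ⁻¹' B)) ∆ (T.1 '' (T.1 ⁻¹' B))) :=
      (T'.1.measurableSet_image.2 (T.1.measurable hB)).symmDiff
        (T.1.measurableSet_image.2 (T.1.measurable hB))
    rw [← T'.2.measure_preimage hm.nullMeasurableSet, image_preimage_eq _ T.1.surjective,
      preimage_symmDiff, preimage_image_eq _ T'.1.injective, symmDiff_comm]
  induction i with
  | zero => simp
  | succ i ih =>
    have hB : MeasurableSet (T.1^[i] ⁻¹' A) := T.1.measurable.iterate i hA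
    refine tendsto_of_tendsto_of_tendsto_of_le_of_le tendsto_const_nhds
      (by simpa using ih.add (hone hB)) (fun _ => zero_le) fun T' => ?_
    refine (measure_symmDiff_le _ (T'.1 ⁻¹' (T.1^[i] ⁻¹' A)) _).trans ?_
    have hm : MeasurableSet ((T'.1^[i] ⁻¹' A) ∆ (T.1^[i] ⁻¹' A)) :=
      (T'.1.measurable.iterate i hA).symmDiff hB
    have h1 := T'.2.measure_preimage hm.nullMeasurableSet
    rw [preimage_symmDiff] at h1
    simp only [Function.iterate_succ, preimage_comp]
    rw [h1]

/-- Values of `f` with the same integer part of `f / δ` differ by less than `δ`. Finitely many of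
these level sets carry all but `ε / 2` of the mass, and the preimages of each vary continuously. -/
lemma tendsto_measure_comp_iterate_sub [IsFiniteMeasure μ] (T : ErgodicAut μ) {f : X → ℝ}
    (hf : Measurable f) (i : ℕ) {δ : ℝ} (hδ : 0 < δ) :
    Tendsto (fun T' : ErgodicAut μ => μ {x | δ ≤ |f (T'.1^[i] x) - f (T.1^[i] x)|})
      (𝓝 T) (𝓝 0) := by
  set q : X → ℤ := fun x => ⌊f x / δ⌋ with hq
  have hqm : Measurable q := (hf.div_const δ).floor
  let V : ℕ → Set X := fun N => {x | (N : ℤ) < |q x|}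
  have hVm : ∀ N, MeasurableSet (V N) := fun N =>
    hqm (to_countable {z : ℤ | (N : ℤ) < |z|}).measurableSet
  have hV : Tendsto (fun N => μ (V N)) atTop (𝓝 0) := by
    have h := tendsto_measure_iInter_atTop (μ := μ) (s := V)
      (fun N => (hVm N).nullMeasurableSet)
      (fun M N hMN x hx => lt_of_le_of_lt (Int.ofNat_le.2 hMN) hx) ⟨0, measure_ne_top _ _⟩
    have h0 : ⋂ N, V N = ∅ := by
      refine eq_empty_of_forall_notMem fun x hx => ?_
      have := mem_iInter.1 hx (q x).natAbs
      simp [V] at this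
    rwa [h0, measure_empty] at h
  rw [ENNReal.tendsto_nhds_zero]
  intro ε hε
  have hε2 : 0 < ε / 2 := ENNReal.half_pos hε.ne'
  obtain ⟨N, hN⟩ := ((ENNReal.tendsto_nhds_zero.1 hV) _ hε2).exists
  have hsum : Tendsto (fun T' : ErgodicAut μ => ∑ j ∈ Finset.Icc (-(N : ℤ)) N,
      μ ((T'.1^[i] ⁻¹' (q ⁻¹' {j})) ∆ (T.1^[i] ⁻¹' (q ⁻¹' {j})))) (𝓝 T) (𝓝 0) := by
    have := tendsto_finsetSum (Finset.Icc (-(N : ℤ)) N) fun j _ =>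
      tendsto_measure_preimage_iterate_symmDiff T i (hqm (measurableSet_singleton j))
    simpa using this
  filter_upwards [(ENNReal.tendsto_nhds_zero.1 hsum) _ hε2] with T' hT'
  calc μ {x | δ ≤ |f (T'.1^[i] x) - f (T.1^[i] x)|}
      ≤ μ ((⋃ j ∈ Finset.Icc (-(N : ℤ)) N,
          (T'.1^[i] ⁻¹' (q ⁻¹' {j})) ∆ (T.1^[i] ⁻¹' (q ⁻¹' {j}))) ∪ T.1^[i] ⁻¹' V N) := by
        refine measure_mono fun x hx => ?_
        by_cases hxV : T.1^[i] x ∈ V N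
        · exact Or.inr hxV
        · left
          have hle : |q (T.1^[i] x)| ≤ N := not_lt.1 hxV
          refine mem_iUnion₂.2 ⟨q (T.1^[i] x), Finset.mem_Icc.2 (abs_le.1 hle), Or.inr ⟨rfl, ?_⟩⟩
          intro (heq : q (T'.1^[i] x) = q (T.1^[i] x))
          have h1 := Int.abs_sub_lt_one_of_floor_eq_floor heq
          rw [← sub_div, abs_div, abs_of_pos hδ, div_lt_one hδ] at h1
          exact absurd hx (not_le.2 h1)
    _ ≤ ε / 2 + ε / 2 := by
        refine (measure_union_le _ _).trans (add_le_add ?_ ?_)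
        · exact (measure_biUnion_finset_le _ _).trans hT'
        · rwa [(T.2.toMeasurePreserving.iterate i).measure_preimage (hVm N).nullMeasurableSet]
    _ = ε := ENNReal.add_halves ε

lemma tendsto_measure_birkhoffSum_sub [IsFiniteMeasure μ] (T : ErgodicAut μ) {f : X → ℝ}
    (hf : Measurable f) (n : ℕ) {δ : ℝ} (hδ : 0 < δ) :
    Tendsto (fun T' : ErgodicAut μ => μ {x | δ ≤ |birkhoffSum T'.1 f n x - birkhoffSum T.1 f n x|})
      (𝓝 T) (𝓝 0) := by
  -- Dividing by `n + 1` covers `n = 0` and makes the total strictly less than `δ`.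
  have hδn : 0 < δ / (n + 1) := by positivity
  have hsum : Tendsto (fun T' : ErgodicAut μ => ∑ i ∈ Finset.range n,
      μ {x | δ / (n + 1) ≤ |f (T'.1^[i] x) - f (T.1^[i] x)|}) (𝓝 T) (𝓝 0) := by
    have := tendsto_finsetSum (Finset.range n) fun i _ =>
      tendsto_measure_comp_iterate_sub T hf i hδn
    simpa using this
  refine tendsto_of_tendsto_of_tendsto_of_le_of_le tendsto_const_nhds hsum
    (fun _ => zero_le) fun T' => ?_
  refine (measure_mono fun x (hx : δ ≤ _) => ?_).trans (measure_biUnion_finset_le _ _)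
  by_contra h
  simp only [mem_iUnion, mem_ofPred_eq, not_exists, not_le] at h
  have h1 : |birkhoffSum T'.1 f n x - birkhoffSum T.1 f n x| ≤ n * (δ / (n + 1)) := by
    simp only [birkhoffSum]
    rw [← Finset.sum_sub_distrib]
    refine (Finset.abs_sum_le_sum_abs _ _).trans ?_
    refine (Finset.sum_le_sum fun i hi => (h i hi).le).trans ?_
    simp
  have h2 : n * (δ / (n + 1)) < δ := by
    rw [← mul_div_assoc, div_lt_iff₀ (by positivity)]
    nlinarith
  linarith

/-- The transformations whose Birkhoff sums of `f` exceed `K` in absolute value only on sets of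
measure at most `1 / 8`. -/
def boundedBirkhoff (μ : Measure X) (f : X → ℝ) (K : ℝ) : Set (ErgodicAut μ) :=
  {T | ∀ n, μ.real {x | K < |birkhoffSum T.1 f n x|} ≤ 1 / 8}

/-- If the sums exceed `K` on measure above `1 / 8`, then by continuity of measure they exceed `K +
δ` on measure above `1 / 8` for some `δ > 0`. Convergence in measure of the sums then gives the same
for all nearby transformations, with threshold `K`. -/
lemma isClosed_boundedBirkhoff [IsFiniteMeasure μ] {f : X → ℝ} (hf : Measurable f) (K : ℝ) :
    IsClosed (boundedBirkhoff μ f K) := by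
  rw [← isOpen_compl_iff, isOpen_iff_mem_nhds]
  intro T hT
  obtain ⟨n, hn⟩ : ∃ n, 1 / 8 < μ.real {x | K < |birkhoffSum T.1 f n x|} := by
    by_contra! h
    exact hT h
  obtain ⟨m, hm⟩ : ∃ m : ℕ,
      1 / 8 < μ.real {x | K + 1 / ((m : ℝ) + 1) < |birkhoffSum T.1 f n x|} := by
    have h := tendsto_measure_iUnion_atTop (μ := μ)
      (s := fun m : ℕ => {x | K + 1 / ((m : ℝ) + 1) < |birkhoffSum T.1 f n x|})
      (fun a b hab x (hx : _ < _) => lt_of_le_of_lt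
        (add_le_add_right (Nat.one_div_le_one_div hab) K) hx)
    have hU : ⋃ m : ℕ, {x | K + 1 / ((m : ℝ) + 1) < |birkhoffSum T.1 f n x|} =
        {x | K < |birkhoffSum T.1 f n x|} := by
      ext x
      simp only [mem_iUnion, mem_ofPred_eq]
      refine ⟨fun ⟨m, h⟩ => lt_trans (by simp; positivity) h, fun h => ?_⟩
      obtain ⟨m, hm⟩ := exists_nat_one_div_lt (sub_pos.2 h)
      exact ⟨m, by linarith⟩
    rw [hU] at h
    have h2 := (ENNReal.tendsto_toReal (measure_ne_top μ _)).comp h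
    exact (h2.eventually (lt_mem_nhds hn)).exists
  set δ : ℝ := 1 / ((m : ℝ) + 1) with hδ
  have hδ0 : 0 < δ := by positivity
  have ht := (ENNReal.tendsto_toReal ENNReal.zero_ne_top).comp
    (tendsto_measure_birkhoffSum_sub T hf n hδ0)
  simp only [ENNReal.toReal_zero] at ht
  filter_upwards [ht.eventually (gt_mem_nhds (sub_pos.2 hm))] with T' hT' hmem
  have h1 : μ.real {x | δ ≤ |birkhoffSum T'.1 f n x - birkhoffSum T.1 f n x|} <
    μ.real {x | K + δ < |birkhoffSum T.1 f n x|} - 1 / 8 := hT'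
  have h2 : μ.real {x | K + δ < |birkhoffSum T.1 f n x|} ≤
      μ.real {x | K < |birkhoffSum T'.1 f n x|} +
      μ.real {x | δ ≤ |birkhoffSum T'.1 f n x - birkhoffSum T.1 f n x|} := by
    refine le_trans (measureReal_mono (fun x (hx : K + δ < _) => ?_) (measure_ne_top _ _))
      (measureReal_union_le _ _)
    rcases le_or_gt δ |birkhoffSum T'.1 f n x - birkhoffSum T.1 f n x| with h | h
    · exact Or.inr h
    · left
      have h3 := abs_sub_abs_le_abs_sub (birkhoffSum T.1 f n x) (birkhoffSum T'.1 f n x)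
      rw [abs_sub_comm] at h3
      show K < _
      linarith
  have := hmem n
  linarith

end WeakContinuity

/-! ### Meagreness in the weak and the uniform topology. -/

section Meagre

variable {X : Type*} [MeasurableSpace X] {μ : Measure X}

/-- The balls are given as a subbase only; the triangle inequality makes them a base. -/
lemma exists_ball_subset_of_isOpen_uniform {U : Set (ErgodicAut μ)}
    (hU : IsOpen[ErgodicAut.uniformTopology μ] U) {T : ErgodicAut μ} (hT : T ∈ U) :
    ∃ ε : ℝ≥0∞, ε ≠ 0 ∧ ∀ T' : ErgodicAut μ, μ {x | T'.1 x ≠ T.1 x} < ε → T' ∈ U := by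
  induction hU with
  | basic U h =>
    obtain ⟨S, ε, hε, rfl⟩ := h
    have hlt : μ {x | T.1 x ≠ S.1 x} < ε := hT
    refine ⟨ε - μ {x | T.1 x ≠ S.1 x}, (tsub_pos_of_lt hlt).ne', fun T' hT' => ?_⟩
    refine lt_of_le_of_lt ?_ (lt_tsub_iff_right.1 hT')
    refine (measure_mono fun x (hx : T'.1 x ≠ S.1 x) => ?_).trans (measure_union_le _ _)
    by_cases h : T'.1 x = T.1 x
    · exact Or.inr fun h' => hx (h.trans h')
    · exact Or.inl h
  | univ => exact ⟨1, one_ne_zero, fun _ _ => trivial⟩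
  | inter U V _ _ hU hV =>
    obtain ⟨a, ha, haU⟩ := hU hT.1
    obtain ⟨b, hb, hbV⟩ := hV hT.2
    exact ⟨min a b, (lt_min ha.bot_lt hb.bot_lt).ne', fun T' h =>
      ⟨haU T' (h.trans_le (min_le_left _ _)), hbV T' (h.trans_le (min_le_right _ _))⟩⟩
  | sUnion S _ ih =>
    obtain ⟨U, hU, hTU⟩ := hT
    obtain ⟨a, ha, haU⟩ := ih U hU hTU
    exact ⟨a, ha, fun T' h => ⟨U, hU, haU T' h⟩⟩

/-- The images of a set can differ only within the two images of the set where `S` and `T` disagree.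
Hence the uniform topology is finer than the weak one. -/
lemma measure_image_symmDiff_le (S T : ErgodicAut μ) (A : Set X) :
    μ ((S.1 '' A) ∆ (T.1 '' A)) ≤ 2 * μ {x | S.1 x ≠ T.1 x} := by
  set D := {x | S.1 x ≠ T.1 x} with hD
  have himage : ∀ R : ErgodicAut μ, μ (R.1 '' D) = μ D := fun R => by
    rw [R.1.image_eq_preimage_symm]
    exact (MeasurePreserving.symm R.1 R.2.toMeasurePreserving).measure_preimage_equiv D
  calc μ ((S.1 '' A) ∆ (T.1 '' A)) ≤ μ (S.1 '' D ∪ T.1 '' D) := by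
        refine measure_mono ?_
        rintro y (⟨⟨x, hx, rfl⟩, hy⟩ | ⟨⟨x, hx, rfl⟩, hy⟩)
        · exact Or.inl ⟨x, fun h => hy ⟨x, hx, h.symm⟩, rfl⟩
        · exact Or.inr ⟨x, fun h => hy ⟨x, hx, h⟩, rfl⟩
    _ ≤ μ (S.1 '' D) + μ (T.1 '' D) := measure_union_le _ _
    _ = 2 * μ D := by rw [himage, himage, two_mul]

lemma uniformTopology_le_weakTopology :
    ErgodicAut.uniformTopology μ ≤ ErgodicAut.weakTopology μ := by
  refine le_generateFrom ?_
  rintro _ ⟨S, A, ε, hA, hε, rfl⟩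
  let _ := ErgodicAut.uniformTopology μ
  rw [isOpen_iff_mem_nhds]
  intro T hT
  have hlt : μ ((T.1 '' A) ∆ (S.1 '' A)) < ε := hT
  set η := (ε - μ ((T.1 '' A) ∆ (S.1 '' A))) / 2 with hη
  have hη0 : 0 < η := ENNReal.half_pos (tsub_pos_of_lt hlt).ne'
  have ho : IsOpen {T' : ErgodicAut μ | μ {x | T'.1 x ≠ T.1 x} < η} :=
    .basic _ ⟨T, η, hη0, rfl⟩
  filter_upwards [ho.mem_nhds (by simpa using hη0)] with T' (hT' : μ _ < η)
  refine lt_of_le_of_lt (measure_symmDiff_le _ (T.1 '' A) _) ?_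
  refine lt_of_le_of_lt (add_le_add_left (measure_image_symmDiff_le T' T A) _) ?_
  refine lt_tsub_iff_right.1 ?_
  rw [mul_comm]
  exact (ENNReal.lt_div_iff_mul_lt (by simp) (by simp)).1 hT'

/-- The Birkhoff sums telescope to `g - g ∘ T^[n]`. For large `K` each of the two terms exceeds `K /
2` in absolute value on measure below `1 / 16` only, whatever `n` is. -/
lemma exists_mem_boundedBirkhoff [IsFiniteMeasure μ] {f : X → ℝ} {T : ErgodicAut μ} {g : X → ℝ}
    (h : IsCoboundarySolution μ f T g) : ∃ K : ℕ, T ∈ boundedBirkhoff μ f K := by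
  obtain ⟨hg, hfg⟩ := h
  let V : ℕ → Set X := fun K => {x | (K : ℝ) / 2 < |g x|}
  have hVm : ∀ K, MeasurableSet (V K) := fun K => measurableSet_lt measurable_const hg.abs
  have hV : Tendsto (fun K => μ.real (V K)) atTop (𝓝 0) := by
    have h := tendsto_measure_iInter_atTop (μ := μ) (s := V)
      (fun N => (hVm N).nullMeasurableSet)
      (fun M N hMN x (hx : (N : ℝ) / 2 < |g x|) =>
        show (M : ℝ) / 2 < |g x| from lt_of_le_of_lt (by gcongr) hx) ⟨0, measure_ne_top _ _⟩
    have h0 : ⋂ N, V N = ∅ := by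
      refine eq_empty_of_forall_notMem fun x hx => ?_
      obtain ⟨K, hK⟩ := exists_nat_ge (2 * |g x|)
      have : (K : ℝ) / 2 < |g x| := mem_iInter.1 hx K
      linarith
    rw [h0, measure_empty] at h
    exact (ENNReal.tendsto_toReal ENNReal.zero_ne_top).comp h
  obtain ⟨K, hK⟩ := (hV.eventually (gt_mem_nhds (show (0 : ℝ) < 1 / 16 by norm_num))).exists
  refine ⟨K, fun n => ?_⟩
  have hae : ∀ᵐ x ∂μ, birkhoffSum T.1 f n x = g x - g (T.1^[n] x) := by
    have h1 : ∀ᵐ x ∂μ, ∀ i, f (T.1^[i] x) = g (T.1^[i] x) - g (T.1 (T.1^[i] x)) :=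
      ae_all_iff.2 fun i =>
        (T.2.toMeasurePreserving.iterate i).quasiMeasurePreserving.ae hfg
    filter_upwards [h1] with x hx
    simp only [birkhoffSum, hx, ← Function.iterate_succ_apply']
    exact Finset.sum_range_sub' (fun i => g (T.1^[i] x)) n
  have hle : μ {x | (K : ℝ) < |birkhoffSum T.1 f n x|} ≤ μ (V K ∪ T.1^[n] ⁻¹' V K) := by
    refine measure_mono_ae ?_
    filter_upwards [hae] with x hx (hK' : _ < _)
    rw [hx] at hK'
    by_contra hc
    have hc1 : |g x| ≤ K / 2 := not_lt.1 fun h => hc (Or.inl h)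
    have hc2 : |g (T.1^[n] x)| ≤ K / 2 := not_lt.1 fun h => hc (Or.inr h)
    have := abs_sub (g x) (g (T.1^[n] x))
    linarith
  have hn : μ.real (T.1^[n] ⁻¹' V K) = μ.real (V K) :=
    (T.2.toMeasurePreserving.iterate n).measureReal_preimage (hVm K).nullMeasurableSet
  have h2 : μ.real {x | (K : ℝ) < |birkhoffSum T.1 f n x|} ≤ μ.real (V K ∪ T.1^[n] ⁻¹' V K) :=
    ENNReal.toReal_mono (measure_ne_top _ _) hle
  have h3 := measureReal_union_le (μ := μ) (V K) (T.1^[n] ⁻¹' V K)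
  linarith

lemma isMeagre_of_isClosed {Y : Type*} [TopologicalSpace Y] {s : Set Y} {F : ℕ → Set Y}
    (hF : ∀ K, IsClosed (F K)) (hintg : ∀ K, interior (F K) = ∅) (hs : s ⊆ ⋃ K, F K) :
    IsMeagre s :=
  isMeagre_iff_countable_union_isNowhereDense.2 ⟨range F,
    forall_mem_range.2 fun K => (hF K).isNowhereDense_iff.2 (hintg K), countable_range F, by
      rwa [sUnion_range]⟩

variable [StandardBorelSpace X] [IsProbabilityMeasure μ] [NullSingletonClass μ]

lemma not_subset_boundedBirkhoff {f : X → ℝ} (hf : Measurable f) (hf0 : μ {x | f x ≠ 0} ≠ 0)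
    (K : ℝ) {U : Set (ErgodicAut μ)} (hU : IsOpen[ErgodicAut.uniformTopology μ] U)
    (hsub : U ⊆ boundedBirkhoff μ f K) : U = ∅ := by
  refine eq_empty_of_forall_notMem fun T hT => ?_
  obtain ⟨ε, hε, hball⟩ := exists_ball_subset_of_isOpen_uniform hU hT
  obtain ⟨T', hT', n, hn⟩ := exists_near_abs_birkhoffSum_large T hf hf0 hε K
  exact absurd (hsub (hball T' hT') n) (not_le.2 hn)

/-- For `f` not almost everywhere zero, the set of transformations for which `f` is a coboundary
is meagre in every topology between the weak and the uniform one. -/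
lemma isMeagre_coboundarySolution {f : X → ℝ} (hf : AEMeasurable f μ)
    (hf0 : μ {x | f x ≠ 0} ≠ 0) (t : TopologicalSpace (ErgodicAut μ))
    (hu : ErgodicAut.uniformTopology μ ≤ t) (hw : t ≤ ErgodicAut.weakTopology μ) :
    IsMeagre {T : ErgodicAut μ | ∃ g : X → ℝ, IsCoboundarySolution μ f T g} := by
  have hmk := hf.ae_eq_mk
  have hf0' : μ {x | hf.mk f x ≠ 0} ≠ 0 := by
    have : μ {x | hf.mk f x ≠ 0} = μ {x | f x ≠ 0} := by
      refine measure_congr ?_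
      filter_upwards [hmk] with x hx
      exact congrArg (· ≠ 0) hx.symm
    rwa [this]
  -- Closedness is inherited from the weak topology. The interior for `t` is open for the uniform
  -- topology, where density of large Birkhoff sums shows that it is empty.
  refine isMeagre_of_isClosed (F := fun K : ℕ => boundedBirkhoff μ (hf.mk f) K)
    (fun K => (isClosed_boundedBirkhoff hf.measurable_mk K).mono hw) (fun K => ?_) ?_
  · exact not_subset_boundedBirkhoff hf.measurable_mk hf0' K (hu _ isOpen_interior)
      interior_subset
  · rintro T ⟨g, hg, hfg⟩
    refine mem_iUnion.2 (exists_mem_boundedBirkhoff ⟨hg, ?_⟩)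
    filter_upwards [hmk, hfg] with x h1 h2
    rw [← h1, h2]

end Meagre

end Coboundary

theorem theorem3 {X : Type*} [MeasurableSpace X] [StandardBorelSpace X]
    (μ : Measure X) [IsProbabilityMeasure μ] [NullSingletonClass μ]
    (f : X → ℝ) (hf : AEMeasurable f μ) :
    (0 < μ {x | f x ≠ 0} →
      @IsMeagre (ErgodicAut μ) (ErgodicAut.weakTopology μ)
          {T : ErgodicAut μ | ∃ g : X → ℝ, IsCoboundarySolution μ f T g} ∧
      @IsMeagre (ErgodicAut μ) (ErgodicAut.uniformTopology μ)
          {T : ErgodicAut μ | ∃ g : X → ℝ, IsCoboundarySolution μ f T g}) ∧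
    ((∃ (T : ErgodicAut μ) (g : X → ℝ), IsCoboundarySolution μ f T g) ↔
      ∫⁻ x in {x | 0 < f x}, ENNReal.ofReal (f x) ∂μ =
        ∫⁻ x in {x | f x < 0}, ENNReal.ofReal (-f x) ∂μ) := by
  refine ⟨fun h0 => ⟨?_, ?_⟩, Coboundary.exists_coboundarySolution_iff hf⟩
  · exact Coboundary.isMeagre_coboundarySolution hf h0.ne' _
      Coboundary.uniformTopology_le_weakTopology le_rfl
  · exact Coboundary.isMeagre_coboundarySolution hf h0.ne' _ le_rfl
      Coboundary.uniformTopology_le_weakTopology
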